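/- **Machines.** The convolution of words $w_1,\dots,w_k$ over a finite alphabet $\Gamma$ is the word whose $p$-th letter is the tuple of the $p$-th letters of $w_1,\dots,w_k$, shorter words being filled up with a new symbol $\#$. A $k$-ary relation on $\Gamma^*$ is *automatic* if the set of convolutions of its tuples is a regular language; a function $(\Gamma^*)^k\to\Gamma^*$ is *automatic* if its graph is automatic. A *deterministic automatic register machine* (DARM) has a finite machine alphabet $\Gamma$ containing the input alphabet, finitely many registers holding words over $\Gamma$ (initially empty), and a program, i.e. a finite list of numbered instructions of the following kinds: read the input word into a register; write a register; assign a fixed word over the input alphabet to a register; copy a register; assign to a register the value of an automatic function of some registers; jump to a line; jump to a line if an automatic relation holds for some registers; halt (and accept, or reject). One step is the execution of one line. A *polynomial-size padded* machine (PARM) has, instead of the read instruction, an instruction $\mathrm{read\_and\_boost}(R_i,R_j,p)$ with a polynomial $p$, which can be executed only once in a run and assigns the input word $x$ to $R_i$ and a padding word $0^\ell$ to $R_j$, where $\ell\ge p(|x|)$ is chosen by an adversary. $\mathrm{DAL}[f(n)]$ (resp. $\mathrm{PDAL}[f(n)]$) is the class of languages $L$ over finite alphabets for which some DARM (resp. deterministic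 PARM) decides $L$ (accepts the words in $L$ and rejects all others) within $O(f(n))$ steps on inputs of length $n$, for PARMs no matter which padding lengths the adversary chooses. Put $\mathrm{DAL}[o(n)]=\bigcup_{f\in o(n)}\mathrm{DAL}[f(n)]$, $\mathrm{PDAL}[o(n)]=\bigcup_{f\in o(n)}\mathrm{PDAL}[f(n)]$ and $\mathrm{PDAL}[\mathrm{polylog}\,n]=\bigcup_{k}\mathrm{PDAL}[(\log n)^k]$. **3SAT.** A 3CNF formula is a finite list of clauses, each consisting of three literals (repetitions allowed). A formula has $h$ variables if $h$ is least such that all its variables are among $x_0,\dots,x_{h-1}$. Formulas are encoded over the alphabet $\{0,1,+,-,|,\&\}$: a literal is the binary numeral of the index of its variable followed by its sign $+$ or $-$, the literals of a clause are separated by $|$, and the clauses by $\&$. For $c\in\mathbb N$, *$(c\log n)$-variable 3SAT* is the language of encodings $w$ of satisfiable 3CNF formulas with at most $c\lfloor\log_2 n\rfloor$ variables, where $n=|w|$ (and $\lfloor \log_2 0\rfloor:=0$). **ETH.** There is a $\delta>0$ such that no deterministic one-tape Turing machine decides the satisfiability of all 3CNF formulas, given by their encodings, in time $O\big(2^{\delta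 h}\cdot (l+1)^{k}\big)$ for some constant $k$, where $h$ is the number of variables and $l$ the length of the encoding of the formula. **Theorem.** 1. Over every finite alphabet, $\mathrm{DAL}[o(n)]\subseteq\mathrm{PDAL}[o(n)]$. 2. For every $c\in\mathbb N$, $(c\log n)$-variable 3SAT is in $\mathrm{PDAL}[\mathrm{polylog}\,n]$. 3. If ETH is true then $\mathrm{PDAL}[o(n)]\ne\mathrm{DAL}[o(n)]$; more precisely, $\mathrm{DAL}[o(n)]\subsetneq\mathrm{PDAL}[o(n)]$ already for languages over the alphabet $\{0,1,+,-,|,\&\}$, and there is a $c_0$ such that for every natural number $c\ge c_0$, $(c\log n)$-variable 3SAT is in $\mathrm{PDAL}[o(n)]$ but not in $\mathrm{DAL}[o(n)]$. -/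

import Mathlib

namespace AutReg

open Filter Asymptotics

/-! ## Convolutions, automatic relations and automatic functions -/

/-- The convolution of finitely many words: position `p` of the convolution carries the tuple of
the `p`-th letters, where `none` plays the role of the padding symbol `#` for the shorter words. -/
def conv {ι Γ : Type} [Fintype ι] (w : ι → List Γ) : List (ι → Option Γ) :=
  (List.range (Finset.univ.sup fun i => (w i).length)).map fun p i => (w i)[p]?

/-- A relation on `k`-tuples of words is automatic if its set of convolutions is regular. -/
def IsAutomaticRel {Γ : Type} {k : ℕ} (R : (Fin k → List Γ) → Prop) : Prop :=
  Language.IsRegular ({u | ∃ w, R w ∧ conv w = u} : Language (Fin k → Option Γ))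

/-- A function of `k` words is automatic if its graph is automatic
(the last component of the tuple is the value). -/
def IsAutomaticFun {Γ : Type} {k : ℕ} (F : (Fin k → List Γ) → List Γ) : Prop :=
  IsAutomaticRel fun v : Fin (k + 1) → List Γ => v (Fin.last k) = F fun i => v i.castSucc

/-! ## Deterministic automatic register machines -/

/-- The three ways of halting. -/
inductive Verdict
  | halt
  | accept
  | reject

/-- Instructions of a deterministic automatic register machine with input alphabet `A`, machine
alphabet `Γ` and `r` registers. Operations are automatic functions, tests are automatic relations.
Line numbers are natural numbers, the first line being line `0`. -/
inductive Instr (A Γ : Type) (r : ℕ)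
  /-- assign the input word to register `i` -/
  | read (i : Fin r)
  /-- assign the input word, of length `n` say, to register `i`, and then a padding word `0^l`,
  whose length `l ≥ p(n)` is chosen by an adversary, to register `j` -/
  | readBoost (i j : Fin r) (p : Polynomial ℕ)
  /-- output the content of register `i` -/
  | write (i : Fin r)
  /-- assign a fixed word over the input alphabet to register `i` -/
  | const (i : Fin r) (w : List A)
  /-- assign the content of register `j` to register `i` -/
  | copy (i j : Fin r)
  /-- assign the value of an automatic function of some registers to register `i` -/
  | op (i : Fin r) (k : ℕ) (F : (Fin k → List Γ) → List Γ) (hF : IsAutomaticFun F)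
      (args : Fin k → Fin r)
  /-- unconditional jump -/
  | goto (line : ℕ)
  /-- jump if an automatic relation holds for some registers -/
  | ifGoto (k : ℕ) (R : (Fin k → List Γ) → Prop) (hR : IsAutomaticRel R)
      (args : Fin k → Fin r) (line : ℕ)
  /-- halt, halt and accept, or halt and reject -/
  | halt (v : Verdict)

/-- Deterministic automatic register machines over the input alphabet `A`. -/
structure Machine (A : Type) where
  /-- the machine alphabet -/
  Γ : Type
  finΓ : Finite Γ
  /-- the input alphabet is part of the machine alphabet -/
  emb : A ↪ Γ
  /-- the letter `0` of padding words -/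
  zero : Γ
  /-- the number of registers -/
  r : ℕ
  /-- the program -/
  prog : List (Instr A Γ r)

/-- Configurations: next line, register contents, whether a padding word has been generated
already, the words written so far, and how the machine has halted (if it has). -/
structure Config (Γ : Type) (r : ℕ) where
  pc : ℕ
  regs : Fin r → List Γ
  boosted : Bool
  out : List (List Γ)
  result : Option Verdict

namespace Machine

variable {A : Type}

/-- Initially all registers are empty and the program starts in its first line. -/
def init (M : Machine A) : Config M.Γ M.r :=
  ⟨0, fun _ => [], false, [], none⟩

open Classical in
/-- The effect of one instruction on input `x`, where the adversary lets the padding word exceed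
its required minimal length by `m`. A padding word can be generated only once in a run; a second
attempt blocks the machine (it stays in its configuration forever, without halting). -/
noncomputable def exec (M : Machine A) (x : List A) (m : ℕ) (c : Config M.Γ M.r) :
    Instr A M.Γ M.r → Config M.Γ M.r
  | .read i => { c with pc := c.pc + 1, regs := Function.update c.regs i (x.map M.emb) }
  | .readBoost i j p =>
      if c.boosted then c
      else { c with
        pc := c.pc + 1
        regs := Function.update (Function.update c.regs i (x.map M.emb)) j
          (List.replicate (p.eval x.length + m) M.zero)
        boosted := true }
  | .write i => { c with pc := c.pc + 1, out := c.out ++ [c.regs i] }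
  | .const i w => { c with pc := c.pc + 1, regs := Function.update c.regs i (w.map M.emb) }
  | .copy i j => { c with pc := c.pc + 1, regs := Function.update c.regs i (c.regs j) }
  | .op i _ F _ args =>
      { c with pc := c.pc + 1, regs := Function.update c.regs i (F fun a => c.regs (args a)) }
  | .goto l => { c with pc := l }
  | .ifGoto _ R _ args l => { c with pc := if R fun a => c.regs (args a) then l else c.pc + 1 }
  | .halt v => { c with result := some v }

/-- One step performs one line of the program. A machine that has halted does not move any more,
and a machine that has left its program is blocked without having halted. -/
noncomputable def step (M : Machine A) (x : List A) (m : ℕ) (c : Config M.Γ M.r) :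
    Config M.Γ M.r :=
  match c.result, M.prog[c.pc]? with
  | none, some I => M.exec x m c I
  | _, _ => c

/-- The configuration after `t` steps. -/
noncomputable def run (M : Machine A) (x : List A) (m t : ℕ) : Config M.Γ M.r :=
  (M.step x m)^[t] M.init

/-- A DARM reads its input by `read` only. -/
def IsDARM (M : Machine A) : Prop := ∀ i j p, Instr.readBoost i j p ∉ M.prog

/-- A deterministic PARM reads its input by `readBoost` only. -/
def IsPARM (M : Machine A) : Prop := ∀ i, Instr.read i ∉ M.prog

/-- `M` decides `L` in `O(f(n))` steps, whatever the length of the padding word (for a DARM the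
parameter `m` has no effect). -/
def DecidesIn (M : Machine A) (L : Language A) (f : ℕ → ℝ) : Prop :=
  ∃ T : ℕ → ℕ, (fun n => (T n : ℝ)) =O[atTop] f ∧ ∀ (x : List A) (m : ℕ),
    (x ∈ L → (M.run x m (T x.length)).result = some .accept) ∧
    (x ∉ L → (M.run x m (T x.length)).result = some .reject)

end Machine

/-- `DAL[f(n)]`, for languages over `A`. -/
def DAL (A : Type) (f : ℕ → ℝ) : Set (Language A) :=
  {L | ∃ M : Machine A, M.IsDARM ∧ M.DecidesIn L f}

/-- `PDAL[f(n)]`, for languages over `A`. -/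
def PDAL (A : Type) (f : ℕ → ℝ) : Set (Language A) :=
  {L | ∃ M : Machine A, M.IsPARM ∧ M.DecidesIn L f}

/-- `DAL[o(n)]`. -/
def DALSublinear (A : Type) : Set (Language A) :=
  {L | ∃ f : ℕ → ℝ, f =o[atTop] (fun n => (n : ℝ)) ∧ L ∈ DAL A f}

/-- `PDAL[o(n)]`. -/
def PDALSublinear (A : Type) : Set (Language A) :=
  {L | ∃ f : ℕ → ℝ, f =o[atTop] (fun n => (n : ℝ)) ∧ L ∈ PDAL A f}

/-- `PDAL[polylog n]`. -/
def PDALPolylog (A : Type) : Set (Language A) :=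
  {L | ∃ k : ℕ, L ∈ PDAL A (fun n => Real.log n ^ k)}

/-! ## 3SAT in binary encoding -/

/-- The letters `0`, `1`, `+`, `-`, `|`, `&` of the encoding. -/
inductive SatSym
  | zero
  | one
  | plus
  | minus
  | bar
  | amp
  deriving DecidableEq

/-- The literal `x_var` (if `pos`) or its negation. -/
structure Literal where
  var : ℕ
  pos : Bool

/-- Clauses have three literals (repetitions are allowed). -/
abbrev Clause := Fin 3 → Literal

/-- 3CNF formulas, as lists of clauses. -/
abbrev Formula := List Clause

/-- Some truth assignment makes a literal of every clause true. -/
def Formula.Satisfiable (φ : Formula) : Prop :=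
  ∃ v : ℕ → Bool, ∀ C ∈ φ, ∃ a : Fin 3, v (C a).var = (C a).pos

/-- The number `h` of variables: the least `h` such that all variables of the formula are among
`x_0, …, x_{h-1}`. -/
def Formula.numVars (φ : Formula) : ℕ :=
  (φ.map fun C => Finset.univ.sup fun a : Fin 3 => (C a).var + 1).foldr max 0

/-- The binary numeral of `i`, most significant digit first, without leading zeros. -/
def encodeNat (i : ℕ) : List SatSym :=
  if i = 0 then [.zero]
  else (Nat.digits 2 i).reverse.map fun d => if d = 0 then .zero else .one

/-- A literal is written as the numeral of its variable, followed by its sign. -/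
def encodeLiteral (l : Literal) : List SatSym :=
  encodeNat l.var ++ [if l.pos then .plus else .minus]

/-- The literals of a clause are separated by `|`. -/
def encodeClause (C : Clause) : List SatSym :=
  [SatSym.bar].intercalate (List.ofFn fun a => encodeLiteral (C a))

/-- The clauses of a formula are separated by `&`. -/
def Formula.encode (φ : Formula) : List SatSym :=
  [SatSym.amp].intercalate (φ.map encodeClause)

/-- `(c log n)`-variable 3SAT: the encodings of satisfiable 3CNF formulas that have at most
`c ⌊log₂ n⌋` variables, `n` being the length of the encoding. -/
def logVar3SAT (c : ℕ) : Language SatSym :=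
  {w | ∃ φ : Formula, φ.encode = w ∧ φ.numVars ≤ c * Nat.log 2 w.length ∧ φ.Satisfiable}

/-! ## One-tape Turing machines and the Exponential Time Hypothesis -/

/-- Head moves. -/
inductive Move
  | left
  | right
  | stay

/-- Deterministic Turing machines with input alphabet `A` and one tape that is infinite to the
right. -/
structure TuringMachine (A : Type) where
  /-- the tape alphabet -/
  Γ : Type
  finΓ : Finite Γ
  /-- the states -/
  Q : Type
  finQ : Finite Q
  blank : Γ
  emb : A ↪ Γ
  emb_ne_blank : ∀ a, emb a ≠ blank
  start : Q
  accept : Q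
  reject : Q
  accept_ne_reject : accept ≠ reject
  δ : Q → Γ → Q × Γ × Move

/-- Configurations of a Turing machine; the leftmost cell is cell `0`. -/
structure TMConfig (Γ Q : Type) where
  state : Q
  head : ℕ
  tape : ℕ → Γ

namespace TuringMachine

variable {A : Type}

/-- The input is written on the leftmost cells, the head scans the leftmost cell. -/
def init (M : TuringMachine A) (x : List A) : TMConfig M.Γ M.Q :=
  ⟨M.start, 0, fun p => (x.map M.emb).getD p M.blank⟩

/-- The new head position; a left move in the leftmost cell has no effect. -/
def move (p : ℕ) : Move → ℕ
  | .left => p - 1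
  | .right => p + 1
  | .stay => p

open Classical in
/-- One step; the machine rests once it is in its accepting or rejecting state. -/
noncomputable def step (M : TuringMachine A) (c : TMConfig M.Γ M.Q) : TMConfig M.Γ M.Q :=
  if c.state = M.accept ∨ c.state = M.reject then c
  else
    let d := M.δ c.state (c.tape c.head)
    ⟨d.1, move c.head d.2.2, Function.update c.tape c.head d.2.1⟩

/-- The configuration after `t` steps. -/
noncomputable def run (M : TuringMachine A) (x : List A) (t : ℕ) : TMConfig M.Γ M.Q :=
  M.step^[t] (M.init x)

end TuringMachine

/-- `M` decides the satisfiability of every 3CNF formula `φ` with `h` variables and encoding length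
`l` in at most `C * 2^(δ h) * (l + 1)^k` steps, for some constants `C` and `k`. -/
def SolvesThreeSAT (M : TuringMachine SatSym) (δ : ℝ) : Prop :=
  ∃ (C : ℝ) (k : ℕ), ∀ φ : Formula, ∃ t : ℕ,
    (t : ℝ) ≤ C * (2 : ℝ) ^ (δ * (φ.numVars : ℝ)) * ((φ.encode.length : ℝ) + 1) ^ k ∧
    (φ.Satisfiable → (M.run φ.encode t).state = M.accept) ∧
    (¬ φ.Satisfiable → (M.run φ.encode t).state = M.reject)

/-- The Exponential Time Hypothesis: for some `δ > 0`, 3SAT with `h` variables cannot be solved in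
time `2^(δ h)`, up to factors that are polynomial in the length of the formula. -/
def ETH : Prop :=
  ∃ δ : ℝ, 0 < δ ∧ ∀ M : TuringMachine SatSym, ¬ SolvesThreeSAT M δ

end AutReg

set_option linter.unusedSectionVars false

/-! Inclusion. A PARM can read the input once, together with a padding word that it ignores, keep it
in a spare register and replace every `read` by a copy. This costs one additional step
(`readOnceSim_run`).

Polylogarithmic upper bound. Let the padding have length `N ≥ n ^ c + n + 1`. A position `p < N` is
regarded as the truth assignment that gives `x_i` the `i`-th binary digit of `p`; since `2 ^ (c log
n) ≤ N`, all assignments to the admissible variables occur, and one automatic function works on all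
of them in parallel. The machine enumerates the triples of variables lexicographically. For the
current triple, three tracks hold the three corresponding bits of every position, and below each
numeral of the formula stands a counter whose zeros mark the literals with the current variables. A
left automaton collects the sign patterns of the clauses over the current triple, of which there are
at most eight, and every position tests its assignment against them. Passing to the next variable is
local: a counter is decremented with the help of an automaton that reads from the right, and bit `j
+ 1` of the positions changes exactly where bit `j` falls (`testBit_succ_eq`, `stP_div`). A round is
therefore computed by a bimachine, whose output is an automatic function (`isAutomaticFun_bmFun`),
and there are at most `(c log n + 1) ^ 3` triples. The bound on the number of variables is checked
beforehand: `n` marks are halved `log n` times, with `c` decrements of all counters for each halving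
(`IsChk.iterate`). `IsChk.outcome` combines the phases.

Lower bound under ETH. An automatic function lengthens its arguments by at most a constant
(`IsAutomaticFun.exists_length_le`), and it can be evaluated by one pass to the right, which
performs a subset construction, and one pass back, which traces an accepting run
(`exists_updateJob`). So `T` steps of a DARM cost a one-tape Turing machine `O(T)` sweeps over `O(n
+ T)` cells (`exists_sweepJobs`). To decide a formula with `h` variables, append tautological
clauses until its length `n` satisfies `h ≤ c log n`; this needs at most `J = 2 ^ (h / c + 1)`
clauses. Whether the length suffices is asked of the DARM itself, on the formula with all signs made
positive: that formula is satisfiable, so the verdict depends on the length only. A last run decides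
the padded formula. With at most linearly many steps per run, the total time is `O((l + 1) ^ 2 * J ^
4)`, which is within `2 ^ (δ h)` up to a polynomial factor once `c δ ≥ 4` (`exists_solvesThreeSAT`).
-/

namespace AutReg

open Filter Asymptotics

/-! ### Valid convolutions of words -/

section Conv

variable {ι Γ : Type} [Fintype ι]

/-- The number of letters of a convolution. -/
def convLength (w : ι → List Γ) : ℕ := Finset.univ.sup fun i => (w i).length

theorem length_le_convLength (w : ι → List Γ) (i : ι) : (w i).length ≤ convLength w :=
  Finset.le_sup (f := fun i => (w i).length) (Finset.mem_univ i)

theorem convLength_le {w : ι → List Γ} {N : ℕ} (h : ∀ i, (w i).length ≤ N) : convLength w ≤ N :=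
  Finset.sup_le fun i _ => h i

theorem conv_def (w : ι → List Γ) :
    conv w = (List.range (convLength w)).map fun p i => (w i)[p]? := rfl

@[simp] theorem length_conv (w : ι → List Γ) : (conv w).length = convLength w := by
  simp [conv_def]

theorem exists_lt_length_of_lt_convLength {w : ι → List Γ} {p : ℕ} (h : p < convLength w) :
    ∃ i, p < (w i).length := by
  by_contra! hc
  exact absurd (convLength_le hc) (not_le.2 h)

theorem exists_ne_none_of_mem_conv {w : ι → List Γ} {a : ι → Option Γ} (h : a ∈ conv w) :
    ∃ i, a i ≠ none := by
  rw [conv_def, List.mem_map] at h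
  obtain ⟨p, hp, rfl⟩ := h
  obtain ⟨i, hi⟩ := exists_lt_length_of_lt_convLength (List.mem_range.1 hp)
  exact ⟨i, by simp [hi]⟩

theorem map_range_eq_conv_append (w : ι → List Γ) {N : ℕ} (h : ∀ i, (w i).length ≤ N) :
    ((List.range N).map fun p i => (w i)[p]?) =
      conv w ++ List.replicate (N - convLength w) fun _ => none := by
  have hN := convLength_le h
  apply List.ext_getElem
  · simp; omega
  · intro p h1 h2
    rw [List.getElem_append]
    split_ifs with h3
    · simp [conv_def]
    · simp only [List.getElem_map, List.getElem_range, List.getElem_replicate]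
      funext i
      have := length_le_convLength w i
      simp only [length_conv] at h3
      simp; omega

/-- In a valid convolution the padding symbol is never followed by a letter. -/
def PaddedRight (u : List (ι → Option Γ)) : Prop :=
  u.Pairwise fun a b => ∀ i, a i = none → b i = none

/-- All letters precede the padding, so discarding the padding only cuts off a tail and moves no
letter. -/
theorem getElem?_reduceOption {l : List (Option Γ)}
    (h : l.Pairwise fun a b => a = none → b = none) (p : ℕ) :
    l.reduceOption[p]? = (l[p]?).join := by
  induction l generalizing p with
  | nil => simp
  | cons a l ih =>
    rw [List.pairwise_cons] at h
    cases a with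
    | none =>
      have hl : ∀ b ∈ l, b = none := fun b hb => h.1 b hb rfl
      have h0 : l.reduceOption = [] := by
        rw [List.reduceOption, List.filterMap_eq_nil_iff]
        intro b hb; rw [hl b hb]; rfl
      rw [List.reduceOption_cons_of_none, h0]
      cases p with
      | zero => simp
      | succ p =>
        cases hp : l[p]? with
        | none => simp [hp]
        | some b => simp [hp, hl b (List.mem_of_getElem? hp)]
    | some a =>
      rw [List.reduceOption_cons_of_some]
      cases p with
      | zero => simp
      | succ p => simpa using ih h.2 p

/-- Each component word is recovered by discarding its padding. Excluding letters that consist of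
padding only guarantees that the longest recovered word is as long as `u`. -/
theorem exists_conv_eq_iff {u : List (ι → Option Γ)} :
    (∃ w, conv w = u) ↔ (∀ a ∈ u, ∃ i, a i ≠ none) ∧ PaddedRight u := by
  constructor
  · rintro ⟨w, rfl⟩
    refine ⟨fun a => exists_ne_none_of_mem_conv, ?_⟩
    rw [PaddedRight, conv_def, List.pairwise_map]
    refine List.pairwise_lt_range.imp ?_
    intro p q hpq i hi
    simp only [List.getElem?_eq_none_iff] at hi ⊢
    omega
  · rintro ⟨h1, h2⟩
    have key : ∀ (i : ι) (p : ℕ), ((u.map (· i)).reduceOption)[p]? = (u[p]?).bind (· i) := by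
      intro i p
      rw [getElem?_reduceOption]
      · simp [List.getElem?_map, Option.bind, Option.join]
        cases u[p]? <;> rfl
      · rw [List.pairwise_map]
        exact h2.imp fun h => h i
    refine ⟨fun i => (u.map (· i)).reduceOption, ?_⟩
    have hlen : ∀ i, ((u.map (· i)).reduceOption).length ≤ u.length := by
      intro i
      simpa using List.reduceOption_length_le (u.map (· i))
    have h3 := map_range_eq_conv_append (fun i => (u.map (· i)).reduceOption) hlen
    have h4 : (List.range u.length).map (fun p i => ((u.map (· i)).reduceOption)[p]?) = u := by
      apply List.ext_getElem
      · simp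
      · intro p h5 h6
        simp only [List.getElem_map, List.getElem_range]
        funext i
        rw [key, List.getElem?_eq_getElem h6]; rfl
    rw [h4] at h3
    have h5 : u.length - convLength (fun i => (u.map (· i)).reduceOption) = 0 := by
      by_contra hc
      obtain ⟨m, hm⟩ := Nat.exists_eq_succ_of_ne_zero hc
      have : (fun _ => none : ι → Option Γ) ∈ u := by
        rw [h3, hm]; simp
      obtain ⟨i, hi⟩ := h1 _ this
      exact hi rfl
    rw [h5] at h3
    simpa using h3.symm

theorem conv_injective [Nonempty ι] : Function.Injective (conv (ι := ι) (Γ := Γ)) := by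
  intro v w h
  have hl : convLength v = convLength w := by rw [← length_conv, h, length_conv]
  funext i
  apply List.ext_getElem?
  intro p
  by_cases hp : p < convLength v
  · have h1 : (conv v)[p]? = (conv w)[p]? := by rw [h]
    simp only [conv_def, List.getElem?_map, List.getElem?_range hp,
      List.getElem?_range (hl ▸ hp), Option.map_some, Option.some.injEq] at h1
    exact congrFun h1 i
  · have h1 := length_le_convLength v i
    have h2 := length_le_convLength w i
    rw [List.getElem?_eq_none (by omega), List.getElem?_eq_none (by omega)]

end Conv

/-! ### Closure properties of regular languages and first automatic relations -/

section Regular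

variable {ι Γ : Type} [Fintype ι]

/-- The automaton that checks that the padding symbol is never followed by a letter; it remembers
which components have ended. -/
noncomputable def paddingDFA (ι Γ : Type) : DFA (ι → Option Γ) (Option (Set ι)) :=
  open Classical in
  { step := fun s a => s.bind fun E =>
      if (∃ i, a i ≠ none) ∧ ∀ i ∈ E, a i = none then some {i | a i = none} else none
    start := some ∅
    accept := {s | s ≠ none} }

theorem paddingDFA_evalFrom_none (u : List (ι → Option Γ)) :
    (paddingDFA ι Γ).evalFrom none u = none := by
  induction u with
  | nil => rfl
  | cons a u ih => rw [DFA.evalFrom_cons]; exact ih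

/-- The set `E` of components that have already ended is arbitrary, for the sake of the induction;
the start state is the case `E = ∅`. -/
theorem paddingDFA_evalFrom_some (u : List (ι → Option Γ)) (E : Set ι) :
    (paddingDFA ι Γ).evalFrom (some E) u ≠ none ↔
      (∀ a ∈ u, (∃ i, a i ≠ none) ∧ ∀ i ∈ E, a i = none) ∧ PaddedRight u := by
  classical
  induction u generalizing E with
  | nil => simp [PaddedRight]
  | cons a u ih =>
    rw [DFA.evalFrom_cons]
    have hs : (paddingDFA ι Γ).step (some E) a =
      if (∃ i, a i ≠ none) ∧ ∀ i ∈ E, a i = none then some {i | a i = none} else none := by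
      simp only [paddingDFA, Option.bind_some]
      congr
    rw [hs]
    split_ifs with h
    · rw [ih, PaddedRight, PaddedRight, List.pairwise_cons]
      simp only [List.mem_cons, forall_eq_or_imp]
      constructor
      · rintro ⟨h1, h2⟩
        exact ⟨⟨h, fun b hb => ⟨(h1 b hb).1, fun i hi => (h1 b hb).2 i (h.2 i hi)⟩⟩,
          fun b hb i hi => (h1 b hb).2 i hi, h2⟩
      · rintro ⟨⟨-, h1⟩, h2, h3⟩
        exact ⟨fun b hb => ⟨(h1 b hb).1, fun i hi => h2 b hb i hi⟩, h3⟩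
    · rw [paddingDFA_evalFrom_none]
      simp only [ne_eq, not_true_eq_false, List.mem_cons, forall_eq_or_imp, false_iff, not_and]
      intro h1
      exact absurd h1.1 h

theorem isRegular_range_conv : Language.IsRegular {u | ∃ w : ι → List Γ, conv w = u} := by
  classical
  have : Fintype (Option (Set ι)) := Fintype.ofFinite _
  refine ⟨Option (Set ι), inferInstance, paddingDFA ι Γ, ?_⟩
  ext u
  have h := paddingDFA_evalFrom_some u (∅ : Set ι)
  rw [DFA.mem_accepts]
  refine Iff.trans h ?_
  refine Iff.trans ?_ exists_conv_eq_iff.symm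
  simp

/-- To show that a relation is automatic, it suffices to recognize it among valid convolutions. -/
theorem isAutomaticRel_of_isRegular {k : ℕ} {R : (Fin k → List Γ) → Prop}
    {L : Language (Fin k → Option Γ)} (hL : L.IsRegular) (h : ∀ w, conv w ∈ L ↔ R w) :
    IsAutomaticRel R := by
  unfold IsAutomaticRel
  suffices h0 : ({u | ∃ w, R w ∧ conv w = u} : Language (Fin k → Option Γ)) =
      L ⊓ {u | ∃ w : Fin k → List Γ, conv w = u} by
    rw [h0]; exact hL.inf isRegular_range_conv
  ext u
  constructor
  · rintro ⟨w, hw, rfl⟩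
    exact ⟨(h w).2 hw, w, rfl⟩
  · rintro ⟨h1, w, rfl⟩
    exact ⟨w, (h w).1 h1, rfl⟩

theorem isRegular_of_nfa {α σ : Type} [Finite σ] (M : NFA α σ) : M.accepts.IsRegular := by
  classical
  have : Fintype (Set σ) := Fintype.ofFinite _
  exact ⟨Set σ, inferInstance, M.toDFA, NFA.toDFA_correct⟩

theorem isRegular_of_dfa {α σ : Type} [Finite σ] (M : DFA α σ) : M.accepts.IsRegular := by
  have : Fintype σ := Fintype.ofFinite _
  exact ⟨σ, inferInstance, M, rfl⟩

theorem isRegular_setOf_forall_mem {α : Type} (P : α → Prop) :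
    Language.IsRegular {u : List α | ∀ a ∈ u, P a} := by
  suffices h0 : ({u : List α | ∀ a ∈ u, P a} : Language α) =
      DFA.accepts (α := α) (σ := Prop)
        { step := fun s a => s ∧ P a, start := True, accept := {s | s} } by
    rw [h0]; exact isRegular_of_dfa _
  refine Language.ext fun u => ?_
  change (∀ a ∈ u, P a) ↔ DFA.evalFrom (α := α) (σ := Prop)
    { step := fun s a => s ∧ P a, start := True, accept := {s | s} } True u
  have : ∀ s : Prop, DFA.evalFrom (α := α) (σ := Prop)
      { step := fun s a => s ∧ P a, start := True, accept := {s | s} } s u ↔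
      (s ∧ ∀ a ∈ u, P a) := by
    induction u with
    | nil => simp
    | cons a u ih =>
      intro s
      rw [DFA.evalFrom_cons, ih]
      simp [and_assoc]
  exact (by simpa using (this True).symm)

/-- Myhill–Nerode: the nonempty left quotients of `{u}` are the singletons of suffixes of `u`, hence
finitely many. -/
theorem isRegular_singleton {α : Type} (u : List α) : Language.IsRegular ({u} : Set (List α)) := by
  apply Language.IsRegular.of_finite_range_leftQuotient
  refine Set.Finite.subset (s := insert ∅ ((fun s => ({s} : Set (List α))) '' {s | s ∈ u.tails}))
    (Set.Finite.insert _ (Set.Finite.image _ (List.finite_toSet _))) ?_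
  rintro _ ⟨x, rfl⟩
  by_cases h : ∃ s, x ++ s = u
  · obtain ⟨s, hs⟩ := h
    refine Or.inr ⟨s, by simpa using ⟨x, hs⟩, ?_⟩
    ext y
    change y = s ↔ x ++ y = u
    rw [← hs]; simp
  · left
    ext y
    change x ++ y = u ↔ False
    exact ⟨fun hy => h ⟨y, hy⟩, False.elim⟩

/-- A regular language is an automatic unary relation. -/
theorem isAutomaticRel_mem {L : Language Γ} (hL : L.IsRegular) :
    IsAutomaticRel fun v : Fin 1 → List Γ => v 0 ∈ L := by
  obtain ⟨σ, _, M, rfl⟩ := hL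
  have e : ∀ v : Fin 1 → List Γ, conv v = (v 0).map fun a _ => some a := by
    intro v
    have : convLength v = (v 0).length := by simp [convLength]
    apply List.ext_getElem
    · simp [this]
    · intro p h1 h2
      simp only [conv_def, List.getElem_map, List.getElem_range]
      funext i
      rw [Subsingleton.elim i 0]
      simp at h2; simp [h2]
  let M' : DFA (Fin 1 → Option Γ) σ :=
    { step := fun s a => match a 0 with
        | some x => M.step s x
        | none => s
      start := M.start
      accept := M.accept }
  refine isAutomaticRel_of_isRegular (isRegular_of_dfa M') fun v => ?_
  rw [e, DFA.mem_accepts, DFA.mem_accepts]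
  have : ∀ (l : List Γ) (s : σ), M'.evalFrom s (l.map fun a _ => some a) = M.evalFrom s l := by
    intro l
    induction l with
    | nil => intro s; rfl
    | cons a l ih => intro s; exact ih _
  rw [DFA.eval, this]; rfl

/-- Together with `isAutomaticFun_id` this lets the Turing machine treat `const`, `read` and `copy`
in the same way as `op`. -/
theorem isAutomaticFun_const (u : List Γ) :
    IsAutomaticFun fun _ : Fin 0 → List Γ => u := by
  unfold IsAutomaticFun IsAutomaticRel
  suffices h0 : ({c | ∃ w : Fin 1 → List Γ, w (Fin.last 0) = u ∧ conv w = c} :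
      Language (Fin 1 → Option Γ)) = ({conv fun _ : Fin 1 => u} : Set _) by
    rw [h0]; exact isRegular_singleton _
  ext c
  constructor
  · rintro ⟨w, hw, rfl⟩
    have : w = fun _ => u := by
      funext i; rw [Subsingleton.elim i (Fin.last 0)]; exact hw
    rw [this]; rfl
  · rintro rfl
    exact ⟨fun _ => u, rfl, rfl⟩

theorem isAutomaticFun_id : IsAutomaticFun fun v : Fin 1 → List Γ => v 0 := by
  refine isAutomaticRel_of_isRegular
    (isRegular_setOf_forall_mem fun a : Fin 2 → Option Γ => a 1 = a 0) fun w => ?_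
  change (∀ a ∈ conv w, a 1 = a 0) ↔ w 1 = w 0
  constructor
  · intro h
    apply List.ext_getElem?
    intro p
    by_cases hp : p < convLength w
    · exact h _ (by rw [conv_def]; exact List.mem_map.2 ⟨p, List.mem_range.2 hp, rfl⟩)
    · have h1 := length_le_convLength w 0
      have h2 := length_le_convLength w 1
      rw [List.getElem?_eq_none (by omega), List.getElem?_eq_none (by omega)]
  · intro h a ha
    rw [conv_def, List.mem_map] at ha
    obtain ⟨p, -, rfl⟩ := ha
    simp [h]

end Regular

/-! ### Automata on padded streams, and the growth of automatic functions -/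

section Streams

variable {ι Γ : Type} [Fintype ι]

/-- `D`, followed by any number of letters that consist of padding symbols only. -/
noncomputable def padDFA {σ : Type} (D : DFA (ι → Option Γ) σ) :
    DFA (ι → Option Γ) (Option (σ × Bool)) :=
  open Classical in
  { step := fun s a => s.bind fun s =>
      if a = (fun _ => none) then some (s.1, true)
      else if s.2 then none else some (D.step s.1 a, false)
    start := some (D.start, false)
    accept := {s | ∃ q ∈ D.accept, ∃ b, s = some (q, b)} }

theorem padDFA_evalFrom_of_ne {σ : Type} (D : DFA (ι → Option Γ) σ) (s : σ)
    (u : List (ι → Option Γ)) (h : ∀ a ∈ u, a ≠ fun _ => none) :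
    (padDFA D).evalFrom (some (s, false)) u = some (D.evalFrom s u, false) := by
  classical
  induction u generalizing s with
  | nil => rfl
  | cons a u ih =>
    rw [DFA.evalFrom_cons, DFA.evalFrom_cons, ← ih _ fun b hb => h b (by simp [hb])]
    congr 1
    have := h a (by simp)
    simp [padDFA, this]

theorem padDFA_evalFrom_true {σ : Type} (D : DFA (ι → Option Γ) σ) (s : σ) (m : ℕ) (b : Bool) :
    ∃ b', (padDFA D).evalFrom (some (s, b)) (List.replicate m fun _ => none) = some (s, b') := by
  classical
  induction m generalizing b with
  | zero => exact ⟨b, rfl⟩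
  | succ m ih =>
    rw [List.replicate_succ, DFA.evalFrom_cons]
    have : (padDFA D).step (some (s, b)) (fun _ => none) = some (s, true) := by simp [padDFA]
    rw [this]; exact ih _

theorem padDFA_evalFrom_none {σ : Type} (D : DFA (ι → Option Γ) σ) (u : List (ι → Option Γ)) :
    (padDFA D).evalFrom none u = none := by
  induction u with
  | nil => rfl
  | cons a u ih => rw [DFA.evalFrom_cons]; exact ih

/-- After the first all-padding letter only such letters keep the run alive, so a surviving word is
a part read by `D` followed by padding. The flag `b` tells that the padding has begun, and then
nothing is left for `D`. -/
theorem padDFA_evalFrom_eq_some {σ : Type} {D : DFA (ι → Option Γ) σ} {u : List (ι → Option Γ)}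
    {s t : σ} {b b' : Bool} (h : (padDFA D).evalFrom (some (s, b)) u = some (t, b')) :
    ∃ u₀ m, u = u₀ ++ List.replicate m (fun _ => none) ∧ D.evalFrom s u₀ = t ∧
      (b = true → u₀ = []) := by
  classical
  induction u generalizing s b with
  | nil =>
    simp only [DFA.evalFrom_nil, Option.some.injEq, Prod.mk.injEq] at h
    exact ⟨[], 0, rfl, h.1, fun _ => rfl⟩
  | cons a u ih =>
    rw [DFA.evalFrom_cons] at h
    have hs : (padDFA D).step (some (s, b)) a = if a = (fun _ => none) then some (s, true)
      else if b then none else some (D.step s a, false) := by simp [padDFA]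
    rw [hs] at h
    split_ifs at h with h1 h2
    · obtain ⟨u₀, m, rfl, h3, h4⟩ := ih h
      have := h4 rfl
      subst this
      exact ⟨[], m + 1, by simp [h1, List.replicate_succ], h3, fun _ => rfl⟩
    · rw [padDFA_evalFrom_none] at h; exact absurd h (by simp)
    · obtain ⟨u₀, m, rfl, h3, h4⟩ := ih h
      exact ⟨a :: u₀, m, rfl, h3, fun h => absurd h h2⟩

/-- An automatic relation is recognized by a finite automaton that reads words as sequences which
end with arbitrarily many padding symbols. -/
theorem IsAutomaticRel.exists_dfa {k : ℕ} {R : (Fin k → List Γ) → Prop} (hR : IsAutomaticRel R) :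
    ∃ (σ : Type) (_ : Finite σ) (D : DFA (Fin k → Option Γ) σ),
      ∀ (N : ℕ) (t : ℕ → Fin k → Option Γ), D.eval ((List.range N).map t) ∈ D.accept ↔
        ∃ w, R w ∧ (∀ i, (w i).length ≤ N) ∧ ∀ p < N, ∀ i, t p i = (w i)[p]? := by
  obtain ⟨σ, _, D, hD⟩ := hR
  refine ⟨Option (σ × Bool), inferInstance, padDFA D, fun N t => ?_⟩
  constructor
  · rintro ⟨q, hq, b, h⟩
    obtain ⟨u₀, m, h1, h2, -⟩ := padDFA_evalFrom_eq_some h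
    have h3 : u₀ ∈ D.accepts := by rw [DFA.mem_accepts, DFA.eval, h2]; exact hq
    rw [hD] at h3
    obtain ⟨w, hw, rfl⟩ := h3
    have hlen : convLength w + m = N := by
      have := congrArg List.length h1
      simpa using this.symm
    have hl : ∀ i, (w i).length ≤ N := fun i =>
      (length_le_convLength w i).trans (by omega)
    refine ⟨w, hw, hl, fun p hp i => ?_⟩
    have h4 := map_range_eq_conv_append w hl
    rw [show N - convLength w = m by omega, ← h1] at h4
    have h5 := List.map_inj_left.1 h4 p (List.mem_range.2 hp)
    exact (congrFun h5 i).symm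
  · rintro ⟨w, hw, hl, h⟩
    have h1 : (List.range N).map t = (List.range N).map fun p i => (w i)[p]? :=
      List.map_congr_left fun p hp => funext fun i => h p (List.mem_range.1 hp) i
    have h2 : conv w ∈ D.accepts := by rw [hD]; exact ⟨w, hw, rfl⟩
    rw [h1, map_range_eq_conv_append w hl, DFA.eval, DFA.evalFrom_of_append]
    have h3 : (padDFA D).evalFrom (padDFA D).start (conv w) = some (D.eval (conv w), false) :=
      padDFA_evalFrom_of_ne D _ _ fun a ha h0 => by
        obtain ⟨i, hi⟩ := exists_ne_none_of_mem_conv ha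
        exact hi (by rw [h0])
    rw [h3]
    obtain ⟨b, hb⟩ := padDFA_evalFrom_true D (D.eval (conv w)) (N - convLength w) false
    rw [hb]
    exact ⟨_, h2, b, rfl⟩

/-- The value of an automatic function is at most a constant longer than the arguments. -/
theorem IsAutomaticFun.exists_length_le {k : ℕ} {F : (Fin k → List Γ) → List Γ}
    (hF : IsAutomaticFun F) : ∃ K, ∀ v, (F v).length ≤ convLength v + K := by
  obtain ⟨σ, _, D, hD⟩ := hF
  refine ⟨Fintype.card σ, fun v => ?_⟩
  by_contra! hlt
  set n := convLength v with hn
  set w : Fin (k + 1) → List Γ := Fin.snoc (α := fun _ => List Γ) v (F v) with hw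
  have hw1 : ∀ i : Fin k, w i.castSucc = v i := fun i => by simp [hw]
  have hw2 : w (Fin.last k) = F v := by simp [hw]
  have hcl : convLength w = (F v).length := by
    apply le_antisymm
    · refine convLength_le fun i => ?_
      refine Fin.lastCases ?_ (fun i => ?_) i
      · rw [hw2]
      · rw [hw1]; have := length_le_convLength v i; omega
    · rw [← hw2]; exact length_le_convLength w _
  have hacc : conv w ∈ D.accepts := by
    rw [hD]; exact ⟨w, by simp only [hw2, hw1], rfl⟩
  have hsplit : conv w = (conv w).take n ++ (conv w).drop n := (List.take_append_drop _ _).symm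
  have hlen2 : Fintype.card σ ≤ ((conv w).drop n).length := by
    simp only [List.length_drop, length_conv]; omega
  -- Pumping in the region where all arguments have ended: a loop `b` of the automaton lies there
  -- and is deleted from the word.
  obtain ⟨q, a, b, c, habc, -, hb, h1, h2, h3⟩ := D.evalFrom_split
    (s := D.evalFrom D.start ((conv w).take n)) hlen2 rfl
  have hmem : (conv w).take n ++ a ++ c ∈ D.accepts := by
    rw [DFA.mem_accepts, DFA.eval, DFA.evalFrom_of_append, DFA.evalFrom_of_append, h1, h3,
      ← DFA.evalFrom_of_append, ← hsplit]
    exact hacc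
  rw [hD] at hmem
  obtain ⟨w', hw', hc'⟩ := hmem
  have hbpos : 0 < b.length := List.length_pos_of_ne_nil hb
  have hlen3 : (conv w).length = n + (a.length + b.length + c.length) := by
    have := congrArg List.length habc
    simp only [List.length_drop, length_conv, List.length_append] at this
    rw [length_conv]; omega
  have hcl' : convLength w' = n + (a.length + c.length) := by
    rw [← length_conv, hc']
    simp only [List.length_append, List.length_take]; omega
  have hget : ∀ (p : ℕ) (i : Fin (k + 1)), p < n → (w' i)[p]? = (w i)[p]? := by
    intro p i hp
    have h4 : (conv w')[p]? = (conv w)[p]? := by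
      rw [hc', List.append_assoc, List.getElem?_append_left (by simp; omega),
        List.getElem?_take_of_lt hp]
    simp only [conv_def, List.getElem?_map] at h4
    rw [List.getElem?_range (by omega), List.getElem?_range (by rw [length_conv] at hlen3; omega)] at h4
    simp only [Option.map_some, Option.some.injEq] at h4
    exact congrFun h4 i
  -- The letters of the shortened word from position `n` on all come from the tail of `conv w`,
  -- where the arguments show padding; so the deletion leaves the arguments unchanged.
  have hge : ∀ (i : Fin k), (w' i.castSucc).length ≤ n := by
    intro i
    by_contra! hc
    have hcl2 := length_le_convLength w' i.castSucc
    have h4 : (conv w')[n]? = some fun i => (w' i)[n]? := by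
      rw [conv_def, List.getElem?_map, List.getElem?_range (by omega)]; rfl
    have h5 : (fun i => (w' i)[n]?) ∈ (conv w).drop n := by
      rw [habc]
      have : (fun i => (w' i)[n]?) ∈ (conv w').drop n := by
        have h6 : ((conv w').drop n)[0]? = some fun i => (w' i)[n]? := by
          rw [List.getElem?_drop]; simpa using h4
        exact List.mem_of_getElem? h6
      rw [hc', List.append_assoc, List.drop_append_of_le_length (by simp; omega),
        List.drop_eq_nil_of_le (by simp)] at this
      simp only [List.nil_append, List.mem_append] at this ⊢
      tauto
    rw [List.mem_iff_getElem?] at h5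
    obtain ⟨p, hp⟩ := h5
    rw [List.getElem?_drop, conv_def, List.getElem?_map, Option.map_eq_some_iff] at hp
    obtain ⟨p', hp1, hp2⟩ := hp
    have hp3 : p' = n + p := by
      rw [List.getElem?_eq_some_iff] at hp1
      obtain ⟨h7, h8⟩ := hp1
      simpa using h8.symm
    have h9 := congrFun hp2 i.castSucc
    simp only [hw1] at h9
    rw [List.getElem?_eq_none (by have := length_le_convLength v i; omega)] at h9
    rw [eq_comm, List.getElem?_eq_none_iff] at h9
    omega
  have hveq : ∀ i : Fin k, w' i.castSucc = v i := by
    intro i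
    apply List.ext_getElem?
    intro p
    by_cases hp : p < n
    · rw [hget p _ hp, hw1]
    · have h1 := length_le_convLength v i
      have h2 := hge i
      rw [List.getElem?_eq_none (by omega), List.getElem?_eq_none (by omega)]
  -- Since `F` is a function, equal arguments force the same value, which no longer fits into the
  -- shortened convolution.
  have h4 : w' (Fin.last k) = F v := by rw [hw']; simp only [hveq]
  have h5 := length_le_convLength w' (Fin.last k)
  rw [h4, hcl'] at h5
  rw [length_conv, hcl] at hlen3
  omega

end Streams

/-! ### Runs of register machines -/

section RunLemmas

variable {A : Type} (M : Machine A) (x : List A) (m : ℕ)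

namespace Machine

theorem run_succ (t : ℕ) : M.run x m (t + 1) = M.step x m (M.run x m t) := by
  rw [run, Function.iterate_succ_apply']; rfl

theorem run_add (s t : ℕ) : M.run x m (s + t) = (M.step x m)^[t] (M.run x m s) := by
  rw [run, run, Nat.add_comm, Function.iterate_add_apply]

theorem step_of_result_ne_none {c : Config M.Γ M.r} (h : c.result ≠ none) :
    M.step x m c = c := by
  unfold step
  cases hr : c.result with
  | none => exact absurd hr h
  | some v => rfl

theorem iterate_step_of_result_ne_none {c : Config M.Γ M.r} (h : c.result ≠ none) (t : ℕ) :
    (M.step x m)^[t] c = c := by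
  induction t with
  | zero => rfl
  | succ t ih => rw [Function.iterate_succ_apply', ih, step_of_result_ne_none M x m h]

/-- A machine that has halted keeps its result. -/
theorem run_result_of_le {s t : ℕ} {v : Verdict} (hst : s ≤ t)
    (h : (M.run x m s).result = some v) : (M.run x m t).result = some v := by
  obtain ⟨d, rfl⟩ := Nat.exists_eq_add_of_le hst
  rw [run_add, iterate_step_of_result_ne_none M x m (by simp [h]), h]

theorem step_of_getElem? {c : Config M.Γ M.r} {I : Instr A M.Γ M.r} (h : c.result = none)
    (hI : M.prog[c.pc]? = some I) : M.step x m c = M.exec x m c I := by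
  unfold step
  rw [h, hI]

end Machine

end RunLemmas

/-! ### Reading the input only once: a DARM as a PARM -/

section ReadOnce

variable {A Γ : Type} {r : ℕ}

/-- The register that keeps the input word. -/
def inputReg (r : ℕ) : Fin (r + 2) := Fin.natAdd r 0

/-- The register that takes the padding word. -/
def padReg (r : ℕ) : Fin (r + 2) := Fin.natAdd r 1

/-- The instruction one line further down, with access to the input through a register. -/
def Instr.shift : Instr A Γ r → Instr A Γ (r + 2)
  | .read i => .copy (Fin.castAdd 2 i) (inputReg r)
  | .readBoost i j p => .readBoost (Fin.castAdd 2 i) (Fin.castAdd 2 j) p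
  | .write i => .write (Fin.castAdd 2 i)
  | .const i w => .const (Fin.castAdd 2 i) w
  | .copy i j => .copy (Fin.castAdd 2 i) (Fin.castAdd 2 j)
  | .op i k F hF args => .op (Fin.castAdd 2 i) k F hF fun a => Fin.castAdd 2 (args a)
  | .goto l => .goto (l + 1)
  | .ifGoto k R hR args l => .ifGoto k R hR (fun a => Fin.castAdd 2 (args a)) (l + 1)
  | .halt v => .halt v

/-- The machine that reads its input, together with an unused padding word, once and for all in its
first line. -/
noncomputable abbrev Machine.readOnce (M : Machine A) : Machine A where
  Γ := M.Γ
  finΓ := M.finΓ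
  emb := M.emb
  zero := M.zero
  r := M.r + 2
  prog := .readBoost (inputReg M.r) (padReg M.r) 0 :: M.prog.map Instr.shift

theorem Machine.readOnce_isPARM (M : Machine A) : M.readOnce.IsPARM := by
  intro i hi
  rcases List.mem_cons.1 hi with h | h
  · cases h
  · obtain ⟨I, -, hI⟩ := List.mem_map.1 h
    cases I <;> simp [Instr.shift] at hI

/-- The configurations of `M.readOnce` that correspond to a configuration of `M`. -/
structure ReadOnceSim (M : Machine A) (x : List A) (c : Config M.Γ M.r)
    (c' : Config M.Γ (M.r + 2)) : Prop where
  pc : c'.pc = c.pc + 1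
  regs : ∀ i, c'.regs (Fin.castAdd 2 i) = c.regs i
  input : c'.regs (inputReg M.r) = x.map M.emb
  result : c'.result = c.result

theorem castAdd_ne_inputReg (i : Fin r) : inputReg r ≠ Fin.castAdd 2 i := by
  intro h
  have := congrArg Fin.val h
  simp [inputReg] at this
  omega

theorem ReadOnceSim.update {M : Machine A} {x : List A} {c : Config M.Γ M.r}
    {c' : Config M.Γ (M.r + 2)} (h : ReadOnceSim M x c c') (i : Fin M.r) (w : List M.Γ) :
    ReadOnceSim M x { c with pc := c.pc + 1, regs := Function.update c.regs i w }
      { c' with pc := c'.pc + 1, regs := Function.update c'.regs (Fin.castAdd 2 i) w } := by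
  refine ⟨by simp [h.pc], fun j => ?_, ?_, h.result⟩
  · by_cases hj : j = i
    · subst hj; simp
    · have : Fin.castAdd 2 j ≠ Fin.castAdd 2 i := fun h => hj (Fin.castAdd_injective _ _ h)
      simp [Function.update_of_ne hj, Function.update_of_ne this, h.regs]
  · simp [Function.update_of_ne (castAdd_ne_inputReg i), h.input]

/-- No shifted instruction writes the register with the input, so copying from it always has the
effect of `read`; all other instructions act alike on the original registers. -/
theorem ReadOnceSim.step {M : Machine A} (hM : M.IsDARM) {x : List A} {m : ℕ}
    {c : Config M.Γ M.r} {c' : Config M.Γ (M.r + 2)} (h : ReadOnceSim M x c c') :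
    ReadOnceSim M x (M.step x m c) (M.readOnce.step x m c') := by
  by_cases hr : c.result = none
  swap
  · rw [M.step_of_result_ne_none x m hr,
      M.readOnce.step_of_result_ne_none x m (c := c') (by rw [h.result]; exact hr)]
    exact h
  have hget : M.readOnce.prog[c'.pc]? = (M.prog[c.pc]?).map Instr.shift := by
    rw [h.pc, ← List.getElem?_map]; exact List.getElem?_cons_succ
  cases hI : M.prog[c.pc]? with
  | none =>
    have h1 : M.step x m c = c := by unfold Machine.step; rw [hr, hI]
    have h2 : M.readOnce.step x m c' = c' := by
      unfold Machine.step; rw [hget, hI, h.result, hr]; rfl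
    rw [h1, h2]; exact h
  | some I =>
    have hmem : I ∈ M.prog := List.mem_of_getElem? hI
    rw [M.step_of_getElem? x m hr hI,
      M.readOnce.step_of_getElem? x m (c := c') (I := I.shift) (by rw [h.result, hr])
        (by rw [hget, hI]; rfl)]
    cases I with
    | read i =>
      have h1 := h.update i (x.map M.emb)
      have h2 : M.readOnce.exec x m c' (Instr.read i).shift = { c' with
          pc := c'.pc + 1, regs := Function.update c'.regs (Fin.castAdd 2 i) (x.map M.emb) } := by
        rw [← h.input]; rfl
      rw [h2]; exact h1
    | readBoost i j p => exact absurd hmem (hM i j p)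
    | write i => exact ⟨by simp [Instr.shift, Machine.exec, h.pc], h.regs, h.input, h.result⟩
    | const i w => exact h.update i _
    | copy i j =>
      have h1 := h.update i (c.regs j)
      have h2 : M.readOnce.exec x m c' (Instr.copy i j).shift = { c' with
          pc := c'.pc + 1, regs := Function.update c'.regs (Fin.castAdd 2 i) (c.regs j) } := by
        rw [← h.regs]; rfl
      rw [h2]; exact h1
    | op i k F hF args =>
      have := h.update i (F fun a => c.regs (args a))
      simp only [Instr.shift, Machine.exec, h.regs]
      exact this
    | goto l => exact ⟨rfl, h.regs, h.input, h.result⟩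
    | ifGoto k R hR args l =>
      refine ⟨?_, h.regs, h.input, h.result⟩
      have h1 : (fun a => c'.regs (Fin.castAdd 2 (args a))) = fun a => c.regs (args a) :=
        funext fun a => h.regs _
      simp only [Instr.shift, Machine.exec, h.pc]
      by_cases h2 : R fun a => c.regs (args a)
      · rw [if_pos (h1 ▸ h2 : R fun a => c'.regs (Fin.castAdd 2 (args a))), if_pos h2]
      · rw [if_neg (h1 ▸ h2 : ¬ R fun a => c'.regs (Fin.castAdd 2 (args a))), if_neg h2]
    | halt v => exact ⟨h.pc, h.regs, h.input, rfl⟩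

/-- The additional step is the initial `readBoost`. The choice `m` of the adversary does not matter,
because no shifted instruction refers to the padding register. -/
theorem readOnceSim_run {M : Machine A} (hM : M.IsDARM) (x : List A) (m t : ℕ) :
    ReadOnceSim M x (M.run x m t) (M.readOnce.run x m (t + 1)) := by
  induction t with
  | zero =>
    have h : M.readOnce.run x m 1 = M.readOnce.exec x m M.readOnce.init
        (.readBoost (inputReg M.r) (padReg M.r) 0) :=
      M.readOnce.step_of_getElem? x m (c := M.readOnce.init) rfl List.getElem?_cons_zero
    have hne : inputReg M.r ≠ padReg M.r := by
      intro h; have := congrArg Fin.val h; simp [inputReg, padReg] at this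
    rw [Nat.zero_add, h]
    refine ⟨rfl, fun i => ?_, ?_, rfl⟩
    · have h1 : Fin.castAdd 2 i ≠ padReg M.r := by
        intro h; have := congrArg Fin.val h; simp [padReg] at this; omega
      have h2 := (castAdd_ne_inputReg i).symm
      exact (Function.update_of_ne h1 _ _).trans (Function.update_of_ne h2 _ _)
    · exact (Function.update_of_ne hne _ _).trans (Function.update_self _ _ _)
  | succ t ih =>
    rw [Machine.run_succ, Machine.run_succ _ _ _ (t + 1)]
    exact ih.step hM

end ReadOnce

theorem DALSublinear_subset_PDALSublinear (A : Type) : DALSublinear A ⊆ PDALSublinear A := by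
  rintro L ⟨f, hf, M, hM, T, hT, hdec⟩
  -- The bound `f` may vanish, so it is enlarged to absorb the additional step; it remains `o(n)`.
  refine ⟨fun n => |f n| + 1, ?_, M.readOnce, M.readOnce_isPARM, fun n => T n + 1, ?_, ?_⟩
  · refine hf.abs_left.add ?_
    exact isLittleO_const_left.2 (Or.inr (tendsto_norm_atTop_atTop.comp tendsto_natCast_atTop_atTop))
  · obtain ⟨C, hC⟩ := hT.bound
    refine IsBigO.of_bound (max C 1) (hC.mono fun n hn => ?_)
    rw [Real.norm_eq_abs, Real.norm_eq_abs] at hn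
    rw [Real.norm_eq_abs, Real.norm_eq_abs, abs_of_nonneg (by positivity),
      abs_of_nonneg (by positivity : (0:ℝ) ≤ |f n| + 1)]
    have h1 := le_max_left C 1
    have h2 := le_max_right C 1
    have h3 := le_abs_self (T n : ℝ)
    have h4 := mul_le_mul_of_nonneg_right h1 (abs_nonneg (f n))
    push_cast
    linarith
  · intro x m
    have h := readOnceSim_run hM x m (T x.length)
    exact ⟨fun hx => h.result.trans ((hdec x m).1 hx), fun hx => h.result.trans ((hdec x m).2 hx)⟩

/-! ### Binary numerals and their decrement -/

section Numerals

/-- The value of a binary numeral, most significant digit first. -/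
def bitsVal : List Bool → ℕ
  | [] => 0
  | b :: l => b.toNat * 2 ^ l.length + bitsVal l

theorem bitsVal_append_singleton (l : List Bool) (b : Bool) :
    bitsVal (l ++ [b]) = 2 * bitsVal l + b.toNat := by
  induction l with
  | nil => simp [bitsVal]
  | cons a l ih => simp only [List.cons_append, bitsVal, ih, List.length_append,
      List.length_singleton, pow_succ]; ring

/-- A digit as a letter. -/
def symOfBit (b : Bool) : SatSym := if b then .one else .zero

/-- A new least significant digit is appended at the right end; for `n = 0` the old numeral `0`
would survive as a leading zero. -/
theorem encodeNat_bit {n : ℕ} (hn : n ≠ 0) (b : Bool) :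
    encodeNat (2 * n + b.toNat) = encodeNat n ++ [symOfBit b] := by
  have h1 : 2 * n + b.toNat ≠ 0 := by omega
  rw [encodeNat, if_neg h1, encodeNat, if_neg hn]
  have h2 : Nat.digits 2 (2 * n + b.toNat) = b.toNat :: Nat.digits 2 n := by
    rw [Nat.digits_def' (by norm_num) (by omega)]
    have h3 := Bool.toNat_le b
    congr 1
    · omega
    · congr 1; omega
  rw [h2]
  cases b <;> simp [symOfBit]

theorem encodeNat_zero : encodeNat 0 = [.zero] := rfl

theorem encodeNat_one : encodeNat 1 = [.one] := by simp [encodeNat]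

theorem encodeNat_bitsVal (l : List Bool) :
    encodeNat (bitsVal (true :: l)) = (true :: l).map symOfBit := by
  induction l using List.reverseRecOn with
  | nil => simp [bitsVal, encodeNat_one, symOfBit]
  | append_singleton l b ih =>
    rw [← List.cons_append, bitsVal_append_singleton, encodeNat_bit, ih]
    · simp
    · simp [bitsVal]

/-- The final alternative excludes superfluous leading zeros; the parser depends on it. -/
theorem exists_bits (i : ℕ) : ∃ l : List Bool, encodeNat i = l.map symOfBit ∧ bitsVal l = i ∧
    (l = [false] ∨ ∃ l', l = true :: l') := by
  induction i using Nat.strong_induction_on with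
  | _ i ih =>
    rcases Nat.lt_or_ge i 2 with h | h
    · interval_cases i
      · exact ⟨[false], by simp [encodeNat_zero, symOfBit], by simp [bitsVal], Or.inl rfl⟩
      · exact ⟨[true], by simp [encodeNat_one, symOfBit], by simp [bitsVal], Or.inr ⟨[], rfl⟩⟩
    · obtain ⟨l, h1, h2, h3⟩ := ih (i / 2) (by omega)
      have h4 : i = 2 * (i / 2) + (decide (i % 2 = 1)).toNat := by
        rcases Nat.mod_two_eq_zero_or_one i with h5 | h5 <;> simp [h5] <;> omega
      refine ⟨l ++ [decide (i % 2 = 1)], ?_, ?_, ?_⟩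
      · have h5 := encodeNat_bit (n := i / 2) (by omega) (decide (i % 2 = 1))
        rw [← h4, h1] at h5
        simpa using h5
      · rw [bitsVal_append_singleton, h2]; exact h4.symm
      · rcases h3 with rfl | ⟨l', rfl⟩
        · simp [bitsVal] at h2; omega
        · exact Or.inr ⟨_, rfl⟩

/-- The binary digits of a number, most significant digit first. -/
noncomputable def bitsOf (i : ℕ) : List Bool := (exists_bits i).choose

theorem encodeNat_eq (i : ℕ) : encodeNat i = (bitsOf i).map symOfBit :=
  (exists_bits i).choose_spec.1

theorem bitsVal_bitsOf (i : ℕ) : bitsVal (bitsOf i) = i := (exists_bits i).choose_spec.2.1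

theorem bitsOf_cases (i : ℕ) : bitsOf i = [false] ∨ ∃ l, bitsOf i = true :: l :=
  (exists_bits i).choose_spec.2.2

/-- All digits are zero. -/
def allZero (l : List Bool) : Bool := l.all (!·)

theorem allZero_iff (l : List Bool) : allZero l = true ↔ bitsVal l = 0 := by
  induction l with
  | nil => simp [allZero, bitsVal]
  | cons a l ih =>
    have : allZero (a :: l) = (!a && allZero l) := rfl
    rw [this, bitsVal]
    cases a <;> simp [ih]

/-- Decrement a binary numeral, cyclically. -/
def decBits : List Bool → List Bool
  | [] => []
  | b :: l => (b ^^ allZero l) :: decBits l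

@[simp] theorem length_decBits (l : List Bool) : (decBits l).length = l.length := by
  induction l with
  | nil => rfl
  | cons a l ih => simp [decBits, ih]

/-- Subtracting one flips exactly the digits that have only zeros to their right, so the borrow is
visible to an automaton reading from the right. Zero wraps around to the largest numeral of the same
length. -/
theorem bitsVal_decBits (l : List Bool) :
    bitsVal (decBits l) + 1 = if bitsVal l = 0 then 2 ^ l.length else bitsVal l := by
  induction l with
  | nil => simp [decBits, bitsVal]
  | cons a l ih =>
    rw [decBits, bitsVal, bitsVal, length_decBits, add_assoc, ih]
    have hpos : 0 < 2 ^ l.length := by positivity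
    by_cases h : bitsVal l = 0
    · have h1 := (allZero_iff l).2 h
      cases a <;> simp [h, h1, pow_succ]; ring
    · have h1 : allZero l = false := by
        rw [← Bool.not_eq_true, allZero_iff]; exact h
      cases a <;> simp [h, h1]

/-- The digits of `i` after `d` decrements. -/
noncomputable def curBits (i d : ℕ) : List Bool := decBits^[d] (bitsOf i)

theorem curBits_succ (i d : ℕ) : curBits i (d + 1) = decBits (curBits i d) := by
  rw [curBits, Function.iterate_succ_apply']; rfl

@[simp] theorem length_curBits (i d : ℕ) : (curBits i d).length = (bitsOf i).length := by
  induction d with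
  | zero => rfl
  | succ d ih => rw [curBits_succ, length_decBits, ih]

theorem bitsVal_curBits {i d : ℕ} (h : d ≤ i) : bitsVal (curBits i d) + d = i := by
  induction d with
  | zero => exact bitsVal_bitsOf i
  | succ d ih =>
    have h1 := ih (by omega)
    have h2 := bitsVal_decBits (curBits i d)
    rw [if_neg (by omega), ← curBits_succ] at h2
    omega

/-- For `d ≤ i` the counter has not yet wrapped around. Afterwards its zeros are meaningless, which
is why signs carry the mark `dead`. -/
theorem allZero_curBits {i d : ℕ} (h : d ≤ i) : allZero (curBits i d) = decide (i = d) := by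
  have := bitsVal_curBits h
  rw [Bool.eq_iff_iff, allZero_iff, decide_eq_true_iff]; omega

end Numerals

/-! ### The encodings of formulas form a regular language -/

section Parsing

/-- States of the automaton that recognizes encodings of formulas. -/
inductive ParseState
  | init
  | lit (a : Fin 3)
  | numZero (a : Fin 3)
  | numOne (a : Fin 3)
  | done (a : Fin 3)
  | fail

open ParseState in
instance : Finite ParseState := by
  refine Finite.of_injective (β := Fin 6 × Fin 3)
    (fun s => match s with
      | init => (0, 0)
      | lit a => (1, a)
      | numZero a => (2, a)
      | numOne a => (3, a)
      | done a => (4, a)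
      | fail => (5, 0)) ?_
  intro s t h
  cases s <;> cases t <;> simp_all

/-- Transitions of the automaton that recognizes encodings of formulas. -/
def parseStep : ParseState → SatSym → ParseState
  | .init, .zero => .numZero 0
  | .init, .one => .numOne 0
  | .lit a, .zero => .numZero a
  | .lit a, .one => .numOne a
  | .numZero a, .plus => .done a
  | .numZero a, .minus => .done a
  | .numOne a, .zero => .numOne a
  | .numOne a, .one => .numOne a
  | .numOne a, .plus => .done a
  | .numOne a, .minus => .done a
  | .done 0, .bar => .lit 1
  | .done 1, .bar => .lit 2
  | .done 2, .amp => .lit 0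
  | _, _ => .fail

/-- Accepting states of the automaton that recognizes encodings of formulas. -/
def parseAccept : Set ParseState := {s | s = .init ∨ s = .done 2}

theorem foldl_parseStep_fail (w : List SatSym) : w.foldl parseStep .fail = .fail := by
  induction w with
  | nil => rfl
  | cons a w ih => exact ih

theorem foldl_parseStep_numOne (a : Fin 3) (l : List Bool) :
    (l.map symOfBit).foldl parseStep (.numOne a) = .numOne a := by
  induction l with
  | nil => rfl
  | cons b l ih => cases b <;> exact ih

theorem encodeLiteral_eq (l : Literal) :
    encodeLiteral l = (bitsOf l.var).map symOfBit ++ [if l.pos then .plus else .minus] := by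
  rw [encodeLiteral, encodeNat_eq]

theorem encodeClause_eq (C : Clause) : encodeClause C =
    encodeLiteral (C 0) ++ .bar :: (encodeLiteral (C 1) ++ .bar :: encodeLiteral (C 2)) := by
  simp [encodeClause, List.ofFn_succ, List.intercalate, List.intersperse]

theorem intercalate_singleton_cons {α : Type} (s : α) (u : List α) (l : List (List α)) :
    [s].intercalate (u :: l) = u ++ l.flatMap fun v => s :: v := by
  induction l generalizing u with
  | nil => simp [List.intercalate]
  | cons v l ih =>
    have : [s].intercalate (u :: v :: l) = u ++ s :: [s].intercalate (v :: l) := by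
      simp [List.intercalate]
    rw [this, ih]; simp

theorem encode_nil : Formula.encode [] = [] := rfl

theorem encode_cons (C : Clause) (φ : Formula) : Formula.encode (C :: φ) =
    encodeClause C ++ φ.flatMap fun C => .amp :: encodeClause C := by
  rw [Formula.encode, List.map_cons, intercalate_singleton_cons, List.flatMap_map]

theorem foldl_parseStep_literal (a : Fin 3) (l : Literal) :
    (encodeLiteral l).foldl parseStep (.lit a) = .done a := by
  rw [encodeLiteral_eq, List.foldl_append]
  rcases bitsOf_cases l.var with h | ⟨l', h⟩
  · rw [h]; cases l.pos <;> rfl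
  · rw [h]
    have : ((true :: l').map symOfBit).foldl parseStep (.lit a) = .numOne a :=
      foldl_parseStep_numOne a l'
    rw [this]; cases l.pos <;> rfl

theorem foldl_parseStep_clause (C : Clause) :
    (encodeClause C).foldl parseStep (.lit 0) = .done 2 := by
  rw [encodeClause_eq, List.foldl_append, List.foldl_cons, List.foldl_append, List.foldl_cons,
    foldl_parseStep_literal]
  change List.foldl _ (parseStep (List.foldl _ (.lit 1) _) _) _ = _
  rw [foldl_parseStep_literal]
  exact foldl_parseStep_literal 2 _

/-- The states `init` and `lit 0` have the same transitions; they differ only on the empty word,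
which encodes the formula without clauses. -/
theorem foldl_parseStep_init {w : List SatSym} (hw : w ≠ []) :
    w.foldl parseStep .init = w.foldl parseStep (.lit 0) := by
  cases w with
  | nil => exact absurd rfl hw
  | cons a w => cases a <;> rfl

theorem encodeClause_ne_nil (C : Clause) : encodeClause C ≠ [] := by
  rw [encodeClause_eq]; simp

theorem foldl_parseStep_encode (φ : Formula) : φ.encode.foldl parseStep .init ∈ parseAccept := by
  cases φ with
  | nil => exact Or.inl rfl
  | cons C φ =>
    right
    rw [encode_cons, foldl_parseStep_init (by simp [encodeClause_ne_nil]), List.foldl_append,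
      foldl_parseStep_clause]
    induction φ with
    | nil => rfl
    | cons C φ ih =>
      rw [List.flatMap_cons, List.foldl_append, List.foldl_cons]
      change List.foldl _ (List.foldl _ (ParseState.lit 0) _) _ = _
      rw [foldl_parseStep_clause, ih]

theorem fail_notMem_parseAccept : ParseState.fail ∉ parseAccept := by simp [parseAccept]

/-- Digits keep the state, separators lead to `fail`, and the state itself is not accepting; so an
accepted word must leave it by a sign. -/
theorem exists_numeral_of_numOne {a : Fin 3} {w : List SatSym}
    (h : w.foldl parseStep (.numOne a) ∈ parseAccept) :
    ∃ (l : List Bool) (b : Bool) (w' : List SatSym),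
      w = l.map symOfBit ++ (if b then .plus else .minus) :: w' ∧
      w'.foldl parseStep (.done a) ∈ parseAccept := by
  induction w with
  | nil => simp [parseAccept] at h
  | cons c w ih =>
    rw [List.foldl_cons] at h
    have hf : w.foldl parseStep .fail ∉ parseAccept := by
      rw [foldl_parseStep_fail]; exact fail_notMem_parseAccept
    cases c with
    | zero =>
      obtain ⟨l, b, w', rfl, h'⟩ := ih h
      exact ⟨false :: l, b, w', rfl, h'⟩
    | one =>
      obtain ⟨l, b, w', rfl, h'⟩ := ih h
      exact ⟨true :: l, b, w', rfl, h'⟩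
    | plus => exact ⟨[], true, w, rfl, h⟩
    | minus => exact ⟨[], false, w, rfl, h⟩
    | bar => exact absurd h hf
    | amp => exact absurd h hf

theorem exists_literal_of_lit {a : Fin 3} {w : List SatSym}
    (h : w.foldl parseStep (.lit a) ∈ parseAccept) :
    ∃ (l : Literal) (w' : List SatSym), w = encodeLiteral l ++ w' ∧
      w'.foldl parseStep (.done a) ∈ parseAccept := by
  cases w with
  | nil => simp [parseAccept] at h
  | cons c w =>
    rw [List.foldl_cons] at h
    have hf : w.foldl parseStep .fail ∉ parseAccept := by
      rw [foldl_parseStep_fail]; exact fail_notMem_parseAccept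
    cases c with
    | zero =>
      cases w with
      | nil => exact absurd h (by simp [parseStep, parseAccept])
      | cons c w =>
        have hf : w.foldl parseStep .fail ∉ parseAccept := by
          rw [foldl_parseStep_fail]; exact fail_notMem_parseAccept
        cases c with
        | plus => exact ⟨⟨0, true⟩, w, rfl, h⟩
        | minus => exact ⟨⟨0, false⟩, w, rfl, h⟩
        | _ => exact absurd h hf
    | one =>
      obtain ⟨l, b, w', rfl, h'⟩ := exists_numeral_of_numOne h
      refine ⟨⟨bitsVal (true :: l), b⟩, w', ?_, h'⟩
      rw [encodeLiteral, encodeNat_bitsVal]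
      simp [symOfBit]
    | _ => exact absurd h hf

theorem exists_clause_of_lit {w : List SatSym}
    (h : w.foldl parseStep (.lit 0) ∈ parseAccept) :
    ∃ (C : Clause) (w' : List SatSym), w = encodeClause C ++ w' ∧
      (w' = [] ∨ ∃ w'', w' = .amp :: w'' ∧ w''.foldl parseStep (.lit 0) ∈ parseAccept) := by
  have hf : ∀ w : List SatSym, w.foldl parseStep .fail ∉ parseAccept := fun w => by
    rw [foldl_parseStep_fail]; exact fail_notMem_parseAccept
  have hbar : ∀ {w : List SatSym} {a b : Fin 3}, (a = 0 ∧ b = 1 ∨ a = 1 ∧ b = 2) →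
      w.foldl parseStep (.done a) ∈ parseAccept →
      ∃ w', w = .bar :: w' ∧ w'.foldl parseStep (.lit b) ∈ parseAccept := by
    intro w a b hab h
    rcases w with _ | ⟨c, w⟩
    · rcases hab with ⟨rfl, rfl⟩ | ⟨rfl, rfl⟩ <;> simp [parseAccept] at h
    · rcases hab with ⟨rfl, rfl⟩ | ⟨rfl, rfl⟩ <;> cases c
      case inl.bar => exact ⟨w, rfl, h⟩
      case inr.bar => exact ⟨w, rfl, h⟩
      all_goals exact absurd h (hf w)
  obtain ⟨l₀, w₀, rfl, h₀⟩ := exists_literal_of_lit h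
  obtain ⟨w₁, rfl, h₁⟩ := hbar (Or.inl ⟨rfl, rfl⟩) h₀
  obtain ⟨l₁, w₂, rfl, h₂⟩ := exists_literal_of_lit h₁
  obtain ⟨w₃, rfl, h₃⟩ := hbar (Or.inr ⟨rfl, rfl⟩) h₂
  obtain ⟨l₂, w₄, rfl, h₄⟩ := exists_literal_of_lit h₃
  refine ⟨![l₀, l₁, l₂], w₄, by simp [encodeClause_eq], ?_⟩
  rcases w₄ with _ | ⟨c, w⟩
  · exact Or.inl rfl
  · cases c
    case amp => exact Or.inr ⟨w, rfl, h₄⟩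
    all_goals exact absurd h₄ (hf w)

/-- Induction on a length bound: what follows `&` is parsed again from `lit 0`. This state is not
accepting, so a trailing separator is impossible. -/
theorem exists_formula_of_lit (n : ℕ) : ∀ {w : List SatSym}, w.length ≤ n →
    w.foldl parseStep (.lit 0) ∈ parseAccept →
    ∃ (C : Clause) (φ : Formula), Formula.encode (C :: φ) = w := by
  induction n with
  | zero =>
    intro w hw h
    rw [List.length_eq_zero_iff.1 (Nat.le_zero.1 hw)] at h
    simp [parseAccept] at h
  | succ n ih =>
    intro w hw h
    obtain ⟨C, w', rfl, rfl | ⟨w'', rfl, h'⟩⟩ := exists_clause_of_lit h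
    · exact ⟨C, [], by simp [encode_cons]⟩
    · obtain ⟨C', φ, rfl⟩ := ih (by simp at hw; omega) h'
      exact ⟨C, C' :: φ, by simp [encode_cons]⟩

/-- The automaton `parseStep` recognizes the encodings of formulas. -/
theorem exists_encode_eq_iff {w : List SatSym} :
    (∃ φ : Formula, φ.encode = w) ↔ w.foldl parseStep .init ∈ parseAccept := by
  constructor
  · rintro ⟨φ, rfl⟩; exact foldl_parseStep_encode φ
  · intro h
    by_cases hw : w = []
    · exact ⟨[], hw ▸ rfl⟩
    · rw [foldl_parseStep_init hw] at h
      obtain ⟨C, φ, h⟩ := exists_formula_of_lit _ le_rfl h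
      exact ⟨_, h⟩

theorem isRegular_range_encode : Language.IsRegular {w | ∃ φ : Formula, φ.encode = w} := by
  suffices h : ({w | ∃ φ : Formula, φ.encode = w} : Language SatSym) =
      DFA.accepts { step := parseStep, start := .init, accept := parseAccept } by
    rw [h]; exact isRegular_of_dfa _
  exact Language.ext fun w => exists_encode_eq_iff

end Parsing

/-! ### Bimachines compute automatic functions -/

section Bimachine

variable {α β L R : Type}

/-- The output of a bimachine, which sees, at each letter, the state of an automaton that has read
the letters to the left and the state of an automaton that has read the letters to the right. -/
def bmOut (δ : L → α → L) (ρ : α → R → R) (g : L → α → R → β) : L → List α → R → List β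
  | _, [], _ => []
  | l, a :: w, r => g l a (w.foldr ρ r) :: bmOut δ ρ g (δ l a) w r

variable (δ : L → α → L) (ρ : α → R → R) (g : L → α → R → β)

@[simp] theorem length_bmOut (l : L) (w : List α) (r : R) : (bmOut δ ρ g l w r).length = w.length := by
  induction w generalizing l with
  | nil => rfl
  | cons a w ih => simp [bmOut, ih]

theorem bmOut_append (l : L) (u v : List α) (r : R) :
    bmOut δ ρ g l (u ++ v) r =
      bmOut δ ρ g l u (v.foldr ρ r) ++ bmOut δ ρ g (u.foldl δ l) v r := by
  induction u generalizing l with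
  | nil => rfl
  | cons a u ih => simp [bmOut, ih]

/-- The bimachine that also sees the final state of the left automaton. -/
def bmFun (δ : L → α → L) (ρ : α → R → R) (g : L → L → α → R → α) (l : L) (r : R)
    (w : List α) : List α :=
  bmOut δ ρ (g (w.foldl δ l)) l w r

/-- The convolution of two words of equal length. -/
def zipConv (w y : List α) : List (Fin 2 → Option α) :=
  List.zipWith (fun a b => ![some a, some b]) w y

theorem conv_eq_zipConv {v : Fin 2 → List α} (h : (v 1).length = (v 0).length) :
    conv v = zipConv (v 0) (v 1) := by
  have hl : convLength v = (v 0).length := by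
    refine le_antisymm (convLength_le fun i => ?_) (length_le_convLength v 0)
    fin_cases i
    · exact le_rfl
    · exact h.le
  apply List.ext_getElem
  · simp [zipConv, hl, h]
  · intro p h1 h2
    simp only [length_conv, hl] at h1
    simp only [zipConv, List.getElem_zipWith, conv_def, List.getElem_map, List.getElem_range]
    funext i
    fin_cases i
    · simp [h1]
    · simp [h, h1]

/-- The automaton that guesses the right states and the final left state of a bimachine. -/
def bmNFA (δ : L → α → L) (ρ : α → R → R) (g : L → L → α → R → α) (l₀ : L) (r₀ : R) :
    NFA (Fin 2 → Option α) (L × R × L) where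
  step s a := {t | ∃ x y, a = ![some x, some y] ∧ t.1 = δ s.1 x ∧ s.2.1 = ρ x t.2.1 ∧
    t.2.2 = s.2.2 ∧ y = g s.2.2 s.1 x t.2.1}
  start := {s | s.1 = l₀}
  accept := {s | s.1 = s.2.2 ∧ s.2.1 = r₀}

/-- A state consists of the actual left state, a guess of the right state on the remaining word, and
a guess of the final left state. The first guess is checked at every letter and, at the end, against
`r₀`; the second is carried along and checked at the end. Nondeterminism is harmless, since only the
graph has to be recognized. -/
theorem mem_acceptsFrom_bmNFA (g : L → L → α → R → α) (l₀ : L) (r₀ : R)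
    (u : List (Fin 2 → Option α)) (S : Set (L × R × L)) :
    u ∈ (bmNFA δ ρ g l₀ r₀).acceptsFrom S ↔ ∃ s ∈ S, ∃ w,
      w.foldl δ s.1 = s.2.2 ∧ w.foldr ρ r₀ = s.2.1 ∧
      u = zipConv w (bmOut δ ρ (g s.2.2) s.1 w r₀) := by
  induction u generalizing S with
  | nil =>
    rw [NFA.nil_mem_acceptsFrom]
    constructor
    · rintro ⟨s, hs, h1, h2⟩
      exact ⟨s, hs, [], h1, h2.symm, rfl⟩
    · rintro ⟨s, hs, w, h1, h2, h3⟩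
      have : w = [] := by
        have := congrArg List.length h3
        simp only [zipConv, List.length_nil, List.length_zipWith, length_bmOut, min_self] at this
        exact List.length_eq_zero_iff.1 this.symm
      subst this
      exact ⟨s, hs, h1, h2.symm⟩
  | cons a u ih =>
    rw [NFA.cons_mem_acceptsFrom, ih]
    constructor
    · rintro ⟨t, ht, w, h1, h2, h3⟩
      rw [NFA.mem_stepSet] at ht
      obtain ⟨s, hs, x, y, rfl, h4, h5, h6, h7⟩ := ht
      refine ⟨s, hs, x :: w, ?_, ?_, ?_⟩
      · rw [List.foldl_cons, ← h4, h1, h6]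
      · rw [List.foldr_cons, h2, h5]
      · rw [bmOut, h3, h2, ← h7, h4, h6]; rfl
    · rintro ⟨s, hs, w, h1, h2, h3⟩
      cases w with
      | nil => simp [zipConv] at h3
      | cons x w =>
        rw [bmOut] at h3
        obtain ⟨h4, h5⟩ := List.cons.inj h3
        refine ⟨(δ s.1 x, w.foldr ρ r₀, s.2.2), ?_, w, h1, rfl, h5⟩
        rw [NFA.mem_stepSet]
        exact ⟨s, hs, x, _, h4, rfl, h2.symm, rfl, rfl⟩

/-- Bimachines compute automatic functions. -/
theorem isAutomaticFun_bmFun [Finite L] [Finite R] (g : L → L → α → R → α) (l₀ : L) (r₀ : R) :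
    IsAutomaticFun fun v : Fin 1 → List α => bmFun δ ρ g l₀ r₀ (v 0) := by
  refine isAutomaticRel_of_isRegular (isRegular_of_nfa (bmNFA δ ρ g l₀ r₀)) fun v => ?_
  change conv v ∈ (bmNFA δ ρ g l₀ r₀).acceptsFrom {s | s.1 = l₀} ↔
    v 1 = bmFun δ ρ g l₀ r₀ (v 0)
  rw [mem_acceptsFrom_bmNFA]
  constructor
  · rintro ⟨⟨l, r, gl⟩, hl, w, h1, h2, h3⟩
    obtain rfl : l = l₀ := hl
    simp only at h1 h2 h3
    have h4 : conv v = conv ![w, bmOut δ ρ (g gl) l w r₀] := by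
      rw [conv_eq_zipConv (v := ![w, bmOut δ ρ (g gl) l w r₀]) (by simp), h3]; rfl
    have h5 := conv_injective h4
    rw [h5, ← h1]; rfl
  · intro h
    refine ⟨(l₀, (v 0).foldr ρ r₀, (v 0).foldl δ l₀), rfl, v 0, rfl, rfl, ?_⟩
    rw [conv_eq_zipConv (by rw [h]; simp [bmFun]), h]; rfl

end Bimachine

/-! ### The finite alphabets of the two tracks -/

section Letters

/-- Letters of the input track: a letter of the encoding, a digit of a counter, and a mark for
counters that have fallen below zero. -/
structure XLet where
  sym : SatSym
  dig : Bool
  dead : Bool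

/-- The modes of the algorithm: checking the number of variables, evaluating the clauses, finished,
rejecting. -/
inductive Mode (c : ℕ)
  | chk (k : Fin (c + 1))
  | main
  | fin
  | rej

/-- Letters of the padding track: the mode, a mark, for each of the three literals of a clause one
bit of the assignment, and whether the assignment satisfies the clauses evaluated so far. -/
structure PLet (c : ℕ) where
  mode : Mode c
  u : Bool
  T : Fin 3 → Bool
  ok : Bool

instance : Finite SatSym := by
  refine Finite.of_injective (β := Fin 6)
    (fun s => match s with
      | .zero => 0 | .one => 1 | .plus => 2 | .minus => 3 | .bar => 4 | .amp => 5) ?_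
  intro s t h
  cases s <;> cases t <;> simp_all

instance : Finite XLet :=
  Finite.of_injective (β := SatSym × Bool × Bool) (fun a => (a.sym, a.dig, a.dead)) (by
    rintro ⟨a, b, c⟩ ⟨a', b', c'⟩ h; simp_all)

instance (c : ℕ) : Finite (Mode c) := by
  refine Finite.of_injective (β := Option (Fin (c + 1)) × Fin 3)
    (fun s => match s with
      | .chk k => (some k, 0) | .main => (none, 0) | .fin => (none, 1) | .rej => (none, 2)) ?_
  intro s t h
  cases s <;> cases t <;> simp_all

instance (c : ℕ) : Finite (PLet c) :=
  Finite.of_injective (β := Mode c × Bool × (Fin 3 → Bool) × Bool)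
    (fun a => (a.mode, a.u, a.T, a.ok)) (by
      rintro ⟨a, b, c, d⟩ ⟨a', b', c', d'⟩ h; simp_all)

/-- What happens to a counter. -/
inductive Act
  | keep
  | dec
  | reset

/-- The effect of an action on the number of decrements since the last reset. -/
def Act.apply : Act → ℕ → ℕ
  | .keep, d => d
  | .dec, d => d + 1
  | .reset, _ => 0

end Letters

/-! ### The input track: counters below the numerals -/

section InputTrack

/-- A fresh letter of the input track. -/
def initX (s : SatSym) : XLet := ⟨s, s = .one, false⟩

/-- The state of the left automaton on the input track: the index of the current literal in its
clause; whether all digits of the current numeral so far are zero; the signs of those literals of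
the current clause whose counter is zero; the sign patterns of the clauses all of whose counters are
zero; the indices of literals with positive counters; whether some counter is not negative. -/
structure XState where
  cls : Fin 3
  lz : Bool
  st : Fin 3 → Option Bool
  found : Set (Fin 3 → Bool)
  live : Set (Fin 3)
  alive : Prop

instance : Finite XState :=
  Finite.of_injective (β := Fin 3 × Bool × (Fin 3 → Option Bool) × Set (Fin 3 → Bool) ×
      Set (Fin 3) × Prop)
    (fun a => (a.cls, a.lz, a.st, a.found, a.live, a.alive)) (by
      rintro ⟨a, b, c, d, e, f⟩ ⟨a', b', c', d', e', f'⟩ h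
      simp only [Prod.mk.injEq] at h
      obtain ⟨rfl, rfl, rfl, rfl, rfl, rfl⟩ := h
      rfl)

/-- The left automaton reads a sign. -/
def signStep (pos : Bool) (s : XState) (dead : Bool) : XState :=
  let st' := Function.update s.st s.cls (if s.lz && !dead then some pos else none)
  { cls := s.cls
    lz := true
    st := st'
    found := s.found ∪ {σ | s.cls = 2 ∧ ∀ a, st' a = some (σ a)}
    live := s.live ∪ {b | b = s.cls ∧ s.lz = false ∧ dead = false}
    alive := s.alive ∨ dead = false }

/-- The left automaton on the input track. -/
def stepX (s : XState) (a : XLet) : XState :=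
  match a.sym with
  | .zero => { s with lz := s.lz && !a.dig }
  | .one => { s with lz := s.lz && !a.dig }
  | .plus => signStep true s a.dead
  | .minus => signStep false s a.dead
  | .bar => { s with cls := s.cls + 1, lz := true }
  | .amp => { s with cls := 0, lz := true }

/-- The initial state of the left automaton. -/
def startX : XState := ⟨0, true, fun _ => none, ∅, ∅, False⟩

/-- The right automaton on the input track computes whether all digits further right in the same
numeral are zero. -/
def stepR (a : XLet) (r : Bool) : Bool :=
  match a.sym with
  | .zero => r && !a.dig
  | .one => r && !a.dig
  | _ => true

/-- The new letter on the input track, if literals are treated according to `act`. -/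
def updX (act : Fin 3 → Act) (s : XState) (a : XLet) (r : Bool) : XLet :=
  match act s.cls, a.sym with
  | .keep, _ => a
  | .reset, x => initX x
  | .dec, .zero => { a with dig := a.dig ^^ r }
  | .dec, .one => { a with dig := a.dig ^^ r }
  | .dec, .plus => { a with dead := a.dead || s.lz }
  | .dec, .minus => { a with dead := a.dead || s.lz }
  | .dec, _ => a

/-- The digits of a numeral together with the digits of its counter. -/
def digW (o e : List Bool) : List XLet := List.zipWith (fun b d => ⟨symOfBit b, d, false⟩) o e

/-- The letter for a sign. -/
def signSym (b : Bool) : SatSym := if b then .plus else .minus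

/-- A literal with a counter that has been decremented `d` times. -/
noncomputable def litW (l : Literal) (d : ℕ) : List XLet :=
  digW (bitsOf l.var) (curBits l.var d) ++ [⟨signSym l.pos, false, decide (l.var < d)⟩]

/-- A clause with counters. -/
noncomputable def clauseW (d : Fin 3 → ℕ) (C : Clause) : List XLet :=
  litW (C 0) (d 0) ++ initX .bar :: (litW (C 1) (d 1) ++ initX .bar :: litW (C 2) (d 2))

/-- A formula with counters. -/
noncomputable def formulaW (d : Fin 3 → ℕ) : Formula → List XLet
  | [] => []
  | C :: φ => clauseW d C ++ φ.flatMap fun C => initX .amp :: clauseW d C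

theorem digW_cons (a b : Bool) (o e : List Bool) :
    digW (a :: o) (b :: e) = ⟨symOfBit a, b, false⟩ :: digW o e := rfl

theorem stepX_digit (s : XState) (a b : Bool) (dead : Bool) :
    stepX s ⟨symOfBit a, b, dead⟩ = { s with lz := s.lz && !b } := by
  cases a <;> rfl

theorem stepX_sign (s : XState) (a b : Bool) (dead : Bool) :
    stepX s ⟨signSym a, b, dead⟩ = signStep a s dead := by
  cases a <;> rfl

theorem stepR_digit (r a b dead : Bool) : stepR ⟨symOfBit a, b, dead⟩ r = (r && !b) := by
  cases a <;> rfl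

theorem stepR_sign (r a b dead : Bool) : stepR ⟨signSym a, b, dead⟩ r = true := by
  cases a <;> rfl

theorem allZero_cons (a : Bool) (l : List Bool) : allZero (a :: l) = (!a && allZero l) := rfl

theorem foldl_digW (s : XState) {o e : List Bool} (h : e.length = o.length) :
    (digW o e).foldl stepX s = { s with lz := s.lz && allZero e } := by
  induction o generalizing s e with
  | nil => rw [List.length_eq_zero_iff.1 h]; simp [digW, allZero]
  | cons a o ih =>
    cases e with
    | nil => simp at h
    | cons b e =>
      rw [digW_cons, List.foldl_cons, stepX_digit, ih _ (by simpa using h), allZero_cons]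
      simp [Bool.and_assoc]

theorem foldr_digW (r : Bool) {o e : List Bool} (h : e.length = o.length) :
    (digW o e).foldr stepR r = (r && allZero e) := by
  induction o generalizing e with
  | nil => rw [List.length_eq_zero_iff.1 h]; simp [digW, allZero]
  | cons a o ih =>
    cases e with
    | nil => simp at h
    | cons b e =>
      rw [digW_cons, List.foldr_cons, stepR_digit, ih (by simpa using h), allZero_cons]
      cases r <;> cases b <;> simp

theorem bmOut_digW_keep {act : Fin 3 → Act} (s : XState) (hs : act s.cls = .keep)
    (r : Bool) (w : List XLet) (hw : ∀ s a, a ∈ w → (stepX s a).cls = s.cls) :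
    bmOut stepX stepR (updX act) s w r = w := by
  induction w generalizing s with
  | nil => rfl
  | cons a w ih =>
    rw [bmOut, ih _ (by rw [hw s a (by simp)]; exact hs) fun s b hb => hw s b (by simp [hb])]
    simp [updX, hs]

/-- The right state is `true` because a numeral is followed by a sign, where `stepR` starts afresh.
-/
theorem bmOut_digW_dec {act : Fin 3 → Act} (s : XState) (hs : act s.cls = .dec)
    {o e : List Bool} (h : e.length = o.length) :
    bmOut stepX stepR (updX act) s (digW o e) true = digW o (decBits e) := by
  induction o generalizing s e with
  | nil => rw [List.length_eq_zero_iff.1 h]; rfl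
  | cons a o ih =>
    cases e with
    | nil => simp at h
    | cons b e =>
      have h' : e.length = o.length := by simpa using h
      rw [decBits, digW_cons, digW_cons, bmOut, stepX_digit, ih _ (by simpa using hs) h',
        foldr_digW _ h', Bool.true_and]
      congr 1
      cases a <;> simp [updX, hs, symOfBit]

theorem bmOut_digW_reset {act : Fin 3 → Act} (s : XState) (hs : act s.cls = .reset) (r : Bool)
    {o e : List Bool} (h : e.length = o.length) :
    bmOut stepX stepR (updX act) s (digW o e) r = digW o o := by
  induction o generalizing s e with
  | nil => rw [List.length_eq_zero_iff.1 h]; rfl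
  | cons a o ih =>
    cases e with
    | nil => simp at h
    | cons b e =>
      have h' : e.length = o.length := by simpa using h
      rw [digW_cons, digW_cons, bmOut, stepX_digit, ih _ (by simpa using hs) h']
      congr 1
      cases a <;> simp [updX, hs, symOfBit, initX]

/-- At the sign, `lz` and the mark `dead` together tell whether the counter is zero, positive or
negative, that is, how `l.var` compares with `d`. -/
theorem foldl_litW (s : XState) (hs : s.lz = true) (l : Literal) (d : ℕ) :
    (litW l d).foldl stepX s =
      { cls := s.cls
        lz := true
        st := Function.update s.st s.cls (if l.var = d then some l.pos else none)
        found := s.found ∪ {σ | s.cls = 2 ∧ ∀ a,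
          Function.update s.st s.cls (if l.var = d then some l.pos else none) a = some (σ a)}
        live := s.live ∪ {b | b = s.cls ∧ d < l.var}
        alive := s.alive ∨ d ≤ l.var } := by
  rw [litW, List.foldl_append, foldl_digW s (by simp), List.foldl_cons, List.foldl_nil, stepX_sign,
    signStep, hs, Bool.true_and]
  by_cases h : d ≤ l.var
  · have h1 : ¬ l.var < d := not_lt.2 h
    have h2 : d < l.var ↔ l.var ≠ d := by omega
    simp [allZero_curBits h, h1, h2, h]
  · have h1 : l.var < d := not_le.1 h
    have h2 : l.var ≠ d := by omega
    have h3 : ¬ d < l.var := by omega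
    simp [h1, h2, h3, h]

theorem stepX_cls_of_mem_litW {l : Literal} {d : ℕ} (s : XState) {a : XLet} (ha : a ∈ litW l d) :
    (stepX s a).cls = s.cls := by
  rw [litW, List.mem_append] at ha
  rcases ha with ha | ha
  · obtain ⟨i, hi, rfl⟩ := List.mem_iff_getElem.1 ha
    simp only [digW, List.getElem_zipWith, stepX_digit]
  · rw [List.mem_singleton.1 ha, stepX_sign]; rfl

/-- Decrementing a counter whose digits are all zero sets `dead`, and the mark stays until a reset.
Hence it is correct although the digits wrap around. -/
theorem bmOut_litW (act : Fin 3 → Act) (s : XState) (hs : s.lz = true) (l : Literal) (d : ℕ)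
    (r : Bool) : bmOut stepX stepR (updX act) s (litW l d) r =
      litW l ((act s.cls).apply d) := by
  cases h : act s.cls with
  | keep => exact bmOut_digW_keep s h r _ fun s a ha => stepX_cls_of_mem_litW s ha
  | dec =>
    rw [litW, litW, bmOut_append, List.foldr_cons, List.foldr_nil, stepR_sign,
      bmOut_digW_dec s h (by simp), foldl_digW s (by simp), Act.apply, curBits_succ, hs,
      Bool.true_and]
    congr 1
    have h1 : (decide (l.var < d) || allZero (curBits l.var d)) = decide (l.var < d + 1) := by
      by_cases h2 : d ≤ l.var
      · rw [allZero_curBits h2, Bool.eq_iff_iff]; simp; omega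
      · have h3 : l.var < d := by omega
        have h4 : l.var < d + 1 := by omega
        simp [h3, h4]
    rw [← h1]
    cases l.pos <;> simp [bmOut, updX, h, signSym]
  | reset =>
    rw [litW, litW, bmOut_append, bmOut_digW_reset s h _ (by simp), foldl_digW s (by simp)]
    congr 1
    cases l.pos <;> simp [bmOut, updX, h, signSym, Act.apply, initX]

theorem bmOut_cons_bar (act : Fin 3 → Act) (s : XState) (w : List XLet) (r : Bool) :
    bmOut stepX stepR (updX act) s (initX .bar :: w) r =
      initX .bar :: bmOut stepX stepR (updX act) { s with cls := s.cls + 1, lz := true } w r := by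
  rw [bmOut]
  congr 1
  cases h : act s.cls <;> simp [updX, h, initX]

theorem bmOut_cons_amp (act : Fin 3 → Act) (s : XState) (w : List XLet) (r : Bool) :
    bmOut stepX stepR (updX act) s (initX .amp :: w) r =
      initX .amp :: bmOut stepX stepR (updX act) { s with cls := 0, lz := true } w r := by
  rw [bmOut]
  congr 1
  cases h : act s.cls <;> simp [updX, h, initX]

theorem bmOut_clauseW (act : Fin 3 → Act) (s : XState) (hs : s.lz = true) (hc : s.cls = 0)
    (d : Fin 3 → ℕ) (C : Clause) (r : Bool) :
    bmOut stepX stepR (updX act) s (clauseW d C) r =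
      clauseW (fun a => (act a).apply (d a)) C := by
  rw [clauseW, clauseW, bmOut_append, bmOut_litW _ _ hs, foldl_litW _ hs, bmOut_cons_bar,
    bmOut_append, bmOut_litW _ _ rfl, foldl_litW _ rfl, bmOut_cons_bar, bmOut_litW _ _ rfl, hc]
  rfl

/-- The final `st'` need not be known: the next clause overwrites its three entries before they are
used, which happens at the third sign only. -/
theorem foldl_clauseW (s : XState) (hs : s.lz = true) (hc : s.cls = 0) (d : Fin 3 → ℕ)
    (C : Clause) : ∃ st', (clauseW d C).foldl stepX s =
      { cls := 2
        lz := true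
        st := st'
        found := s.found ∪ {σ | ∀ a, (C a).var = d a ∧ (C a).pos = σ a}
        live := s.live ∪ {b | d b < (C b).var}
        alive := s.alive ∨ ∃ a, d a ≤ (C a).var } := by
  have hbar : ∀ s : XState, stepX s (initX .bar) = { s with cls := s.cls + 1, lz := true } :=
    fun _ => rfl
  rw [clauseW, List.foldl_append, foldl_litW _ hs, List.foldl_cons, hbar, List.foldl_append,
    foldl_litW _ rfl, List.foldl_cons, hbar, foldl_litW _ rfl, hc]
  refine ⟨Function.update (Function.update (Function.update s.st 0
    (if (C 0).var = d 0 then some (C 0).pos else none)) 1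
    (if (C 1).var = d 1 then some (C 1).pos else none)) 2
    (if (C 2).var = d 2 then some (C 2).pos else none), ?_⟩
  have h1 : (0 + 1 : Fin 3) = 1 := rfl
  simp only [h1, XState.mk.injEq, true_and, show (1 + 1 : Fin 3) = 2 from rfl]
  refine ⟨?_, ?_, ?_⟩
  · ext σ
    simp only [Set.mem_union, Set.mem_ofPred_eq, Fin.forall_fin_succ, Fin.succ_zero_eq_one,
      Fin.succ_one_eq_two, IsEmpty.forall_iff, and_true]
    simp [Function.update]
  · ext b
    simp only [Set.mem_union, Set.mem_ofPred_eq]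
    fin_cases b <;> simp
  · simp only [Fin.exists_fin_succ, IsEmpty.exists_iff, or_false, or_assoc]
    rfl

/-- All that a round needs to know about the formula fits into a finite state: the sign patterns of
the clauses over the triple `d`, and which counters can still move. -/
theorem foldl_formulaW (s : XState) (hs : s.lz = true) (hc : s.cls = 0) (d : Fin 3 → ℕ)
    (φ : Formula) :
    ((formulaW d φ).foldl stepX s).found =
      s.found ∪ {σ | ∃ C ∈ φ, ∀ a, (C a).var = d a ∧ (C a).pos = σ a} ∧
    ((formulaW d φ).foldl stepX s).live = s.live ∪ {b | ∃ C ∈ φ, d b < (C b).var} ∧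
    (((formulaW d φ).foldl stepX s).alive ↔ s.alive ∨ ∃ C ∈ φ, ∃ a, d a ≤ (C a).var) := by
  cases φ with
  | nil => simp [formulaW]
  | cons C φ =>
    rw [formulaW, List.foldl_append]
    obtain ⟨st, h⟩ := foldl_clauseW s hs hc d C
    rw [h]
    clear h
    have key : ∀ (φ : Formula) (s : XState),
        ((φ.flatMap fun C => initX .amp :: clauseW d C).foldl stepX s).found =
          s.found ∪ {σ | ∃ C ∈ φ, ∀ a, (C a).var = d a ∧ (C a).pos = σ a} ∧
        ((φ.flatMap fun C => initX .amp :: clauseW d C).foldl stepX s).live =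
          s.live ∪ {b | ∃ C ∈ φ, d b < (C b).var} ∧
        (((φ.flatMap fun C => initX .amp :: clauseW d C).foldl stepX s).alive ↔
          s.alive ∨ ∃ C ∈ φ, ∃ a, d a ≤ (C a).var) := by
      intro φ
      induction φ with
      | nil => intro s; simp
      | cons C φ ih =>
        intro s
        rw [List.flatMap_cons, List.foldl_append, List.foldl_cons]
        obtain ⟨st, h⟩ := foldl_clauseW (stepX s (initX .amp)) rfl rfl d C
        rw [h]
        obtain ⟨h1, h2, h3⟩ := ih ⟨2, true, st, (stepX s (initX .amp)).found ∪
          {σ | ∀ a, (C a).var = d a ∧ (C a).pos = σ a},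
          (stepX s (initX .amp)).live ∪ {b | d b < (C b).var},
          (stepX s (initX .amp)).alive ∨ ∃ a, d a ≤ (C a).var⟩
        refine ⟨h1.trans ?_, h2.trans ?_, h3.trans ?_⟩
        · ext σ; simp [stepX, initX, or_assoc]
        · ext σ; simp [stepX, initX, or_assoc]
        · simp [stepX, initX, or_assoc]
    obtain ⟨h1, h2, h3⟩ := key φ ⟨2, true, st, s.found ∪
      {σ | ∀ a, (C a).var = d a ∧ (C a).pos = σ a}, s.live ∪ {b | d b < (C b).var},
      s.alive ∨ ∃ a, d a ≤ (C a).var⟩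
    refine ⟨h1.trans ?_, h2.trans ?_, h3.trans ?_⟩
    · ext σ; simp [or_assoc]
    · ext σ; simp [or_assoc]
    · simp [or_assoc]

theorem bmOut_formulaW (act : Fin 3 → Act) (s : XState) (hs : s.lz = true) (hc : s.cls = 0)
    (d : Fin 3 → ℕ) (φ : Formula) (r : Bool) :
    bmOut stepX stepR (updX act) s (formulaW d φ) r =
      formulaW (fun a => (act a).apply (d a)) φ := by
  cases φ with
  | nil => rfl
  | cons C φ =>
    rw [formulaW, formulaW, bmOut_append, bmOut_clauseW _ _ hs hc]
    congr 1
    generalize List.foldl stepX s (clauseW d C) = s'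
    induction φ generalizing s' with
    | nil => rfl
    | cons C φ ih =>
      rw [List.flatMap_cons, List.flatMap_cons, bmOut_append, bmOut_cons_amp,
        bmOut_clauseW _ _ rfl rfl, ih]

theorem map_initX_encodeLiteral (l : Literal) : (encodeLiteral l).map initX = litW l 0 := by
  rw [encodeLiteral_eq, litW, List.map_append]
  congr 1
  · rw [show curBits l.var 0 = bitsOf l.var from rfl, digW, List.zipWith_self, List.map_map]
    refine List.map_congr_left fun b _ => ?_
    cases b <;> rfl
  · cases l.pos <;> simp [signSym, initX]

theorem map_initX_encodeClause (C : Clause) :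
    (encodeClause C).map initX = clauseW (fun _ => 0) C := by
  simp [encodeClause_eq, clauseW, map_initX_encodeLiteral]

theorem map_initX_encode (φ : Formula) : φ.encode.map initX = formulaW (fun _ => 0) φ := by
  cases φ with
  | nil => rfl
  | cons C φ =>
    simp [encode_cons, formulaW, map_initX_encodeClause, List.map_flatMap]

end InputTrack

/-! ### The padding track: positions as truth assignments -/

section PadTrack

variable {c : ℕ}

/-- The state of the left automaton on the padding track: the parity of the position, the parity of
the number of marks, whether there are at least one, two marks, and for the three assignment bits
their last value and the last value of the next higher bit. -/
structure PState where
  par : Bool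
  mp : Bool
  ge1 : Bool
  ge2 : Bool
  prev : Fin 3 → Bool × Bool

instance : Finite PState :=
  Finite.of_injective (β := Bool × Bool × Bool × Bool × (Fin 3 → Bool × Bool))
    (fun a => (a.par, a.mp, a.ge1, a.ge2, a.prev)) (by
      rintro ⟨a, b, c, d, e⟩ ⟨a', b', c', d', e'⟩ h
      simp only [Prod.mk.injEq] at h
      obtain ⟨rfl, rfl, rfl, rfl, rfl⟩ := h
      rfl)

/-- The next higher bit of the position: it changes when the given bit falls. -/
def divOut (q : Bool × Bool) (b : Bool) : Bool := q.2 ^^ (q.1 && !b)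

/-- The left automaton on the padding track. -/
def stepP (s : PState) (a : PLet c) : PState where
  par := !s.par
  mp := s.mp ^^ a.u
  ge1 := s.ge1 || a.u
  ge2 := s.ge2 || (s.ge1 && a.u)
  prev i := (a.T i, divOut (s.prev i) (a.T i))

/-- The initial state of the left automaton on the padding track. -/
def startP : PState := ⟨false, false, false, false, fun _ => (false, false)⟩

/-- What one round of the algorithm does. -/
structure Ctl (c : ℕ) where
  act : Fin 3 → Act
  mode : Mode c
  halve : Bool

open Classical in
/-- The control of the algorithm, which depends on the mode and on the final states of the left
automata. -/
noncomputable def ctl (m : Mode c) (sx : XState) (sp : PState) : Ctl c :=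
  match m with
  | .chk k =>
      if 0 < k.val then ⟨fun _ => .dec, .chk ⟨k.val - 1, by omega⟩, false⟩
      else if sp.ge2 = true then ⟨fun _ => .keep, .chk (Fin.last c), true⟩
      else if sx.alive then ⟨fun _ => .keep, .rej, false⟩
      else ⟨fun _ => .reset, .main, false⟩
  | .main =>
      if 2 ∈ sx.live then ⟨![.keep, .keep, .dec], .main, false⟩
      else if 1 ∈ sx.live then ⟨![.keep, .dec, .reset], .main, false⟩
      else if 0 ∈ sx.live then ⟨![.dec, .reset, .reset], .main, false⟩
      else ⟨fun _ => .keep, .fin, false⟩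
  | .fin => ⟨fun _ => .keep, .fin, false⟩
  | .rej => ⟨fun _ => .keep, .rej, false⟩

open Classical in
/-- The new letter on the padding track. -/
noncomputable def newP (ct : Ctl c) (sx : XState) (s : PState) (a : PLet c) : PLet c where
  mode := ct.mode
  u := if ct.halve then a.u && s.mp else a.u
  T i := match ct.act i with
    | .keep => a.T i
    | .dec => divOut (s.prev i) (a.T i)
    | .reset => s.par
  ok := a.ok && decide (a.mode = .main → ∀ σ ∈ sx.found, ∃ i, a.T i = σ i)

/-- The left automaton on the input track rests beyond the end of the input. -/
def optX (s : XState) (a : Option XLet) : XState := a.elim s (stepX s)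

/-- The right automaton on the input track rests beyond the end of the input. -/
def optR (a : Option XLet) (r : Bool) : Bool := a.elim r fun x => stepR x r

/-- The left automaton on both tracks. -/
def satδ (s : XState × PState) (a : Option XLet × PLet c) : XState × PState :=
  (optX s.1 a.1, stepP s.2 a.2)

/-- The right automaton on both tracks. -/
def satρ (a : Option XLet × PLet c) (r : Bool) : Bool := optR a.1 r

/-- The new letter on both tracks. -/
noncomputable def satg (gl l : XState × PState) (a : Option XLet × PLet c) (r : Bool) :
    Option XLet × PLet c :=
  (a.1.map fun x => updX (ctl a.2.mode gl.1 gl.2).act l.1 x r,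
    newP (ctl a.2.mode gl.1 gl.2) gl.1 l.2 a.2)

/-- One round of the algorithm. -/
noncomputable def satFun (c : ℕ) (w : List (Option XLet × PLet c)) :
    List (Option XLet × PLet c) :=
  bmFun satδ satρ satg (startX, startP) true w

/-- The word with the given contents of the two tracks. -/
def tapeW (xs : List XLet) (ps : ℕ → PLet c) (N : ℕ) : List (Option XLet × PLet c) :=
  (List.range N).map fun p => (xs[p]?, ps p)

/-- The state of the left automaton on the padding track before position `p`. -/
def stP (ps : ℕ → PLet c) (p : ℕ) : PState := ((List.range p).map ps).foldl stepP startP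

theorem tapeW_eq_zip {xs : List XLet} {N : ℕ} (h : xs.length ≤ N) (ps : ℕ → PLet c) :
    tapeW xs ps N =
      List.zip (xs.map some ++ List.replicate (N - xs.length) none) ((List.range N).map ps) := by
  apply List.ext_getElem
  · simp [tapeW, h]
  · intro p h1 h2
    simp only [tapeW, List.getElem_map, List.getElem_range, List.getElem_zip,
      List.getElem_append, List.length_map, List.getElem_replicate, Prod.mk.injEq, and_true]
    split_ifs with h3
    · simp [h3]
    · simp; omega

theorem foldl_satδ_zip (A : List (Option XLet)) (B : List (PLet c)) (h : A.length = B.length)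
    (s : XState × PState) : (List.zip A B).foldl satδ s =
      (A.foldl optX s.1, B.foldl stepP s.2) := by
  induction A generalizing B s with
  | nil =>
    cases B with
    | nil => rfl
    | cons b B => simp at h
  | cons a A ih =>
    cases B with
    | nil => simp at h
    | cons b B =>
      rw [List.zip_cons_cons, List.foldl_cons, ih B (by simpa using h)]; rfl

theorem foldr_satρ_zip (A : List (Option XLet)) (B : List (PLet c)) (h : A.length = B.length)
    (r : Bool) : (List.zip A B).foldr satρ r =
      A.foldr optR r := by
  induction A generalizing B with
  | nil => rfl
  | cons a A ih =>
    cases B with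
    | nil => simp at h
    | cons b B =>
      rw [List.zip_cons_cons, List.foldr_cons, ih B (by simpa using h)]; rfl

/-- All cells carry the same mode and see the same final left state, so they compute the same
control, and the two tracks decouple. -/
theorem bmOut_satg_zip (m : Mode c) (gl : XState × PState) (A : List (Option XLet))
    (B : List (PLet c)) (h : A.length = B.length) (hB : ∀ b ∈ B, b.mode = m)
    (s : XState × PState) (r : Bool) :
    bmOut satδ satρ (satg gl) s (List.zip A B) r =
      List.zip (bmOut optX optR
          (fun s a r => a.map fun x => updX (ctl m gl.1 gl.2).act s x r) s.1 A r)
        (bmOut stepP (fun _ r => r) (fun s a _ => newP (ctl m gl.1 gl.2) gl.1 s a) s.2 B r) := by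
  induction A generalizing B s with
  | nil => rfl
  | cons a A ih =>
    cases B with
    | nil => simp at h
    | cons b B =>
      have h' : A.length = B.length := by simpa using h
      rw [List.zip_cons_cons, bmOut, ih B h' (fun b hb => hB b (by simp [hb])),
        foldr_satρ_zip A B h']
      rw [bmOut, bmOut, List.zip_cons_cons]
      simp only [satg, satδ, hB b (by simp)]

theorem foldl_optX (xs : List XLet) (n : ℕ) (s : XState) :
    (xs.map some ++ List.replicate n none).foldl optX s =
      xs.foldl stepX s := by
  rw [List.foldl_append, List.foldl_map]
  have : ∀ s : XState,
      (List.replicate n (none : Option XLet)).foldl optX s = s := by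
    intro s
    induction n with
    | zero => rfl
    | succ n ih => exact ih
  rw [this]; rfl

theorem foldr_optR (xs : List XLet) (n : ℕ) (r : Bool) :
    (xs.map some ++ List.replicate n none).foldr optR r =
      xs.foldr stepR r := by
  rw [List.foldr_append, List.foldr_map]
  have : (List.replicate n (none : Option XLet)).foldr
      optR r = r := by
    induction n with
    | zero => rfl
    | succ n ih => exact ih
  rw [this]; rfl

theorem bmOut_optX (act : Fin 3 → Act) (xs : List XLet) (n : ℕ) (s : XState) (r : Bool) :
    bmOut optX optR
        (fun s a r => a.map fun x => updX act s x r) s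
        (xs.map some ++ List.replicate n none) r =
      (bmOut stepX stepR (updX act) s xs r).map some ++ List.replicate n none := by
  induction xs generalizing s with
  | nil =>
    induction n with
    | zero => rfl
    | succ n ih =>
      simp only [List.map_nil, List.nil_append] at ih
      simp only [List.map_nil, List.nil_append, List.replicate_succ, bmOut, Option.map_none,
        optX, Option.elim_none]
      exact congrArg _ ih
  | cons x xs ih =>
    rw [List.map_cons, List.cons_append, bmOut, bmOut, foldr_optR]
    simp only [optX, Option.elim_some]
    rw [ih]
    rfl

theorem bmOut_map_range {α β L R : Type} (δ : L → α → L) (ρ : α → R → R) (g : L → α → β) (l : L)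
    (f : ℕ → α) (N : ℕ) (r : R) :
    bmOut δ ρ (fun l a _ => g l a) l ((List.range N).map f) r =
      (List.range N).map fun p => g (((List.range p).map f).foldl δ l) (f p) := by
  induction N generalizing r with
  | zero => rfl
  | succ N ih => simp [List.range_succ, bmOut_append, ih, bmOut]

/-- One round of the algorithm on both tracks. -/
theorem satFun_tapeW {xs : List XLet} {ps : ℕ → PLet c} {N : ℕ} {m : Mode c}
    (h : xs.length ≤ N) (hm : ∀ p, (ps p).mode = m) {gx : XState} (hgx : gx = xs.foldl stepX startX)
    {ct : Ctl c} (hct : ct = ctl m gx (stP ps N)) :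
    satFun c (tapeW xs ps N) = tapeW (bmOut stepX stepR (updX ct.act) startX xs true)
      (fun p => newP ct gx (stP ps p) (ps p)) N := by
  have hl : (xs.map some ++ List.replicate (N - xs.length) none).length =
    ((List.range N).map ps).length := by simp [h]
  rw [satFun, bmFun, tapeW_eq_zip h, foldl_satδ_zip _ _ hl, foldl_optX,
    bmOut_satg_zip m _ _ _ hl (by simp [hm]), bmOut_optX, bmOut_map_range,
    tapeW_eq_zip (by simpa using h)]
  simp only [← hgx, length_bmOut]
  rw [hct]
  rfl

theorem stP_succ (ps : ℕ → PLet c) (p : ℕ) : stP ps (p + 1) = stepP (stP ps p) (ps p) := by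
  simp [stP, List.range_succ]

theorem stP_par (ps : ℕ → PLet c) (p : ℕ) : (stP ps p).par = p.testBit 0 := by
  induction p with
  | zero => rfl
  | succ p ih =>
    rw [stP_succ, stepP, ih, Nat.testBit_zero, Nat.testBit_zero, Bool.eq_iff_iff]
    simp; omega

/-- The number of marks before position `p`. -/
def markCount (ps : ℕ → PLet c) (p : ℕ) : ℕ := Nat.count (fun q => (ps q).u = true) p

theorem stP_marks (ps : ℕ → PLet c) (p : ℕ) :
    (stP ps p).mp = decide (markCount ps p % 2 = 1) ∧
    (stP ps p).ge1 = decide (1 ≤ markCount ps p) ∧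
    (stP ps p).ge2 = decide (2 ≤ markCount ps p) := by
  induction p with
  | zero => exact ⟨rfl, rfl, rfl⟩
  | succ p ih =>
    obtain ⟨h1, h2, h3⟩ := ih
    have h4 : markCount ps (p + 1) = markCount ps p + if (ps p).u = true then 1 else 0 :=
      Nat.count_succ _ _
    rw [stP_succ, stepP, h1, h2, h3, h4]
    cases (ps p).u
    · simp
    · refine ⟨?_, ?_, ?_⟩ <;> rw [Bool.eq_iff_iff] <;> simp <;> omega

/-- From `p` to `p + 1` the quotient by `2 ^ j` stays or grows by one; bit `j + 1` flips exactly if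
it grows and is odd before, that is, if bit `j` falls. -/
theorem testBit_succ_eq (p j : ℕ) :
    (p + 1).testBit (j + 1) = divOut (p.testBit j, p.testBit (j + 1)) ((p + 1).testBit j) := by
  have h : ∀ q, q.testBit (j + 1) = decide (q / 2 ^ j / 2 % 2 = 1) := by
    intro q
    rw [Nat.testBit_eq_decide_div_mod_eq, pow_succ, Nat.div_div_eq_div_mul]
  have h' : (p + 1) / 2 ^ j = p / 2 ^ j ∨ (p + 1) / 2 ^ j = p / 2 ^ j + 1 := by
    rw [Nat.succ_div]; split_ifs <;> simp
  rw [divOut, h, h, Nat.testBit_eq_decide_div_mod_eq, Nat.testBit_eq_decide_div_mod_eq]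
  generalize p / 2 ^ j = x at *
  generalize (p + 1) / 2 ^ j = y at *
  rcases h' with rfl | rfl
  · simp
  · rcases Nat.mod_two_eq_zero_or_one x with hx | hx
    · have h1 : (x + 1) / 2 = x / 2 := by omega
      simp [hx, h1]
    · have h1 : (x + 1) % 2 = 0 := by omega
      have h2 : (x + 1) / 2 = x / 2 + 1 := by omega
      rw [Bool.eq_iff_iff]; simp [hx, h1, h2]; omega

/-- One pass turns the track of bit `j` into the track of bit `j + 1`. This is why each entry of the
triple of variables only ever grows by one or returns to zero. -/
theorem stP_div {ps : ℕ → PLet c} {i : Fin 3} {j : ℕ} (h : ∀ p, (ps p).T i = p.testBit j)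
    (p : ℕ) : divOut ((stP ps p).prev i) ((ps p).T i) = p.testBit (j + 1) := by
  -- Before position `p` the state holds the bits of `p - 1`; for `p = 0` the truncated subtraction
  -- agrees with the initial values `false`.
  have key : ∀ p, (stP ps p).prev i = ((p - 1).testBit j, (p - 1).testBit (j + 1)) := by
    intro p
    induction p with
    | zero => simp [stP, startP]
    | succ p ih =>
      rw [stP_succ, stepP]
      simp only [ih, h, Nat.add_sub_cancel, Prod.mk.injEq, true_and]
      cases p with
      | zero => simp [divOut]
      | succ p => simp only [Nat.add_sub_cancel]; exact (testBit_succ_eq p j).symm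
  rw [key, h]
  cases p with
  | zero => simp [divOut]
  | succ p => simp only [Nat.add_sub_cancel]; exact (testBit_succ_eq p j).symm

theorem length_formulaW (d : Fin 3 → ℕ) (φ : Formula) :
    (formulaW d φ).length = φ.encode.length := by
  have hl : ∀ (l : Literal) (d : ℕ), (litW l d).length = (encodeLiteral l).length := by
    intro l d; simp [litW, digW, encodeLiteral_eq]
  have hC : ∀ C : Clause, (clauseW d C).length = (encodeClause C).length := by
    intro C; simp [clauseW, encodeClause_eq, hl]
  cases φ with
  | nil => rfl
  | cons C φ => simp [formulaW, encode_cons, hC, List.length_flatMap]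

/-- One round of the algorithm on a formula with counters. -/
theorem satFun_formulaW {φ : Formula} {d : Fin 3 → ℕ} {ps : ℕ → PLet c} {N : ℕ} {m : Mode c}
    (h : φ.encode.length ≤ N) (hm : ∀ p, (ps p).mode = m) :
    ∃ gx : XState,
      gx.found = {σ | ∃ C ∈ φ, ∀ a, (C a).var = d a ∧ (C a).pos = σ a} ∧
      gx.live = {b | ∃ C ∈ φ, d b < (C b).var} ∧
      (gx.alive ↔ ∃ C ∈ φ, ∃ a, d a ≤ (C a).var) ∧
      satFun c (tapeW (formulaW d φ) ps N) =
        tapeW (formulaW (fun a => ((ctl m gx (stP ps N)).act a).apply (d a)) φ)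
          (fun p => newP (ctl m gx (stP ps N)) gx (stP ps p) (ps p)) N := by
  obtain ⟨h1, h2, h3⟩ := foldl_formulaW startX rfl rfl d φ
  refine ⟨(formulaW d φ).foldl stepX startX, ?_, ?_, ?_, ?_⟩
  · rw [h1]; simp [startX]
  · rw [h2]; simp [startX]
  · rw [h3]; simp [startX]
  · rw [satFun_tapeW (by rwa [length_formulaW]) hm rfl rfl, bmOut_formulaW _ _ rfl rfl]

end PadTrack

/-! ### Invariants of the phases of the algorithm -/

section Phases

variable {c : ℕ}

/-- The words that occur while the number of variables is checked. -/
def IsChk (φ : Formula) (N : ℕ) (k : Fin (c + 1)) (d m : ℕ) (w : List (Option XLet × PLet c)) :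
    Prop :=
  ∃ ps : ℕ → PLet c, w = tapeW (formulaW (fun _ => d) φ) ps N ∧ markCount ps N = m ∧
    ∀ p, (ps p).mode = .chk k ∧ (ps p).ok = true

/-- The words that occur while the clauses are evaluated. -/
def IsMain (φ : Formula) (N : ℕ) (d : Fin 3 → ℕ) (ok : ℕ → Prop)
    (w : List (Option XLet × PLet c)) : Prop :=
  ∃ ps : ℕ → PLet c, w = tapeW (formulaW d φ) ps N ∧
    ∀ p, (ps p).mode = .main ∧ (∀ i, (ps p).T i = p.testBit (d i)) ∧ ((ps p).ok = true ↔ ok p)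

/-- The words that are reached after the evaluation. -/
def IsFin (N : ℕ) (ok : ℕ → Prop) (w : List (Option XLet × PLet c)) : Prop :=
  ∃ (xs : List XLet) (ps : ℕ → PLet c), w = tapeW xs ps N ∧
    ∀ p, (ps p).mode = .fin ∧ ((ps p).ok = true ↔ ok p)

/-- The words that are reached if there are too many variables. -/
def IsRej (N : ℕ) (w : List (Option XLet × PLet c)) : Prop :=
  ∃ (xs : List XLet) (ps : ℕ → PLet c), w = tapeW xs ps N ∧ ∀ p, (ps p).mode = .rej

variable {φ : Formula} {N : ℕ} {w : List (Option XLet × PLet c)}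

theorem IsChk.dec (hN : φ.encode.length ≤ N) {k : Fin (c + 1)} {d m : ℕ}
    (h : IsChk φ N k d m w) (hk : 0 < k.val) :
    IsChk φ N ⟨k.val - 1, by omega⟩ (d + 1) m (satFun c w) := by
  obtain ⟨ps, rfl, hm, hp⟩ := h
  obtain ⟨gx, -, -, -, h4⟩ := satFun_formulaW (d := fun _ => d) hN fun p => (hp p).1
  rw [ctl, if_pos hk] at h4
  rw [h4]
  exact ⟨_, rfl, hm, fun p => ⟨rfl, by simp [newP, hp]⟩⟩

/-- Of the marks, the second, the fourth, and so on survive, so their number is halved and rounded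
down, as in the recursion for `Nat.log 2`. -/
theorem IsChk.halve (hN : φ.encode.length ≤ N) {k : Fin (c + 1)} {d m : ℕ}
    (h : IsChk φ N k d m w) (hk : k.val = 0) (hm2 : 2 ≤ m) :
    IsChk φ N (Fin.last c) d (m / 2) (satFun c w) := by
  obtain ⟨ps, rfl, hm, hp⟩ := h
  obtain ⟨gx, -, -, -, h4⟩ := satFun_formulaW (d := fun _ => d) hN fun p => (hp p).1
  rw [ctl, if_neg (by omega), if_pos (by rw [(stP_marks ps N).2.2, hm]; simpa using hm2)] at h4
  rw [h4]
  refine ⟨_, rfl, ?_, fun p => ⟨rfl, by simp [newP, hp]⟩⟩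
  -- Claimed for every prefix, so that the parity of the earlier marks is available in the
  -- induction.
  have key : ∀ q, markCount (fun p => newP ⟨fun _ => .keep, .chk (Fin.last c), true⟩ gx
      (stP ps p) (ps p)) q = markCount ps q / 2 := by
    intro q
    induction q with
    | zero => simp [markCount]
    | succ q ih =>
      have h5 : markCount ps (q + 1) = markCount ps q + if (ps q).u = true then 1 else 0 :=
        Nat.count_succ _ _
      refine (Nat.count_succ _ _).trans ?_
      rw [h5, ← markCount.eq_def, ih]
      simp only [newP, if_true, (stP_marks ps q).1]
      cases (ps q).u
      · simp
      · rcases Nat.mod_two_eq_zero_or_one (markCount ps q) with h6 | h6 <;> simp [h6] <;> omega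
  rw [key, hm]

/-- A counter that is not negative after `d` decrements belongs to a variable of index at least `d`,
so there are more than `d` variables. -/
theorem IsChk.rej (hN : φ.encode.length ≤ N) {k : Fin (c + 1)} {d m : ℕ}
    (h : IsChk φ N k d m w) (hk : k.val = 0) (hm2 : m < 2)
    (hd : ∃ C ∈ φ, ∃ a, d ≤ (C a).var) : IsRej N (satFun c w) := by
  obtain ⟨ps, rfl, hm, hp⟩ := h
  obtain ⟨gx, -, -, h3, h4⟩ := satFun_formulaW (d := fun _ => d) hN fun p => (hp p).1
  rw [ctl, if_neg (by omega), if_neg (by rw [(stP_marks ps N).2.2, hm]; simpa using hm2),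
    if_pos (h3.2 hd)] at h4
  rw [h4]
  exact ⟨_, _, rfl, fun p => rfl⟩

/-- The reset restores the counters and writes the parity of the position, its bit `0`, on the three
bit tracks: the enumeration starts at the triple `(0, 0, 0)`. -/
theorem IsChk.main (hN : φ.encode.length ≤ N) {k : Fin (c + 1)} {d m : ℕ}
    (h : IsChk φ N k d m w) (hk : k.val = 0) (hm2 : m < 2)
    (hd : ¬ ∃ C ∈ φ, ∃ a, d ≤ (C a).var) :
    IsMain φ N (fun _ => 0) (fun _ => True) (satFun c w) := by
  obtain ⟨ps, rfl, hm, hp⟩ := h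
  obtain ⟨gx, -, -, h3, h4⟩ := satFun_formulaW (d := fun _ => d) hN fun p => (hp p).1
  rw [ctl, if_neg (by omega), if_neg (by rw [(stP_marks ps N).2.2, hm]; simpa using hm2),
    if_neg (fun h => hd (h3.1 h))] at h4
  rw [h4]
  exact ⟨_, rfl, fun p => ⟨rfl, fun i => stP_par ps p, by simp [newP, hp]⟩⟩

open Classical in
/-- The next triple of variables. -/
noncomputable def nextTriple (M d : Fin 3 → ℕ) : Fin 3 → ℕ :=
  if d 2 < M 2 then ![d 0, d 1, d 2 + 1]
  else if d 1 < M 1 then ![d 0, d 1 + 1, 0]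
  else ![d 0 + 1, 0, 0]

/-- A round tests, at every position simultaneously, the clauses over the triple `d`. It then moves
the triple like an odometer: the set `live` shows which entries have not reached their maximum, and
counters and bit tracks receive the same actions. -/
theorem IsMain.step (hN : φ.encode.length ≤ N) {M d : Fin 3 → ℕ} {ok : ℕ → Prop}
    (hM : ∀ b n, (∃ C ∈ φ, n < (C b).var) ↔ n < M b) (h : IsMain φ N d ok w) :
    ((∃ b, d b < M b) → IsMain φ N (nextTriple M d)
      (fun p => ok p ∧ ∀ C ∈ φ, (∀ a, (C a).var = d a) →
        ∃ a, p.testBit (C a).var = (C a).pos) (satFun c w)) ∧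
    ((∀ b, ¬ d b < M b) → IsFin N
      (fun p => ok p ∧ ∀ C ∈ φ, (∀ a, (C a).var = d a) →
        ∃ a, p.testBit (C a).var = (C a).pos) (satFun c w)) := by
  obtain ⟨ps, rfl, hp⟩ := h
  obtain ⟨gx, h1, h2, -, h4⟩ := satFun_formulaW hN fun p => (hp p).1
  have hlive : ∀ b, b ∈ gx.live ↔ d b < M b := fun b => by rw [h2]; exact hM b _
  have hok : ∀ (ct : Ctl c) (s : PState) p, (newP ct gx s (ps p)).ok = true ↔
      ok p ∧ ∀ C ∈ φ, (∀ a, (C a).var = d a) → ∃ a, p.testBit (C a).var = (C a).pos := by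
    intro ct s p
    simp only [newP, Bool.and_eq_true, (hp p).2.2, decide_eq_true_iff, (hp p).1, true_imp_iff, h1,
      (hp p).2.1]
    refine and_congr_right fun _ => ?_
    constructor
    · intro h C hC hv
      obtain ⟨i, hi⟩ := h (fun a => (C a).pos) ⟨C, hC, fun a => ⟨hv a, rfl⟩⟩
      exact ⟨i, by rw [hv]; exact hi⟩
    · rintro h σ ⟨C, hC, hv⟩
      obtain ⟨i, hi⟩ := h C hC fun a => (hv a).1
      exact ⟨i, by rw [← (hv i).1, hi, (hv i).2]⟩
  constructor
  · intro hex
    rw [h4]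
    have hmode : (ctl .main gx (stP ps N)).mode = (.main : Mode c) ∧
        ∀ a, ((ctl (.main : Mode c) gx (stP ps N)).act a).apply (d a) = nextTriple M d a := by
      have : d 2 < M 2 ∨ d 1 < M 1 ∨ d 0 < M 0 := by
        obtain ⟨b, hb⟩ := hex; fin_cases b <;> simp_all
      simp only [ctl, hlive, nextTriple]
      split_ifs with h5 h6 h7
      · exact ⟨rfl, fun a => by fin_cases a <;> rfl⟩
      · exact ⟨rfl, fun a => by fin_cases a <;> rfl⟩
      · exact ⟨rfl, fun a => by fin_cases a <;> rfl⟩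
      · omega
    rw [show (fun a => ((ctl (.main : Mode c) gx (stP ps N)).act a).apply (d a)) =
      nextTriple M d from funext hmode.2]
    refine ⟨_, rfl, fun p => ⟨hmode.1, fun i => ?_, hok _ _ _⟩⟩
    rw [← hmode.2]
    simp only [newP]
    cases (ctl (.main : Mode c) gx (stP ps N)).act i with
    | keep => exact (hp p).2.1 i
    | dec => exact stP_div (fun p => (hp p).2.1 i) p
    | reset => exact stP_par ps p
  · intro hall
    rw [h4]
    refine ⟨_, _, rfl, fun p => ⟨?_, hok _ _ _⟩⟩
    simp only [ctl, newP, hlive, hall, if_false]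

end Phases

/-! ### Letter-by-letter operations -/

section MapConv

/-- Letter-by-letter operations on convolutions are automatic. -/
theorem isAutomaticFun_map_conv {Γ : Type} {k : ℕ} (h : (Fin k → Option Γ) → Γ) :
    IsAutomaticFun fun v : Fin k → List Γ => (conv v).map h := by
  -- The first conjunct prevents the value from being longer than all arguments.
  refine isAutomaticRel_of_isRegular (isRegular_setOf_forall_mem fun a : Fin (k + 1) → Option Γ =>
    (∃ i : Fin k, a i.castSucc ≠ none) ∧ a (Fin.last k) = some (h fun i => a i.castSucc)) fun w => ?_
  change (∀ a ∈ conv w, _) ↔ w (Fin.last k) = (conv fun i => w i.castSucc).map h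
  set v : Fin k → List Γ := fun i => w i.castSucc with hv
  have hget : ∀ p, ((conv v).map h)[p]? = if p < convLength v then
      some (h fun i => (w i.castSucc)[p]?) else none := by
    intro p
    rw [conv_def, List.getElem?_map, List.getElem?_map]
    split_ifs with hp
    · rw [List.getElem?_range hp]; rfl
    · rw [List.getElem?_eq_none (by simpa using hp)]; rfl
  have hvw : convLength v ≤ convLength w := convLength_le fun i => length_le_convLength w i.castSucc
  constructor
  · intro hall
    apply List.ext_getElem?
    intro p
    rw [hget]
    by_cases hp : p < convLength w
    · obtain ⟨⟨i, hi⟩, h2⟩ := hall (fun i => (w i)[p]?)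
        (by rw [conv_def]; exact List.mem_map.2 ⟨p, List.mem_range.2 hp, rfl⟩)
      have h3 : p < convLength v := by
        have := length_le_convLength v i
        have h4 : p < (w i.castSucc).length := by
          by_contra hc
          exact hi (List.getElem?_eq_none (by omega))
        exact lt_of_lt_of_le h4 this
      rw [if_pos h3, h2]
    · rw [if_neg (by omega)]
      have := length_le_convLength w (Fin.last k)
      exact List.getElem?_eq_none (by omega)
  · intro heq a ha
    rw [conv_def, List.mem_map] at ha
    obtain ⟨p, hp, rfl⟩ := ha
    rw [List.mem_range] at hp
    have h1 : p < convLength v := by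
      by_contra hc
      obtain ⟨i, hi⟩ := exists_lt_length_of_lt_convLength hp
      refine hc (Fin.lastCases (fun hi => ?_) (fun i hi => ?_) i hi)
      · rwa [heq, List.length_map, length_conv] at hi
      · exact hi.trans_le (length_le_convLength v i)
    obtain ⟨i, hi⟩ := exists_lt_length_of_lt_convLength h1
    refine ⟨⟨i, ?_⟩, ?_⟩
    · have : p < (w i.castSucc).length := hi
      simp [this]
    · change (w (Fin.last k))[p]? = _
      rw [heq, hget, if_pos h1]

end MapConv

/-! ### The machine for 3SAT with logarithmically many variables -/

section SatMachine

variable (c : ℕ)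

/-- The machine alphabet. -/
abbrev SatLetter := Option XLet × PLet c

/-- A fresh letter of the padding track. -/
def initP (u : Bool) : PLet c := ⟨.chk 0, u, fun _ => false, true⟩

/-- The input letters as letters of the machine. -/
def satEmb : SatSym ↪ SatLetter c where
  toFun a := (some (initX a), initP c true)
  inj' a b h := by
    simp only [Prod.mk.injEq, Option.some.injEq, and_true] at h
    exact congrArg XLet.sym h

/-- The letter of the input encoded in a letter of the machine. -/
def satSym (a : SatLetter c) : SatSym := a.1.elim .zero XLet.sym

/-- Prepare the tracks. -/
def combineLetter (a : Fin 2 → Option (SatLetter c)) : SatLetter c :=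
  ((a 0).bind Prod.fst, initP c ((a 0).bind Prod.fst).isSome)

/-- The input is the encoding of a formula. -/
def SatValid (w : List (SatLetter c)) : Prop := ∃ φ : Formula, φ.encode = w.map (satSym c)

/-- Some assignment satisfies the formula. -/
def SatAcc (w : List (SatLetter c)) : Prop := ∃ a ∈ w, a.2.mode = .fin ∧ a.2.ok = true

/-- The algorithm has finished without success. -/
def SatRej (w : List (SatLetter c)) : Prop :=
  ∀ a ∈ w, a.2.mode = .rej ∨ (a.2.mode = .fin ∧ a.2.ok = false)

theorem isAutomaticRel_satValid : IsAutomaticRel fun v : Fin 1 → List (SatLetter c) =>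
    SatValid c (v 0) := by
  obtain ⟨σ, _, M, hM⟩ := isRegular_range_encode
  refine isAutomaticRel_mem (L := {w | SatValid c w}) ⟨σ, inferInstance, M.comap (satSym c), ?_⟩
  rw [DFA.accepts_comap, hM]
  rfl

theorem isAutomaticRel_satAcc : IsAutomaticRel fun v : Fin 1 → List (SatLetter c) =>
    SatAcc c (v 0) := by
  refine isAutomaticRel_mem (L := {w | SatAcc c w}) ?_
  suffices h : ({w | SatAcc c w} : Language (SatLetter c)) =
      ({w | ∀ a ∈ w, ¬ (a.2.mode = .fin ∧ a.2.ok = true)} : Language (SatLetter c))ᶜ by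
    rw [h]; exact (isRegular_setOf_forall_mem _).compl
  refine Language.ext fun w => ?_
  change SatAcc c w ↔ ¬ ∀ a ∈ w, ¬ (a.2.mode = .fin ∧ a.2.ok = true)
  rw [SatAcc]; push Not; rfl

theorem isAutomaticRel_satRej : IsAutomaticRel fun v : Fin 1 → List (SatLetter c) =>
    SatRej c (v 0) :=
  isAutomaticRel_mem (L := {w | SatRej c w}) (isRegular_setOf_forall_mem _)

theorem isAutomaticFun_satFun : IsAutomaticFun fun v : Fin 1 → List (SatLetter c) =>
    satFun c (v 0) :=
  isAutomaticFun_bmFun _ _ _ _ _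

/-- A polynomial bound for the length of padding words that list all assignments. -/
noncomputable def satPoly : Polynomial ℕ := Polynomial.X ^ c + Polynomial.X + 1

/-- The machine that decides `logVar3SAT c`. -/
noncomputable abbrev satMachine : Machine SatSym where
  Γ := SatLetter c
  finΓ := inferInstance
  emb := satEmb c
  zero := (none, initP c false)
  r := 2
  -- After the validity test, input and padding are merged into one register. A pass through the
  -- loop takes four steps: test for acceptance, test for rejection, one round, jump back. All
  -- rejections share one `halt` instruction.
  prog := [.readBoost 0 1 (satPoly c),
    .ifGoto 1 _ (isAutomaticRel_satValid c) (fun _ => 0) 3,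
    .halt .reject,
    .op 0 2 _ (isAutomaticFun_map_conv (combineLetter c)) id,
    .ifGoto 1 _ (isAutomaticRel_satAcc c) (fun _ => 0) 8,
    .ifGoto 1 _ (isAutomaticRel_satRej c) (fun _ => 0) 2,
    .op 0 1 _ (isAutomaticFun_satFun c) (fun _ => 0),
    .goto 4,
    .halt .accept]

theorem satMachine_isPARM : (satMachine c).IsPARM := by
  intro i hi
  simp [satMachine] at hi

/-- The configurations of the machine in a given line, with a given main register. -/
def SatAt (C : Config (SatLetter c) 2) (pc : ℕ) (w : List (SatLetter c)) : Prop :=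
  C.pc = pc ∧ C.regs 0 = w ∧ C.result = none

variable {c} {x : List SatSym} {m : ℕ} {C : Config (SatLetter c) 2} {w : List (SatLetter c)}

theorem satMachine_step {C : Config (SatLetter c) 2} {pc : ℕ} {w : List (SatLetter c)}
    (h : SatAt c C pc w) {I : Instr SatSym (SatLetter c) 2}
    (hI : (satMachine c).prog[pc]? = some I) :
    (satMachine c).step x m C = (satMachine c).exec x m C I :=
  (satMachine c).step_of_getElem? x m h.2.2 (by rw [h.1]; exact hI)

theorem satAt_ifGoto {pc l : ℕ} {R : (Fin 1 → List (SatLetter c)) → Prop} {hR : IsAutomaticRel R}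
    (h : SatAt c C pc w)
    (hI : (satMachine c).prog[pc]? = some (.ifGoto 1 R hR (fun _ => 0) l)) :
    ((R fun _ => w) → SatAt c ((satMachine c).step x m C) l w) ∧
    ((¬ R fun _ => w) → SatAt c ((satMachine c).step x m C) (pc + 1) w) := by
  rw [satMachine_step h hI]
  obtain ⟨h1, h2, h3⟩ := h
  subst h1 h2
  refine ⟨fun hr => ⟨?_, rfl, h3⟩, fun hr => ⟨?_, rfl, h3⟩⟩
  · exact if_pos hr
  · exact if_neg hr

theorem satAt_round (h : SatAt c C 4 w) (h1 : ¬ SatAcc c w) (h2 : ¬ SatRej c w) :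
    SatAt c (((satMachine c).step x m)^[4] C) 4 (satFun c w) := by
  have h3 := (satAt_ifGoto (x := x) (m := m) h rfl).2 h1
  have h4 := (satAt_ifGoto (x := x) (m := m) h3 rfl).2 h2
  change SatAt c ((satMachine c).step x m ((satMachine c).step x m ((satMachine c).step x m
    ((satMachine c).step x m C)))) 4 (satFun c w)
  generalize (satMachine c).step x m ((satMachine c).step x m C) = C' at h4
  have h5 : SatAt c ((satMachine c).step x m C') 7 (satFun c w) := by
    rw [satMachine_step h4 rfl]
    obtain ⟨h6, h7, h8⟩ := h4
    refine ⟨by simp [Machine.exec, h6], ?_, h8⟩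
    simp [Machine.exec, h7]
  rw [satMachine_step h5 rfl]
  exact ⟨rfl, h5.2.1, h5.2.2⟩

theorem satAt_accept (h : SatAt c C 4 w) (h1 : SatAcc c w) :
    (((satMachine c).step x m)^[2] C).result = some .accept := by
  have h3 := (satAt_ifGoto (x := x) (m := m) h rfl).1 h1
  change ((satMachine c).step x m ((satMachine c).step x m C)).result = _
  rw [satMachine_step h3 rfl]
  rfl

theorem satAt_reject (h : SatAt c C 4 w) (h1 : ¬ SatAcc c w) (h2 : SatRej c w) :
    (((satMachine c).step x m)^[3] C).result = some .reject := by
  have h3 := (satAt_ifGoto (x := x) (m := m) h rfl).2 h1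
  have h4 := (satAt_ifGoto (x := x) (m := m) h3 rfl).1 h2
  change ((satMachine c).step x m ((satMachine c).step x m ((satMachine c).step x m C))).result = _
  rw [satMachine_step h4 rfl]
  rfl

/-- `S` rounds of the algorithm lead from `w` to `w'`, without any of them being the last. -/
def BusyFor (c S : ℕ) (w w' : List (SatLetter c)) : Prop :=
  (satFun c)^[S] w = w' ∧ ∀ s < S, ¬ SatAcc c ((satFun c)^[s] w) ∧ ¬ SatRej c ((satFun c)^[s] w)

theorem BusyFor.trans {S S' : ℕ} {w w' w'' : List (SatLetter c)} (h : BusyFor c S w w')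
    (h' : BusyFor c S' w' w'') : BusyFor c (S' + S) w w'' := by
  refine ⟨by rw [Function.iterate_add_apply, h.1, h'.1], fun s hs => ?_⟩
  rcases Nat.lt_or_ge s S with h1 | h1
  · exact h.2 s h1
  · obtain ⟨t, rfl⟩ := Nat.exists_eq_add_of_le' h1
    rw [Function.iterate_add_apply, h.1]
    exact h'.2 t (by omega)

theorem BusyFor.refl (w : List (SatLetter c)) : BusyFor c 0 w w := ⟨rfl, by simp⟩

theorem BusyFor.single (h1 : ¬ SatAcc c w) (h2 : ¬ SatRej c w) : BusyFor c 1 w (satFun c w) := by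
  refine ⟨rfl, fun s hs => ?_⟩
  obtain rfl : s = 0 := by omega
  exact ⟨h1, h2⟩

theorem satAt_of_busyFor {S : ℕ} {w' : List (SatLetter c)} (h : SatAt c C 4 w)
    (hS : BusyFor c S w w') : SatAt c (((satMachine c).step x m)^[4 * S] C) 4 w' := by
  induction S generalizing w' with
  | zero => rw [← hS.1]; exact h
  | succ S ih =>
    have h1 := ih (w' := (satFun c)^[S] w) ⟨rfl, fun s hs => hS.2 s (by omega)⟩
    have h2 := satAt_round (x := x) (m := m) h1 (hS.2 S (by omega)).1 (hS.2 S (by omega)).2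
    rw [← hS.1, Function.iterate_succ_apply']
    rw [show 4 * (S + 1) = 4 + 4 * S by ring, Function.iterate_add_apply]
    exact h2

end SatMachine

/-! ### Correctness and running time of the machine -/

section Correctness

variable {c : ℕ} {φ : Formula} {N : ℕ} {w : List (SatLetter c)}

/-- The empty word satisfies `SatRej` vacuously, hence `0 < N`; this is one reason for the summand
`1` in `satPoly`. -/
theorem not_acc_not_rej_tapeW {xs : List XLet} {ps : ℕ → PLet c} (hN : 0 < N)
    (h : ∀ p, (ps p).mode ≠ .fin ∧ (ps p).mode ≠ .rej) :
    ¬ SatAcc c (tapeW xs ps N) ∧ ¬ SatRej c (tapeW xs ps N) := by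
  constructor
  · rintro ⟨a, ha, h1, -⟩
    obtain ⟨p, -, rfl⟩ := List.mem_map.1 ha
    exact (h p).1 h1
  · intro hr
    have := hr (xs[0]?, ps 0) (List.mem_map.2 ⟨0, List.mem_range.2 hN, rfl⟩)
    rcases this with h1 | h1
    · exact (h 0).2 h1
    · exact (h 0).1 h1.1

theorem IsChk.busy (hN : 0 < N) {k : Fin (c + 1)} {d m : ℕ} (h : IsChk φ N k d m w) :
    BusyFor c 1 w (satFun c w) := by
  obtain ⟨ps, rfl, -, hp⟩ := h
  have := not_acc_not_rej_tapeW (xs := formulaW (fun _ => d) φ) hN (ps := ps)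
    fun p => by simp [(hp p).1]
  exact BusyFor.single this.1 this.2

theorem IsMain.busy (hN : 0 < N) {d : Fin 3 → ℕ} {ok : ℕ → Prop} (h : IsMain φ N d ok w) :
    BusyFor c 1 w (satFun c w) := by
  obtain ⟨ps, rfl, hp⟩ := h
  have := not_acc_not_rej_tapeW (xs := formulaW d φ) hN (ps := ps)
    fun p => by simp [(hp p).1]
  exact BusyFor.single this.1 this.2

theorem IsRej.acc_rej (h : IsRej N w) : ¬ SatAcc c w ∧ SatRej c w := by
  obtain ⟨xs, ps, rfl, hp⟩ := h
  constructor
  · rintro ⟨a, ha, h1, -⟩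
    obtain ⟨p, -, rfl⟩ := List.mem_map.1 ha
    rw [hp] at h1; cases h1
  · intro a ha
    obtain ⟨p, -, rfl⟩ := List.mem_map.1 ha
    exact Or.inl (hp p)

theorem IsFin.acc_rej {ok : ℕ → Prop} (h : IsFin N ok w) :
    ((∃ p < N, ok p) → SatAcc c w) ∧ ((¬ ∃ p < N, ok p) → ¬ SatAcc c w ∧ SatRej c w) := by
  obtain ⟨xs, ps, rfl, hp⟩ := h
  refine ⟨?_, fun hno => ⟨?_, ?_⟩⟩
  · rintro ⟨p, hpN, h1⟩
    exact ⟨_, List.mem_map.2 ⟨p, List.mem_range.2 hpN, rfl⟩, (hp p).1, (hp p).2.2 h1⟩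
  · rintro ⟨a, ha, -, h1⟩
    obtain ⟨p, hpN, rfl⟩ := List.mem_map.1 ha
    exact hno ⟨p, List.mem_range.1 hpN, (hp p).2.1 h1⟩
  · intro a ha
    obtain ⟨p, hpN, rfl⟩ := List.mem_map.1 ha
    refine Or.inr ⟨(hp p).1, ?_⟩
    rw [← Bool.not_eq_true]
    exact fun h1 => hno ⟨p, List.mem_range.1 hpN, (hp p).2.1 h1⟩

theorem IsChk.decs (hN : φ.encode.length ≤ N) (hN' : 0 < N) (k : ℕ) (hk : k < c + 1) {d m : ℕ}
    (h : IsChk φ N ⟨k, hk⟩ d m w) : ∃ w', BusyFor c k w w' ∧ IsChk φ N 0 (d + k) m w' := by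
  induction k generalizing d w with
  | zero => exact ⟨w, BusyFor.refl w, h⟩
  | succ k ih =>
    have h1 := h.dec hN (Nat.succ_pos k)
    obtain ⟨w', h2, h3⟩ := ih (by omega) h1
    refine ⟨w', ?_, ?_⟩
    · exact (h.busy hN').trans h2
    · rw [show d + (k + 1) = d + 1 + k by ring]; exact h3

/-- Each unit of `Nat.log 2 m` costs one halving and `c` decrements. The number `c * Nat.log 2 m` is
thus subtracted from all counters without ever being written down. -/
theorem IsChk.iterate (hN : φ.encode.length ≤ N) (hN' : 0 < N) {d m : ℕ}
    (h : IsChk φ N 0 d m w) : ∃ w' m', BusyFor c ((c + 1) * Nat.log 2 m) w w' ∧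
      m' < 2 ∧ IsChk φ N 0 (d + c * Nat.log 2 m) m' w' := by
  induction m using Nat.strong_induction_on generalizing d w with
  | _ m ih =>
    rcases Nat.lt_or_ge m 2 with hm | hm
    · have : Nat.log 2 m = 0 := Nat.log_of_lt hm
      rw [this]
      exact ⟨w, m, BusyFor.refl w, hm, h⟩
    · have h1 := h.halve hN rfl hm
      obtain ⟨w₁, h2, h3⟩ := IsChk.decs hN hN' c (Nat.lt_succ_self c) h1
      obtain ⟨w₂, m', h4, h5, h6⟩ := ih (m / 2) (by omega) h3
      refine ⟨w₂, m', ?_, h5, ?_⟩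
      · have h7 := ((h.busy hN').trans h2).trans h4
        rw [Nat.log_of_one_lt_of_le (by norm_num) hm,
          show (c + 1) * (Nat.log 2 (m / 2) + 1) = (c + 1) * Nat.log 2 (m / 2) + (c + 1) by ring]
        exact h7
      · rw [Nat.log_of_one_lt_of_le (by norm_num) hm,
          show d + c * (Nat.log 2 (m / 2) + 1) = d + c + c * Nat.log 2 (m / 2) by ring]
        exact h6

theorem foldr_max_le_iff {l : List ℕ} {h : ℕ} : l.foldr max 0 ≤ h ↔ ∀ x ∈ l, x ≤ h := by
  induction l with
  | nil => simp
  | cons a l ih => simp [ih]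

theorem numVars_le_iff {h : ℕ} : φ.numVars ≤ h ↔ ∀ C ∈ φ, ∀ a, (C a).var < h := by
  rw [Formula.numVars, foldr_max_le_iff]
  simp only [List.mem_map, forall_exists_index, and_imp, forall_apply_eq_imp_iff₂,
    Finset.sup_le_iff, Finset.mem_univ, true_imp_iff, Nat.add_one_le_iff]

/-- The largest variable in literals with a given index. -/
def maxVar (φ : Formula) (b : Fin 3) : ℕ := (φ.map fun C => (C b).var).foldr max 0

theorem lt_maxVar_iff (b : Fin 3) (n : ℕ) : (∃ C ∈ φ, n < (C b).var) ↔ n < maxVar φ b := by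
  rw [← not_le, maxVar, foldr_max_le_iff]
  simp

theorem var_le_maxVar {C : Clause} (hC : C ∈ φ) (b : Fin 3) : (C b).var ≤ maxVar φ b := by
  by_contra! h
  exact lt_irrefl _ ((lt_maxVar_iff b _).1 ⟨C, hC, h⟩)

/-- The place of a triple in the lexicographic enumeration of the triples below `M`. -/
def tripleIdx (M d : Fin 3 → ℕ) : ℕ := (d 0 * (M 1 + 1) + d 1) * (M 2 + 1) + d 2

theorem mul_add_inj {n a b a' b' : ℕ} (hb : b < n) (hb' : b' < n) (h : a * n + b = a' * n + b') :
    a = a' ∧ b = b' := by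
  have h1 : (a * n + b) / n = a := by
    rw [mul_comm, Nat.mul_add_div (by omega), Nat.div_eq_of_lt hb, add_zero]
  have h2 : (a' * n + b') / n = a' := by
    rw [mul_comm, Nat.mul_add_div (by omega), Nat.div_eq_of_lt hb', add_zero]
  have h3 : a = a' := by rw [← h1, h, h2]
  subst h3
  exact ⟨rfl, by omega⟩

theorem tripleIdx_inj {M d d' : Fin 3 → ℕ} (h : ∀ i, d i ≤ M i) (h' : ∀ i, d' i ≤ M i)
    (he : tripleIdx M d = tripleIdx M d') : d = d' := by
  have h2 := h 2; have h1 := h 1; have h2' := h' 2; have h1' := h' 1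
  obtain ⟨e1, e2⟩ := mul_add_inj (by omega) (by omega) he
  obtain ⟨e3, e4⟩ := mul_add_inj (by omega) (by omega) e1
  funext i
  fin_cases i <;> assumption

theorem nextTriple_spec {M d : Fin 3 → ℕ} (h : ∀ i, d i ≤ M i) (hex : ∃ b, d b < M b) :
    (∀ i, nextTriple M d i ≤ M i) ∧ tripleIdx M (nextTriple M d) = tripleIdx M d + 1 := by
  have h0 := h 0; have h1 := h 1; have h2 := h 2
  have hex' : d 2 < M 2 ∨ d 1 < M 1 ∨ d 0 < M 0 := by
    obtain ⟨b, hb⟩ := hex; fin_cases b <;> simp_all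
  unfold nextTriple
  split_ifs with h3 h4
  · refine ⟨fun i => ?_, rfl⟩
    fin_cases i <;> simp <;> omega
  · refine ⟨fun i => by fin_cases i <;> simp <;> omega, ?_⟩
    have h5 : d 2 = M 2 := by omega
    simp only [tripleIdx, Matrix.cons_val]
    rw [h5]; ring
  · refine ⟨fun i => by fin_cases i <;> simp <;> omega, ?_⟩
    have h5 : d 2 = M 2 := by omega
    have h6 : d 1 = M 1 := by omega
    simp only [tripleIdx, Matrix.cons_val]
    rw [h5, h6]; ring

/-- The assignment given by the binary digits of `p` satisfies the clause. -/
def SatBy (p : ℕ) (C : Clause) : Prop := ∃ a, p.testBit (C a).var = (C a).pos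

theorem IsMain.congr {d : Fin 3 → ℕ} {ok ok' : ℕ → Prop} (h : IsMain φ N d ok w)
    (he : ∀ p, ok p ↔ ok' p) : IsMain φ N d ok' w := by
  rwa [show ok' = ok from funext fun p => propext (he p).symm]

/-- The number of triples of variables. -/
def numTriples (φ : Formula) : ℕ := (maxVar φ 0 + 1) * (maxVar φ 1 + 1) * (maxVar φ 2 + 1)

/-- Invariant: `ok` at `p` says that the assignment `p` satisfies all clauses whose triple precedes
`d`. Every clause is tested in the round of its own triple, and `n` counts the triples after `d`. -/
theorem IsMain.iterate (hN : φ.encode.length ≤ N) (hN' : 0 < N) (n : ℕ)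
    {w : List (SatLetter c)} {d : Fin 3 → ℕ}
    (hd : ∀ i, d i ≤ maxVar φ i) (hn : tripleIdx (maxVar φ) d + n + 1 = numTriples φ)
    (h : IsMain φ N d (fun p => ∀ C ∈ φ, tripleIdx (maxVar φ) (fun a => (C a).var) <
      tripleIdx (maxVar φ) d → SatBy p C) w) :
    ∃ w', BusyFor c (n + 1) w w' ∧ IsFin N (fun p => ∀ C ∈ φ, SatBy p C) w' := by
  have hclause : ∀ p, ((∀ C ∈ φ, tripleIdx (maxVar φ) (fun a => (C a).var) <
      tripleIdx (maxVar φ) d → SatBy p C) ∧ ∀ C ∈ φ, (∀ a, (C a).var = d a) →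
        ∃ a, p.testBit (C a).var = (C a).pos) ↔ ∀ C ∈ φ,
      tripleIdx (maxVar φ) (fun a => (C a).var) < tripleIdx (maxVar φ) d + 1 → SatBy p C := by
    intro p
    constructor
    · rintro ⟨h1, h2⟩ C hC h3
      rcases Nat.lt_succ_iff_lt_or_eq.1 h3 with h4 | h4
      · exact h1 C hC h4
      · have := tripleIdx_inj (var_le_maxVar hC) hd h4
        exact h2 C hC fun a => congrFun this a
    · intro h1
      refine ⟨fun C hC h2 => h1 C hC (by omega), fun C hC h2 => h1 C hC ?_⟩
      rw [show (fun a => (C a).var) = d from funext h2]; omega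
  obtain ⟨hs1, hs2⟩ := h.step hN (M := maxVar φ) lt_maxVar_iff
  by_cases hex : ∃ b, d b < maxVar φ b
  · obtain ⟨h1, h2⟩ := nextTriple_spec hd hex
    have h3 := (hs1 hex).congr hclause
    rw [← h2] at h3
    cases n with
    | zero =>
      exfalso
      obtain ⟨b, hb⟩ := hex
      have e0 := hd 0; have e1 := hd 1; have e2 := hd 2
      have : tripleIdx (maxVar φ) d + 1 = tripleIdx (maxVar φ) (maxVar φ) + 1 := by
        rw [← Nat.add_zero (tripleIdx (maxVar φ) d), hn, numTriples, tripleIdx]; ring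
      have := tripleIdx_inj hd (fun i => le_rfl) (Nat.succ_injective this)
      rw [this] at hb
      exact lt_irrefl _ hb
    | succ n =>
      obtain ⟨w', h4, h5⟩ := IsMain.iterate hN hN' n h1 (by omega) h3
      exact ⟨w', (h.busy hN').trans h4, h5⟩
  · have hdM : d = maxVar φ := by
      funext b
      have h1 := hd b
      have h2 : ¬ d b < maxVar φ b := fun h => hex ⟨b, h⟩
      omega
    have hn0 : n = 0 := by
      rw [hdM, numTriples, tripleIdx] at hn
      have : (maxVar φ 0 + 1) * (maxVar φ 1 + 1) * (maxVar φ 2 + 1) =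
        (maxVar φ 0 * (maxVar φ 1 + 1) + maxVar φ 1) * (maxVar φ 2 + 1) + maxVar φ 2 + 1 := by ring
      omega
    subst hn0
    refine ⟨_, h.busy hN', ?_⟩
    have h1 := hs2 fun b hb => hex ⟨b, hb⟩
    rw [show (fun p => ∀ C ∈ φ, SatBy p C) = _ from ?_]
    · exact h1
    · funext p
      refine propext (Iff.trans ?_ (hclause p).symm)
      refine ⟨fun h2 C hC _ => h2 C hC, fun h2 C hC => h2 C hC ?_⟩
      rw [Nat.add_zero] at hn
      rw [hn]
      have h3 := var_le_maxVar hC 0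
      have h4 := var_le_maxVar hC 1
      have h5 := var_le_maxVar hC 2
      have e : numTriples φ = tripleIdx (maxVar φ) (maxVar φ) + 1 := by
        rw [numTriples, tripleIdx]; ring
      rw [e, tripleIdx, tripleIdx]
      refine Nat.lt_succ_of_le ?_
      gcongr

/-- Only the first `h` truth values matter, and they are the binary digits of a number below `2 ^
h`. -/
theorem satisfiable_iff {h : ℕ} (hφ : φ.numVars ≤ h) (hN : 2 ^ h ≤ N) :
    φ.Satisfiable ↔ ∃ p < N, ∀ C ∈ φ, SatBy p C := by
  constructor
  · rintro ⟨v, hv⟩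
    refine ⟨Nat.ofBits fun i : Fin h => v i, (Nat.ofBits_lt_two_pow _).trans_le hN, fun C hC => ?_⟩
    obtain ⟨a, ha⟩ := hv C hC
    refine ⟨a, ?_⟩
    rw [Nat.testBit_ofBits_lt _ _ (numVars_le_iff.1 hφ C hC a)]
    exact ha
  · rintro ⟨p, -, hp⟩
    exact ⟨fun i => p.testBit i, hp⟩

theorem count_lt (n N : ℕ) : Nat.count (fun p => decide (p < n) = true) N = min n N := by
  induction N with
  | zero => simp
  | succ N ih =>
    rw [Nat.count_succ, ih]
    split_ifs with h <;> simp at h <;> omega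

/-- The bound for the number of rounds. -/
def satRounds (c n : ℕ) : ℕ := (c + 1) * Nat.log 2 n + 1 + (c * Nat.log 2 n + 1) ^ 3

/-- The outcome of the algorithm. -/
theorem IsChk.outcome (hN : φ.encode.length ≤ N) (hN' : 0 < N)
    (hpow : 2 ^ (c * Nat.log 2 φ.encode.length) ≤ N) (h : IsChk φ N 0 0 φ.encode.length w) :
    ∃ S ≤ satRounds c φ.encode.length, ∃ w', BusyFor c S w w' ∧
      ((φ.numVars ≤ c * Nat.log 2 φ.encode.length ∧ φ.Satisfiable) → SatAcc c w') ∧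
      (¬ (φ.numVars ≤ c * Nat.log 2 φ.encode.length ∧ φ.Satisfiable) →
        ¬ SatAcc c w' ∧ SatRej c w') := by
  set L := Nat.log 2 φ.encode.length with hL
  obtain ⟨w₁, m', h1, h2, h3⟩ := h.iterate hN hN'
  rw [Nat.zero_add, ← hL] at h3
  rw [← hL] at h1
  by_cases hv : φ.numVars ≤ c * L
  · have hv' := numVars_le_iff.1 hv
    have h4 := h3.main hN rfl h2 (by
      rintro ⟨C, hC, a, ha⟩
      exact absurd (hv' C hC a) (not_lt.2 ha))
    have hM : ∀ b, maxVar φ b ≤ c * L := by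
      intro b
      rw [maxVar, foldr_max_le_iff]
      simp only [List.mem_map, forall_exists_index, and_imp, forall_apply_eq_imp_iff₂]
      exact fun C hC => (hv' C hC b).le
    have hpos : 1 ≤ numTriples φ := by
      unfold numTriples; exact Nat.succ_le_of_lt (by positivity)
    have h0 : tripleIdx (maxVar φ) (fun _ => 0) = 0 := by simp [tripleIdx]
    obtain ⟨w₂, h5, h6⟩ := IsMain.iterate (c := c) (w := satFun c w₁) hN hN' (numTriples φ - 1)
      (d := fun _ => 0) (fun i => Nat.zero_le _) (by omega)
      (h4.congr fun p => by simp [h0])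
    rw [Nat.sub_add_cancel hpos] at h5
    refine ⟨numTriples φ + (1 + (c + 1) * L), ?_, w₂, (h1.trans (h3.busy hN')).trans h5, ?_, ?_⟩
    · have : numTriples φ ≤ (c * L + 1) ^ 3 := by
        rw [numTriples, pow_succ, pow_two]
        have a0 := hM 0; have a1 := hM 1; have a2 := hM 2
        gcongr
      rw [satRounds, ← hL]; omega
    · rintro ⟨-, hs⟩
      exact h6.acc_rej.1 ((satisfiable_iff hv hpow).1 hs)
    · intro hs
      exact h6.acc_rej.2 fun hex => hs ⟨hv, (satisfiable_iff hv hpow).2 hex⟩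
  · have h4 := h3.rej hN rfl h2 (by
      rw [numVars_le_iff] at hv
      push Not at hv
      exact hv)
    refine ⟨1 + (c + 1) * L, ?_, _, h1.trans (h3.busy hN'), fun hs => absurd hs.1 hv,
      fun _ => h4.acc_rej⟩
    rw [satRounds, ← hL]; omega

/-- The formula on which the machine works decides whether the input belongs to the language. -/
theorem satMachine_run (φ : Formula) (m : ℕ) :
    ((φ.numVars ≤ c * Nat.log 2 φ.encode.length ∧ φ.Satisfiable) →
      ((satMachine c).run φ.encode m (4 * satRounds c φ.encode.length + 6)).result =
        some .accept) ∧
    (¬ (φ.numVars ≤ c * Nat.log 2 φ.encode.length ∧ φ.Satisfiable) →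
      ((satMachine c).run φ.encode m (4 * satRounds c φ.encode.length + 6)).result =
        some .reject) := by
  set x := φ.encode with hx
  set N := (satPoly c).eval x.length + m with hN
  have heval : (satPoly c).eval x.length = x.length ^ c + x.length + 1 := by simp [satPoly]
  have hlen : x.length ≤ N := by rw [hN, heval]; omega
  have hpos : 0 < N := by rw [hN, heval]; omega
  -- The purpose of `satPoly`: for `n > 0`, `2 ^ (c log n) ≤ n ^ c`, so polynomially long padding
  -- has a position for every assignment.
  have hpow : 2 ^ (c * Nat.log 2 x.length) ≤ N := by
    rcases Nat.eq_zero_or_pos x.length with h0 | h0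
    · rw [h0]; simpa using Nat.succ_le_of_lt hpos
    · have h1 : (2 ^ Nat.log 2 x.length) ^ c ≤ x.length ^ c :=
        Nat.pow_le_pow_left (Nat.pow_log_le_self 2 (by omega)) c
      rw [mul_comm, pow_mul, hN, heval]; omega
  set R₁ : Fin 2 → List (SatLetter c) := Function.update (Function.update (fun _ => []) 0
    (x.map (satEmb c))) 1 (List.replicate N (none, initP c false)) with hR₁
  have e0 : R₁ 0 = x.map (satEmb c) := by simp [hR₁]
  have e1 : R₁ 1 = List.replicate N (none, initP c false) := by simp [hR₁]
  set C₁ : Config (SatLetter c) 2 := ⟨1, R₁, true, [], none⟩ with hC₁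
  have h1 : (satMachine c).run x m 1 = C₁ :=
    (satMachine c).step_of_getElem? x m (c := (satMachine c).init)
      (I := .readBoost 0 1 (satPoly c)) rfl rfl
  have hsym : ∀ a, satSym c (satEmb c a) = a := fun _ => rfl
  have h2 : (satMachine c).run x m 2 = ⟨3, R₁, true, [], none⟩ := by
    rw [Machine.run_succ, h1, (satMachine c).step_of_getElem? x m (c := C₁)
      (I := .ifGoto 1 _ (isAutomaticRel_satValid c) (fun _ => 0) 3) rfl rfl]
    have hv : SatValid c (R₁ 0) := ⟨φ, by rw [e0, List.map_map]; simp [Function.comp_def, hsym, hx]⟩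
    simp only [Machine.exec, hC₁]
    rw [if_pos hv]
  set w := (conv R₁).map (combineLetter c) with hw
  have h3 : SatAt c ((satMachine c).run x m 3) 4 w := by
    rw [Machine.run_succ, h2, (satMachine c).step_of_getElem? x m
      (I := .op 0 2 _ (isAutomaticFun_map_conv (combineLetter c)) id) rfl rfl]
    refine ⟨rfl, ?_, rfl⟩
    change Function.update R₁ 0 w 0 = w
    exact Function.update_self _ _ _
  have hconv : convLength R₁ = N := by
    apply le_antisymm
    · refine convLength_le fun i => ?_
      fin_cases i
      · simpa [e0] using hlen
      · simp [e1]
    · have := length_le_convLength R₁ 1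
      rwa [e1, List.length_replicate] at this
  -- Initially exactly the positions of the input are marked, so the number of marks does not depend
  -- on the adversary.
  have hchk : IsChk φ N 0 0 x.length w := by
    refine ⟨fun p => initP c (decide (p < x.length)), ?_, ?_, fun p => ⟨rfl, rfl⟩⟩
    · rw [hw, conv_def, hconv, List.map_map, tapeW, ← map_initX_encode]
      refine List.map_congr_left fun p hp => ?_
      have : (R₁ 0)[p]?.bind Prod.fst = (φ.encode.map initX)[p]? := by
        rw [e0, ← hx, List.getElem?_map, List.getElem?_map]
        cases x[p]? <;> rfl
      simp only [Function.comp, combineLetter, this]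
      congr 2
      rw [← hx, Bool.eq_iff_iff]; simp
    · rw [markCount]
      exact (count_lt _ _).trans (by omega)
  obtain ⟨S, hS, w', hb, hacc, hrej⟩ := hchk.outcome hlen hpos hpow
  simp only [← hx] at hS hacc hrej
  have h4 := satAt_of_busyFor (x := x) (m := m) h3 hb
  rw [← Machine.run_add] at h4
  constructor
  · intro hs
    have h5 := satAt_accept (x := x) (m := m) h4 (hacc hs)
    rw [← Machine.run_add] at h5
    exact (satMachine c).run_result_of_le x m (by omega) h5
  · intro hs
    have h5 := satAt_reject (x := x) (m := m) h4 (hrej hs).1 (hrej hs).2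
    rw [← Machine.run_add] at h5
    exact (satMachine c).run_result_of_le x m (by omega) h5

theorem satMachine_run_invalid {x : List SatSym} (hx : ¬ ∃ φ : Formula, φ.encode = x) (m : ℕ) :
    ((satMachine c).run x m 3).result = some .reject := by
  set R₁ : Fin 2 → List (SatLetter c) := Function.update (Function.update (fun _ => []) 0
    (x.map (satEmb c))) 1
    (List.replicate ((satPoly c).eval x.length + m) (none, initP c false)) with hR₁
  have e0 : R₁ 0 = x.map (satEmb c) := by simp [hR₁]
  set C₁ : Config (SatLetter c) 2 := ⟨1, R₁, true, [], none⟩ with hC₁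
  have h1 : (satMachine c).run x m 1 = C₁ :=
    (satMachine c).step_of_getElem? x m (c := (satMachine c).init)
      (I := .readBoost 0 1 (satPoly c)) rfl rfl
  have hsym : ∀ a, satSym c (satEmb c a) = a := fun _ => rfl
  have h2 : (satMachine c).run x m 2 = ⟨2, R₁, true, [], none⟩ := by
    rw [Machine.run_succ, h1, (satMachine c).step_of_getElem? x m (c := C₁)
      (I := .ifGoto 1 _ (isAutomaticRel_satValid c) (fun _ => 0) 3) rfl rfl]
    have hv : ¬ SatValid c (R₁ 0) := by
      rintro ⟨φ, hφ⟩
      refine hx ⟨φ, ?_⟩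
      rw [hφ, e0, List.map_map]; simp [Function.comp_def, hsym]
    simp only [Machine.exec, hC₁]
    rw [if_neg hv]
  rw [Machine.run_succ, h2, (satMachine c).step_of_getElem? x m (I := .halt .reject) rfl rfl]
  rfl

theorem natLog_isBigO_log : (fun n => ((Nat.log 2 n : ℕ) : ℝ) + 1) =O[atTop]
    fun n : ℕ => Real.log n := by
  refine IsBigO.of_bound (2 / Real.log 2) ?_
  filter_upwards [eventually_ge_atTop 2] with n hn
  have h2 : 0 < Real.log 2 := Real.log_pos (by norm_num)
  have hn' : (2 : ℝ) ≤ n := by exact_mod_cast hn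
  have h3 : Real.log 2 ≤ Real.log n := Real.log_le_log (by norm_num) hn'
  have h4 : (Nat.log 2 n : ℝ) * Real.log 2 ≤ Real.log n := by
    rw [← Real.log_pow]
    refine Real.log_le_log (by positivity) ?_
    exact_mod_cast Nat.pow_log_le_self 2 (by omega)
  rw [Real.norm_of_nonneg (by positivity), Real.norm_of_nonneg (h2.le.trans h3), div_mul_eq_mul_div,
    le_div_iff₀ h2]
  linarith

theorem logVar3SAT_mem_PDALPolylog (c : ℕ) : logVar3SAT c ∈ PDALPolylog SatSym := by
  -- The exponent `3` stems from the enumeration of triples.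
  refine ⟨3, satMachine c, satMachine_isPARM c, fun n => 4 * satRounds c n + 6, ?_, fun x m => ?_⟩
  · have h1 := natLog_isBigO_log.pow 3
    refine IsBigO.trans (IsBigO.of_bound ((4 * (c + 3) ^ 3 + 6 : ℕ) : ℝ)
      (Eventually.of_forall fun n => ?_)) h1
    rw [Real.norm_of_nonneg (by positivity), Real.norm_of_nonneg (by positivity)]
    have : 4 * satRounds c n + 6 ≤ (4 * (c + 3) ^ 3 + 6) * (Nat.log 2 n + 1) ^ 3 := by
      rw [satRounds]
      generalize Nat.log 2 n = L
      have h2 : (c * L + 1) ^ 3 ≤ ((c + 1) * (L + 1)) ^ 3 := Nat.pow_le_pow_left (by nlinarith) 3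
      have h3 : (c + 1) * L + 1 ≤ (c + 1) * (L + 1) ^ 3 := by
        have : L + 1 ≤ (L + 1) ^ 3 := Nat.le_self_pow (by norm_num) _
        nlinarith
      have h4 : 1 ≤ (L + 1) ^ 3 := Nat.one_le_pow _ _ (by omega)
      rw [mul_pow] at h2
      have h5 : (c + 1) + (c + 1) ^ 3 ≤ (c + 3) ^ 3 := by nlinarith [sq_nonneg c]
      have h6 := Nat.mul_le_mul_right ((L + 1) ^ 3) h5
      nlinarith
    exact_mod_cast this
  · by_cases hx : ∃ φ : Formula, φ.encode = x
    · obtain ⟨φ, rfl⟩ := hx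
      constructor
      · rintro ⟨φ', he, h1, h2⟩
        rw [← he] at h1 ⊢
        exact (satMachine_run φ' m).1 ⟨h1, h2⟩
      · intro hn
        exact (satMachine_run φ m).2 fun hs => hn ⟨φ, rfl, hs.1, hs.2⟩
    · refine ⟨fun hm => ?_, fun _ => ?_⟩
      · obtain ⟨φ, he, -⟩ := hm
        exact absurd ⟨φ, he⟩ hx
      · exact (satMachine c).run_result_of_le x m (by simp only; omega)
          (satMachine_run_invalid hx m)

theorem PDALPolylog_subset_PDALSublinear (A : Type) : PDALPolylog A ⊆ PDALSublinear A := by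
  rintro L ⟨k, hL⟩
  refine ⟨_, ?_, hL⟩
  have h1 : (fun x : ℝ => Real.log x ^ k) =o[atTop] fun x => x := by
    exact Real.isLittleO_pow_log_id_atTop (n := k)
  exact h1.comp_tendsto tendsto_natCast_atTop_atTop

end Correctness

/-! ### Turing machines that sweep over their tape -/

section Sweeps

/-- A pass over the tape from left to right, followed by a pass from right to left. The passes are
carried out by finite-state transducers with states `QL` and `QR`; the result is the next job or the
final decision. -/
structure SweepJob (S K : Type) where
  QL : Type
  finL : Finite QL
  QR : Type
  finR : Finite QR
  init : QL
  stL : QL → S → QL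
  outL : QL → S → S
  turn : QL → QR
  stR : QR → S → QR
  outR : QR → S → S
  next : QR → K ⊕ Bool

variable {S K : Type}

/-- The states of a Turing machine that performs jobs. -/
inductive SweepState (E : ℕ) (job : K → SweepJob S K)
  | begin (k : K)
  | left (k : K) (q : (job k).QL) (e : Fin (E + 1))
  | right (k : K) (q : (job k).QR)
  | halt (b : Bool)

instance (E : ℕ) (job : K → SweepJob S K) [Finite K] : Finite (SweepState E job) := by
  have : ∀ k, Finite (job k).QL := fun k => (job k).finL
  have : ∀ k, Finite (job k).QR := fun k => (job k).finR
  refine Finite.of_injective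
    (β := K ⊕ (Σ k, (job k).QL × Fin (E + 1)) ⊕ (Σ k, (job k).QR) ⊕ Bool)
    (fun s => match s with
      | .begin k => .inl k
      | .left k q e => .inr (.inl ⟨k, q, e⟩)
      | .right k q => .inr (.inr (.inl ⟨k, q⟩))
      | .halt b => .inr (.inr (.inr b))) ?_
  intro s t h
  cases s <;> cases t <;> simp only [Sum.inl.injEq, Sum.inr.injEq, reduceCtorEq] at h
  · rw [h]
  · cases h; rfl
  · cases h; rfl
  · rw [h]

/-- The state that corresponds to the result of a job. -/
def SweepState.ofResult {E : ℕ} {job : K → SweepJob S K} : K ⊕ Bool → SweepState E job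
  | .inl k => .begin k
  | .inr b => .halt b

/-- The transitions of the Turing machine that performs jobs. Each sweep extends the used part of
the tape by `E + 1` cells; the leftmost cell is marked. -/
def sweepδ (E : ℕ) (job : K → SweepJob S K) (dflt : S) :
    SweepState E job → Option (Bool × S) → SweepState E job × Option (Bool × S) × Move
  | .begin _, none => (.halt true, none, .stay)
  | .begin k, some (_, s) =>
      (.left k ((job k).stL (job k).init s) (Fin.last E),
        some (true, (job k).outL (job k).init s), .right)
  | .left k q e, some (b, s) => (.left k ((job k).stL q s) e, some (b, (job k).outL q s), .right)
  | .left k q e, none =>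
      if e.val = 0 then
        (.right k ((job k).turn ((job k).stL q dflt)), some (false, (job k).outL q dflt), .stay)
      else
        (.left k ((job k).stL q dflt) ⟨e.val - 1, by omega⟩, some (false, (job k).outL q dflt),
          .right)
  | .right k q, some (b, s) =>
      if b then
        (.ofResult ((job k).next ((job k).stR q s)), some (b, (job k).outR q s), .stay)
      else (.right k ((job k).stR q s), some (b, (job k).outR q s), .left)
  | .right _ _, none => (.halt false, none, .stay)
  | .halt b, s => (.halt b, s, .stay)

/-- The Turing machine that performs jobs. -/
abbrev sweepTM {A : Type} [Finite S] [Finite K] (E : ℕ) (job : K → SweepJob S K) (dflt : S) (k₀ : K)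
    (inp : A ↪ S) : TuringMachine A where
  Γ := Option (Bool × S)
  finΓ := inferInstance
  Q := SweepState E job
  finQ := inferInstance
  blank := none
  emb := ⟨fun a => some (false, inp a), fun a b h => inp.injective (by simpa using h)⟩
  emb_ne_blank a := by simp
  start := .begin k₀
  accept := .halt true
  reject := .halt false
  accept_ne_reject := by simp
  δ := sweepδ E job dflt

/-- A tape with the contents `t` on its first `N` cells. -/
def sweepTape (b : Bool) (t : ℕ → S) (N : ℕ) : ℕ → Option (Bool × S) :=
  fun p => if p < N then some (if p = 0 then b else false, t p) else none

/-- The effect of a job on the contents `t` of the first `N` cells. -/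
def SweepResult (J : SweepJob S K) (N : ℕ) (t t' : ℕ → S) (res : K ⊕ Bool) : Prop :=
  ∃ (q : ℕ → J.QL) (r : ℕ → J.QR), q 0 = J.init ∧ (∀ p, q (p + 1) = J.stL (q p) (t p)) ∧
    r N = J.turn (q N) ∧ (∀ p < N, r p = J.stR (r (p + 1)) (J.outL (q p) (t p))) ∧
    (∀ p < N, t' p = J.outR (r (p + 1)) (J.outL (q p) (t p))) ∧ J.next (r 0) = res

/-- The states of the left pass. -/
def SweepJob.lState (J : SweepJob S K) (t : ℕ → S) : ℕ → J.QL
  | 0 => J.init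
  | p + 1 => J.stL (J.lState t p) (t p)

theorem exists_backward {Q : Type} (N : ℕ) (z : Q) (f : ℕ → Q → Q) :
    ∃ r : ℕ → Q, r N = z ∧ ∀ p < N, r p = f p (r (p + 1)) := by
  induction N generalizing z with
  | zero => exact ⟨fun _ => z, rfl, fun p hp => absurd hp (Nat.not_lt_zero p)⟩
  | succ N ih =>
    obtain ⟨r, h1, h2⟩ := ih (f N z)
    refine ⟨Function.update r (N + 1) z, Function.update_self _ _ _, fun p hp => ?_⟩
    rw [Function.update_of_ne (by omega)]
    by_cases hpN : p = N
    · subst hpN; rw [Function.update_self, h1]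
    · rw [Function.update_of_ne (by omega)]; exact h2 p (by omega)

variable {A : Type} [Finite S] [Finite K] {E : ℕ} {job : K → SweepJob S K} {dflt : S} {k₀ : K}
  {inp : A ↪ S}

theorem TuringMachine.step_of_running {M : TuringMachine A} {c : TMConfig M.Γ M.Q}
    (h1 : c.state ≠ M.accept) (h2 : c.state ≠ M.reject) {q : M.Q} {s : M.Γ} {m : Move}
    (hδ : M.δ c.state (c.tape c.head) = (q, s, m)) :
    M.step c = ⟨q, TuringMachine.move c.head m, Function.update c.tape c.head s⟩ := by
  rw [TuringMachine.step, if_neg (by tauto), hδ]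

theorem sweepTM_step {u q : SweepState E job} {p : ℕ} {τ : ℕ → Option (Bool × S)}
    {s : Option (Bool × S)} {m : Move} (hu : ∀ b, u ≠ .halt b)
    (hδ : sweepδ E job dflt u (τ p) = (q, s, m)) :
    (sweepTM E job dflt k₀ inp).step ⟨u, p, τ⟩ =
      ⟨q, TuringMachine.move p m, Function.update τ p s⟩ :=
  TuringMachine.step_of_running (hu true) (hu false) hδ

/-- The tape during the left pass. -/
def leftTape (t t₁ : ℕ → S) (N j : ℕ) : ℕ → Option (Bool × S) :=
  fun p => if p < j then some (decide (p = 0), t₁ p) else if p < N then some (false, t p) else none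

/-- The tape during the right pass. -/
def rightTape (t₁ t' : ℕ → S) (N j : ℕ) : ℕ → Option (Bool × S) :=
  fun p => if p < N then some (decide (p = 0), if p < j then t₁ p else t' p) else none

theorem update_leftTape (t t₁ : ℕ → S) (N j : ℕ) :
    Function.update (leftTape t t₁ N j) j (some (decide (j = 0), t₁ j)) =
      leftTape t t₁ N (j + 1) := by
  funext p
  by_cases hp : p = j
  · subst hp; simp [leftTape]
  · rw [Function.update_of_ne hp, leftTape, leftTape]
    have : p < j + 1 ↔ p < j := by omega
    simp only [this]

theorem update_rightTape (t₁ t' : ℕ → S) {N j : ℕ} (hj : j < N) :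
    Function.update (rightTape t₁ t' N (j + 1)) j (some (decide (j = 0), t' j)) =
      rightTape t₁ t' N j := by
  funext p
  by_cases hp : p = j
  · subst hp; simp [rightTape, hj]
  · rw [Function.update_of_ne hp, rightTape, rightTape]
    have : p < j + 1 ↔ p < j := by omega
    simp only [this]

/-- One sweep. -/
theorem sweepTM_sweep {k : K} {N : ℕ} (hN : 0 < N) {t t' : ℕ → S} (ht : ∀ p, N ≤ p → t p = dflt)
    {res : K ⊕ Bool} (h : SweepResult (job k) (N + (E + 1)) t t' res) (b : Bool) :
    (sweepTM E job dflt k₀ inp).step^[2 * (N + (E + 1))] ⟨.begin k, 0, sweepTape b t N⟩ =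
      ⟨.ofResult res, 0, sweepTape true t' (N + (E + 1))⟩ := by
  obtain ⟨q, r, hq0, hq, hrN, hr, ht', hres⟩ := h
  set t₁ : ℕ → S := fun p => (job k).outL (q p) (t p) with ht₁
  set N' := N + (E + 1) with hN'
  -- The budget of new cells stays at `E` on the first `N` cells, by truncated subtraction, and then
  -- counts down; at `0` one more blank cell is filled and the pass turns.
  have hleft : ∀ j, j + 1 ≤ N + E → (sweepTM E job dflt k₀ inp).step^[j + 1] ⟨.begin k, 0, sweepTape b t N⟩ =
      ⟨.left k (q (j + 1)) ⟨E - (j + 1 - N), by omega⟩, j + 1, leftTape t t₁ N (j + 1)⟩ := by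
    intro j
    induction j with
    | zero =>
      intro _
      change (sweepTM E job dflt k₀ inp).step _ = _
      rw [sweepTM_step (by simp)
        (q := .left k (q 1) (Fin.last E)) (s := some (true, t₁ 0)) (m := .right)
        (by
          simp only [sweepTape, if_pos hN, if_true]
          rw [sweepδ, hq, hq0, ht₁]
          simp only [hq0])]
      congr 1
      · congr 1
        exact Fin.ext (by simp; omega)
      · rw [← update_leftTape]
        -- The leftmost cell is unmarked on the original input and marked after a sweep; the first
        -- step sets the mark in either case.
        have : sweepTape b t N = Function.update (leftTape t t₁ N 0) 0 (some (b, t 0)) := by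
          funext p
          by_cases hp : p = 0
          · subst hp; simp [sweepTape, hN]
          · simp [sweepTape, leftTape, hp]
        rw [this, Function.update_idem]; rfl
    | succ j ih =>
      intro hj
      rw [Function.iterate_succ_apply', ih (by omega)]
      have hout : t₁ (j + 1) = (job k).outL (q (j + 1)) (t (j + 1)) := rfl
      have hst := hq (j + 1)
      rw [← update_leftTape _ _ _ (j + 1)]
      by_cases hjN : j + 1 < N
      · rw [sweepTM_step (by simp)
          (q := .left k (q (j + 1 + 1)) ⟨E - (j + 1 - N), by omega⟩)
          (s := some (false, t₁ (j + 1))) (m := .right)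
          (by
            simp only [leftTape, lt_irrefl, if_false, if_pos hjN]
            rw [sweepδ, hst])]
        congr 1
        congr 1
        exact Fin.ext (by simp; omega)
      · rw [sweepTM_step (by simp)
          (q := .left k (q (j + 1 + 1)) ⟨E - (j + 1 - N) - 1, by omega⟩)
          (s := some (false, t₁ (j + 1))) (m := .right)
          (by
            simp only [leftTape, lt_irrefl, if_false, if_neg hjN]
            rw [sweepδ, if_neg (by simp; omega), hst, hout, ht (j + 1) (by omega)])]
        congr 1
        congr 1
        exact Fin.ext (by simp; omega)
  have hturn : (sweepTM E job dflt k₀ inp).step^[N'] ⟨.begin k, 0, sweepTape b t N⟩ =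
      ⟨.right k (r N'), N' - 1, rightTape t₁ t' N' N'⟩ := by
    rw [show N' = N + E + 1 from rfl, Function.iterate_succ_apply']
    obtain ⟨e, he, h1⟩ : ∃ e : Fin (E + 1), e.val = 0 ∧
        (sweepTM E job dflt k₀ inp).step^[N + E] ⟨.begin k, 0, sweepTape b t N⟩ =
          ⟨.left k (q (N + E)) e, N + E, leftTape t t₁ N (N + E)⟩ := by
      obtain ⟨n, hn⟩ : ∃ n, N + E = n + 1 := ⟨N + E - 1, by omega⟩
      rw [hn]
      exact ⟨_, by simp; omega, hleft n hn.ge⟩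
    rw [h1]
    have hst := hq (N + E)
    rw [sweepTM_step (by simp)
      (q := .right k (r N')) (s := some (false, t₁ (N + E))) (m := .stay)
      (by
        simp only [leftTape, lt_irrefl, if_false, show ¬ N + E < N by omega]
        rw [sweepδ, if_pos he, hrN]
        rw [show N' = N + E + 1 from rfl, hst, ht₁]
        simp only [ht (N + E) (by omega)])]
    congr 1
    have h3 := update_leftTape t t₁ N (N + E)
    rw [show decide (N + E = 0) = false by simp; omega] at h3
    rw [h3]
    funext p
    simp only [leftTape, rightTape]
    by_cases hp : p < N + E + 1
    · simp [hp]
    · simp [hp, show ¬ p < N by omega]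
  have hright : ∀ i, i + 1 ≤ N' → (sweepTM E job dflt k₀ inp).step^[i] ⟨.right k (r N'), N' - 1, rightTape t₁ t' N' N'⟩ =
      ⟨.right k (r (N' - i)), N' - i - 1, rightTape t₁ t' N' (N' - i)⟩ := by
    intro i
    induction i with
    | zero => intro _; rfl
    | succ i ih =>
      intro hi
      rw [Function.iterate_succ_apply', ih (by omega)]
      obtain ⟨j, hj⟩ : ∃ j, N' - i = j + 2 := ⟨N' - i - 2, by omega⟩
      have hj' : N' - (i + 1) = j + 1 := by omega
      rw [hj, hj']
      rw [sweepTM_step (by simp)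
        (q := .right k (r (j + 1))) (s := some (false, t' (j + 1))) (m := .left)
        (by
          simp only [rightTape, show j + 2 - 1 < N' by omega, if_true,
            show j + 2 - 1 < j + 2 by omega]
          rw [sweepδ]
          simp only [show j + 2 - 1 = j + 1 by omega, hr (j + 1) (by omega), ht' (j + 1) (by omega)]
          simp only [Nat.add_eq_zero_iff, one_ne_zero, and_false, decide_false, Bool.false_eq_true, if_false]
          rfl)]
      have h3 := update_rightTape t₁ t' (N := N') (j := j + 1) (by omega)
      rw [← h3]
      simp [TuringMachine.move]
  rw [two_mul, Function.iterate_add_apply, hturn]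
  have h4 := hright (N' - 1) (by omega)
  obtain ⟨n, hn⟩ : ∃ n, N' = n + 1 := ⟨N + E, rfl⟩
  rw [show (sweepTM E job dflt k₀ inp).step^[N'] = (sweepTM E job dflt k₀ inp).step^[(N' - 1) + 1] by rw [Nat.sub_add_cancel (by omega)],
    Function.iterate_succ_apply', h4, show N' - (N' - 1) = 1 by omega]
  rw [sweepTM_step (by simp)
    (q := .ofResult res) (s := some (true, t' 0)) (m := .stay)
    (by
      simp only [rightTape, show 1 - 1 < N' by omega, if_true, show 1 - 1 < 1 by omega]
      rw [sweepδ]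
      simp only [show 1 - 1 = 0 from rfl, ← hres, hr 0 (by omega), ht' 0 (by omega), ht₁]
      simp)]
  have h3 := update_rightTape t₁ t' (N := N') (j := 0) (by omega)
  rw [show some (true, t' 0) = some (decide (0 = 0), t' 0) by simp]
  change TMConfig.mk _ _ (Function.update (rightTape t₁ t' N' (0 + 1)) 0 _) = _
  rw [h3]
  congr 1

/-- `W` sweeps lead from the job `k` with tape contents `t` on `N` cells to `res` and `t'`. -/
def SweepReach (A : Type) (E : ℕ) (job : K → SweepJob S K) (dflt : S) (k₀ : K) (inp : A ↪ S)
    (W : ℕ) (k : K) (t : ℕ → S) (N : ℕ) (res : K ⊕ Bool) (t' : ℕ → S) : Prop :=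
  (∀ p, N + W * (E + 1) ≤ p → t' p = dflt) ∧
  ∀ b, ∃ b' T, T ≤ 2 * W * (N + W * (E + 1)) ∧
    (sweepTM E job dflt k₀ inp).step^[T] ⟨.begin k, 0, sweepTape b t N⟩ =
      ⟨.ofResult res, 0, sweepTape b' t' (N + W * (E + 1))⟩

theorem SweepReach.refl {k : K} {t : ℕ → S} {N : ℕ} (ht : ∀ p, N ≤ p → t p = dflt) :
    SweepReach A E job dflt k₀ inp 0 k t N (.inl k) t :=
  ⟨by simpa using ht, fun b => ⟨b, 0, by simp, by simp [SweepState.ofResult]⟩⟩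

theorem SweepReach.trans {W W' : ℕ} {k k' : K} {t t' t'' : ℕ → S} {N : ℕ} {res : K ⊕ Bool}
    (h : SweepReach A E job dflt k₀ inp W k t N (.inl k') t')
    (h' : SweepReach A E job dflt k₀ inp W' k' t' (N + W * (E + 1)) res t'') :
    SweepReach A E job dflt k₀ inp (W + W') k t N res t'' := by
  obtain ⟨-, h2⟩ := h
  obtain ⟨h1', h2'⟩ := h'
  have hN : N + W * (E + 1) + W' * (E + 1) = N + (W + W') * (E + 1) := by ring
  rw [hN] at h1' h2'
  refine ⟨h1', fun b => ?_⟩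
  obtain ⟨b₁, T, hT, h3⟩ := h2 b
  obtain ⟨b₂, T', hT', h4⟩ := h2' b₁
  refine ⟨b₂, T' + T, ?_, ?_⟩
  · have : N + W * (E + 1) ≤ N + (W + W') * (E + 1) := by rw [← hN]; omega
    calc T' + T ≤ 2 * W' * (N + (W + W') * (E + 1)) + 2 * W * (N + W * (E + 1)) := by omega
      _ ≤ 2 * W' * (N + (W + W') * (E + 1)) + 2 * W * (N + (W + W') * (E + 1)) := by gcongr
      _ = _ := by ring
  · rw [Function.iterate_add_apply, h3]; exact h4

theorem SweepReach.single {k : K} {t t' : ℕ → S} {N : ℕ} {res : K ⊕ Bool} (hN : 0 < N)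
    (ht : ∀ p, N ≤ p → t p = dflt) (ht' : ∀ p, N + (E + 1) ≤ p → t' p = dflt)
    (h : SweepResult (job k) (N + (E + 1)) t t' res) :
    SweepReach A E job dflt k₀ inp 1 k t N res t' := by
  refine ⟨by simpa using ht', fun b => ⟨true, 2 * (N + (E + 1)), by simp, ?_⟩⟩
  rw [sweepTM_sweep hN ht h, one_mul]

end Sweeps

/-! ### Automatic functions and relations evaluated by sweeps -/

section Jobs

variable {A Γ K σ : Type} {r m k : ℕ}

/-- The letters of the sweeping Turing machine: a letter of the source word, a letter of each
register, and a scratch letter. -/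
abbrev Cell (A Γ : Type) (r m : ℕ) : Type := (Option A × (Fin r → Option Γ)) × Fin (m + 1)

/-- The blank cell. -/
abbrev Cell.blank (A Γ : Type) (r m : ℕ) : Cell A Γ r m := ((none, fun _ => none), 0)

/-- The first `N` cells hold the source word `w` and the register contents `regs`. -/
def Represents (w : List A) (regs : Fin r → List Γ) (N : ℕ) (t : ℕ → Cell A Γ r m) : Prop :=
  (∀ p, (t p).1 = (w[p]?, fun i => (regs i)[p]?)) ∧ ∀ p, N ≤ p → t p = Cell.blank A Γ r m

theorem Represents.getElem?_eq_none {w : List A} {regs : Fin r → List Γ} {N : ℕ}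
    {t : ℕ → Cell A Γ r m} (h : Represents w regs N t) {p : ℕ} (hp : N ≤ p) :
    w[p]? = none ∧ ∀ i, (regs i)[p]? = none := by
  have h1 := h.1 p
  rw [h.2 p hp] at h1
  obtain ⟨h2, h3⟩ := Prod.ext_iff.1 h1
  exact ⟨h2.symm, fun i => (congrFun h3 i).symm⟩

open Classical in
/-- A state in `X` and a letter that lead to the state `q`, if there are any. -/
noncomputable def predecessor (D : DFA (Fin (k + 1) → Option Γ) σ) (X : Set σ)
    (a : Fin k → Option Γ) (q : σ) : σ × Option Γ :=
  if h : ∃ z : σ × Option Γ, z.1 ∈ X ∧ D.step z.1 (Fin.snoc (α := fun _ => Option Γ) a z.2) = q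
  then h.choose else (q, none)

theorem predecessor_spec {D : DFA (Fin (k + 1) → Option Γ) σ} {X : Set σ}
    {a : Fin k → Option Γ} {q : σ}
    (h : ∃ z : σ × Option Γ, z.1 ∈ X ∧
      D.step z.1 (Fin.snoc (α := fun _ => Option Γ) a z.2) = q) :
    (predecessor D X a q).1 ∈ X ∧
      D.step (predecessor D X a q).1
        (Fin.snoc (α := fun _ => Option Γ) a (predecessor D X a q).2) = q := by
  rw [predecessor, dif_pos h]
  exact h.choose_spec

open Classical in
/-- An accepting state in `X`, if there is any. -/
noncomputable def acceptingState {α : Type} (D : DFA α σ) (X : Set σ) : σ :=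
  if h : ∃ q ∈ X, q ∈ D.accept then h.choose else D.start

theorem acceptingState_spec {α : Type} {D : DFA α σ} {X : Set σ} (h : ∃ q ∈ X, q ∈ D.accept) :
    acceptingState D X ∈ X ∧ acceptingState D X ∈ D.accept := by
  rw [acceptingState, dif_pos h]
  exact h.choose_spec

/-- The job that computes the value of an automatic function: the left pass performs the subset
construction for the automaton of the graph, the right pass guesses the value backwards. -/
noncomputable def updateJob [Finite σ] (D : DFA (Fin (k + 1) → Option Γ) σ)
    (code : Set σ → Fin (m + 1)) (rd : Fin k → Option A × (Fin r → Option Γ) → Option Γ)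
    (i : Fin r) (κ : K) : SweepJob (Cell A Γ r m) K where
  QL := Set σ
  finL := inferInstance
  QR := σ
  finR := inferInstance
  init := {D.start}
  stL X s := {q | ∃ q' ∈ X, ∃ y,
    D.step q' (Fin.snoc (α := fun _ => Option Γ) (fun a => rd a s.1) y) = q}
  outL X s := (s.1, code X)
  turn := acceptingState D
  stR q s := (predecessor D (Function.invFun code s.2) (fun a => rd a s.1) q).1
  outR q s := ((s.1.1, Function.update s.1.2 i
    (predecessor D (Function.invFun code s.2) (fun a => rd a s.1) q).2), s.2)
  next _ := .inl κ

theorem DFA_eval_range_succ {α : Type} (D : DFA α σ) (f : ℕ → α) (p : ℕ) :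
    D.eval ((List.range (p + 1)).map f) = D.step (D.eval ((List.range p).map f)) (f p) := by
  rw [List.range_succ, List.map_append, List.map_singleton, DFA.eval_append_singleton]

theorem eq_of_getElem?_of_length_le {u v : List Γ} {N : ℕ} (hu : u.length ≤ N) (hv : v.length ≤ N)
    (h : ∀ p < N, u[p]? = v[p]?) : u = v := by
  refine List.ext_getElem? fun p => ?_
  by_cases hp : p < N
  · exact h p hp
  · rw [List.getElem?_eq_none (by omega), List.getElem?_eq_none (by omega)]

/-- The left pass stores in the scratch track the sets of states that are reachable for some choice
of the value. The right pass starts in an accepting state and selects predecessors in these sets,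
which yields an accepting run. As the automaton recognizes the graph of a function, the letters
along any such run spell `F v`. -/
theorem exists_updateJob {F : (Fin k → List Γ) → List Γ} (hF : IsAutomaticFun F)
    (rd : Fin k → Option A × (Fin r → Option Γ) → Option Γ)
    (hrd : ∀ a, rd a (none, fun _ => none) = none) :
    ∀ᶠ m in atTop, ∀ (K : Type) (κ : K) (i : Fin r), ∃ J : SweepJob (Cell A Γ r m) K,
      ∀ (v : Fin k → List Γ) (w : List A) (regs : Fin r → List Γ) (N : ℕ) (t : ℕ → Cell A Γ r m),
        Represents w regs N t → (∀ a (p : ℕ), rd a (w[p]?, fun i => (regs i)[p]?) = (v a)[p]?) →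
        ∃ t', SweepResult J (N + (m + 1)) t t' (.inl κ) ∧
          Represents w (Function.update regs i (F v)) (N + (m + 1)) t' := by
  obtain ⟨B, hB⟩ := hF.exists_length_le
  obtain ⟨σ, _, D, hD⟩ := IsAutomaticRel.exists_dfa hF
  -- The number `m` has two tasks: the `m + 1` new cells hold the growth of the value, and the `m +
  -- 1` scratch letters code the sets of states.
  filter_upwards [eventually_ge_atTop (max B (Nat.card (Set σ)))] with m hm K κ i
  have hm1 : B ≤ m := le_trans (le_max_left _ _) hm
  have hm2 : Nat.card (Set σ) ≤ m + 1 := le_trans (le_max_right _ _) (hm.trans m.le_succ)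
  let code : Set σ → Fin (m + 1) := fun X => Fin.castLE hm2 (Finite.equivFin (Set σ) X)
  have hcode : Function.Injective code :=
    (Fin.castLE_injective hm2).comp (Finite.equivFin (Set σ)).injective
  have hdec : ∀ X, Function.invFun code (code X) = X := Function.leftInverse_invFun hcode
  refine ⟨updateJob D code rd i κ, fun v w regs N t ht hv => ?_⟩
  set J : SweepJob (Cell A Γ r m) K := updateJob D code rd i κ with hJ
  set N' := N + (m + 1) with hN'
  have hletter : ∀ p, (fun a => rd a (t p).1) = fun a => (v a)[p]? := by
    intro p; funext a; rw [ht.1 p, hv]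
  have hvN : ∀ a, (v a).length ≤ N := by
    intro a
    have h1 := hv a N
    rw [(ht.getElem?_eq_none le_rfl).1, funext (ht.getElem?_eq_none le_rfl).2, hrd] at h1
    exact List.getElem?_eq_none_iff.1 h1.symm
  have hFN : (F v).length ≤ N' := by
    have h1 : convLength v ≤ N := convLength_le hvN
    have h2 := hB v
    omega
  let X : ℕ → Set σ := J.lState t
  have hX0 : X 0 = {D.start} := rfl
  have hXs : ∀ p, X (p + 1) = {q | ∃ q' ∈ X p, ∃ y,
      D.step q' (Fin.snoc (α := fun _ => Option Γ) (fun a => (v a)[p]?) y) = q} := by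
    intro p
    rw [← hletter p]; rfl
  -- The run on the true value stays inside the sets, so the last set contains an accepting state.
  have hmem : ∀ p, D.eval ((List.range p).map fun p =>
      Fin.snoc (α := fun _ => Option Γ) (fun a => (v a)[p]?) (F v)[p]?) ∈ X p := by
    intro p
    induction p with
    | zero => rw [hX0]; rfl
    | succ p ih =>
      rw [DFA_eval_range_succ, hXs]
      exact ⟨_, ih, _, rfl⟩
  have hacc : ∃ q ∈ X N', q ∈ D.accept := by
    refine ⟨_, hmem N', (hD _ _).2 ⟨Fin.snoc (α := fun _ => List Γ) v (F v), by simp, ?_, ?_⟩⟩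
    · intro a
      refine Fin.lastCases ?_ (fun a => ?_) a
      · simpa using hFN
      · simpa using (hvN a).trans (by omega)
    · intro p _ a
      refine Fin.lastCases ?_ (fun a => ?_) a <;> simp
  obtain ⟨ρ, hρN, hρ⟩ := exists_backward N' (J.turn (X N'))
    fun p q => (predecessor D (X p) (fun a => (v a)[p]?) q).1
  let y : ℕ → Option Γ := fun p => (predecessor D (X p) (fun a => (v a)[p]?) (ρ (p + 1))).2
  have hρN' : ρ N' ∈ X N' ∧ ρ N' ∈ D.accept := by
    rw [hρN]
    exact acceptingState_spec hacc
  have hspec : ∀ p < N', ρ (p + 1) ∈ X (p + 1) → ρ p ∈ X p ∧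
      D.step (ρ p) (Fin.snoc (α := fun _ => Option Γ) (fun a => (v a)[p]?) (y p)) = ρ (p + 1) := by
    intro p hp h
    rw [hXs] at h
    obtain ⟨q', hq', y', hy'⟩ := h
    rw [hρ p hp]
    exact predecessor_spec ⟨(q', y'), hq', hy'⟩
  have hρX : ∀ j p, p + j = N' → ρ p ∈ X p := by
    intro j
    induction j with
    | zero => rintro p rfl; exact hρN'.1
    | succ j ih => intro p hp; exact (hspec p (by omega) (ih (p + 1) (by omega))).1
  have hrun : ∀ p ≤ N', D.eval ((List.range p).map fun p =>
      Fin.snoc (α := fun _ => Option Γ) (fun a => (v a)[p]?) (y p)) = ρ p := by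
    intro p
    induction p with
    | zero =>
      intro _
      have h1 := hρX N' 0 (by omega)
      rw [hX0] at h1
      exact h1.symm
    | succ p ih =>
      intro hp
      rw [DFA_eval_range_succ, ih (by omega)]
      exact (hspec p (by omega) (hρX (N' - (p + 1)) (p + 1) (by omega))).2
  have hy : ∀ p < N', y p = (F v)[p]? := by
    have h1 := hρN'.2
    rw [← hrun N' le_rfl] at h1
    obtain ⟨u, hu, hlen, hp⟩ := (hD _ _).1 h1
    have hv' : (fun a : Fin k => u a.castSucc) = v := by
      funext a
      refine eq_of_getElem?_of_length_le (hlen _) ((hvN a).trans (by omega)) fun p hpN => ?_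
      simpa using (hp p hpN a.castSucc).symm
    intro p hpN
    have h2 := hp p hpN (Fin.last k)
    rw [Fin.snoc_last, hu, hv'] at h2
    exact h2
  refine ⟨fun p => if p < N' then (((t p).1.1, Function.update (t p).1.2 i (y p)), code (X p))
    else Cell.blank A Γ r m, ⟨X, ρ, rfl, fun p => rfl, hρN, ?_, ?_, rfl⟩, ?_, ?_⟩
  · intro p hp
    rw [hρ p hp]
    change _ = (predecessor D (Function.invFun code (code (X p))) (fun a => rd a (t p).1) _).1
    rw [hdec, hletter]
  · intro p hp
    simp only [if_pos hp]
    change _ = (((t p).1.1, Function.update (t p).1.2 i (predecessor D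
      (Function.invFun code (code (X p))) (fun a => rd a (t p).1) _).2), code (X p))
    rw [hdec, hletter]
  · intro p
    by_cases hp : p < N'
    · simp only [if_pos hp, ht.1 p, hy p hp]
      congr 1
      funext j
      by_cases hj : j = i
      · subst hj; simp
      · simp [hj]
    · simp only [if_neg hp]
      obtain ⟨h1, h2⟩ := ht.getElem?_eq_none (p := p) (by omega)
      rw [h1]
      congr 1
      funext j
      by_cases hj : j = i
      · subst hj
        rw [Function.update_self, List.getElem?_eq_none (by omega)]
      · rw [Function.update_of_ne hj, h2]
  · intro p hp
    simp only [if_neg (not_lt.2 hp)]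

open Classical in
/-- The job that tests an automatic relation. -/
noncomputable def testJob [Finite σ] (D : DFA (Fin k → Option Γ) σ)
    (rd : Fin k → Option A × (Fin r → Option Γ) → Option Γ) (κ κ' : K) :
    SweepJob (Cell A Γ r m) K where
  QL := σ
  finL := inferInstance
  QR := Bool
  finR := inferInstance
  init := D.start
  stL q s := D.step q fun a => rd a s.1
  outL _ s := s
  turn q := decide (q ∈ D.accept)
  stR b _ := b
  outR _ s := s
  next b := .inl (if b then κ else κ')

open Classical in
-- The automaton runs during the left pass; the right pass merely carries the verdict back, and the
-- tape contents stay as they are.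
theorem exists_testJob {R : (Fin k → List Γ) → Prop} (hR : IsAutomaticRel R)
    (rd : Fin k → Option A × (Fin r → Option Γ) → Option Γ)
    (hrd : ∀ a, rd a (none, fun _ => none) = none) (m : ℕ) (K : Type) (κ κ' : K) :
    ∃ J : SweepJob (Cell A Γ r m) K,
      ∀ (v : Fin k → List Γ) (w : List A) (regs : Fin r → List Γ) (N : ℕ) (t : ℕ → Cell A Γ r m),
        Represents w regs N t → (∀ a (p : ℕ), rd a (w[p]?, fun i => (regs i)[p]?) = (v a)[p]?) →
        SweepResult J (N + (m + 1)) t t (.inl (if R v then κ else κ')) := by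
  obtain ⟨σ, _, D, hD⟩ := hR.exists_dfa
  refine ⟨testJob D rd κ κ', fun v w regs N t ht hv => ?_⟩
  set N' := N + (m + 1) with hN'
  have hletter : ∀ p, (fun a => rd a (t p).1) = fun a => (v a)[p]? := by
    intro p; funext a; rw [ht.1 p, hv]
  have hvN : ∀ a, (v a).length ≤ N' := by
    intro a
    have h1 := hv a N
    rw [(ht.getElem?_eq_none le_rfl).1, funext (ht.getElem?_eq_none le_rfl).2, hrd] at h1
    exact (List.getElem?_eq_none_iff.1 h1.symm).trans (by omega)
  have hacc : D.eval ((List.range N').map fun p a => (v a)[p]?) ∈ D.accept ↔ R v := by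
    rw [hD]
    refine ⟨?_, fun h => ⟨v, h, hvN, fun _ _ _ => rfl⟩⟩
    rintro ⟨u, hu, hlen, hp⟩
    have : u = v := funext fun a =>
      eq_of_getElem?_of_length_le (hlen a) (hvN a) fun p hpN => (hp p hpN a).symm
    rwa [← this]
  refine ⟨fun p => D.eval ((List.range p).map fun p a => (v a)[p]?), fun _ => decide (R v), rfl,
    fun p => ?_, ?_, fun _ _ => rfl, fun _ _ => rfl, ?_⟩
  · refine (DFA_eval_range_succ D _ p).trans ?_
    rw [← hletter]; rfl
  · change _ = decide (_ ∈ D.accept)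
    simp only [hacc]
  · change Sum.inl (if decide (R v) = true then κ else κ') = _
    simp only [decide_eq_true_eq]

/-- The job that appends the word `u` to the source word and empties all registers if `clear`. -/
def growJob (u : List A) (clear : Bool) (res : K ⊕ Bool) : SweepJob (Cell A Γ r m) K where
  QL := Fin (u.length + 1)
  finL := inferInstance
  QR := Unit
  finR := inferInstance
  init := 0
  stL j s := if h : s.1.1 = none ∧ j.val < u.length then ⟨j.val + 1, by omega⟩ else j
  outL j s := ((s.1.1 <|> u[j.val]?, if clear then fun _ => none else s.1.2), 0)
  turn _ := ()
  stR _ _ := ()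
  outR _ s := s
  next _ := res

theorem growJob_result {u : List A} (hu : u.length ≤ m + 1) (clear : Bool) (res : K ⊕ Bool)
    {w : List A} {regs : Fin r → List Γ} {N : ℕ} {t : ℕ → Cell A Γ r m}
    (ht : Represents w regs N t) :
    ∃ t', SweepResult (growJob u clear res) (N + (m + 1)) t t' res ∧
      Represents (w ++ u) (if clear then fun _ => [] else regs) (N + (m + 1)) t' := by
  have hw : w.length ≤ N := List.getElem?_eq_none_iff.1 (ht.getElem?_eq_none le_rfl).1
  have hsrc : ∀ p, (t p).1.1 = w[p]? := fun p => by rw [ht.1 p]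
  -- The state at cell `p` is the number of letters of `u` already written: it grows behind the end
  -- of `w` until `u` is used up.
  refine ⟨fun p => (((w ++ u)[p]?, if clear then fun _ => none else (t p).1.2), 0),
    ⟨fun p => ⟨min (p - w.length) u.length, by omega⟩, fun _ => (), ?_, ?_, rfl, fun _ _ => rfl,
      ?_, rfl⟩, ?_, ?_⟩
  · exact Fin.ext (by simp [growJob])
  · intro p
    simp only [growJob, hsrc, List.getElem?_eq_none_iff]
    split_ifs with h
    · exact Fin.ext (by simp at h ⊢; omega)
    · exact Fin.ext (by simp at h ⊢; omega)
  · intro p _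
    simp only [growJob, hsrc]
    congr 2
    by_cases hp : p < w.length
    · rw [List.getElem?_append_left hp, List.getElem?_eq_getElem hp]; rfl
    · rw [List.getElem?_append_right (by omega), List.getElem?_eq_none (l := w) (by omega)]
      rcases le_total (p - w.length) u.length with h | h
      · rw [min_eq_left h]; rfl
      · rw [min_eq_right h, List.getElem?_eq_none h, List.getElem?_eq_none le_rfl]; rfl
  · intro p
    simp only [ht.1 p]
    cases clear <;> simp
  · intro p hp
    obtain ⟨h1, h2⟩ := ht.getElem?_eq_none (p := p) (by omega)
    simp only [List.getElem?_eq_none (l := w ++ u) (i := p) (by simp; omega), ht.2 p (by omega)]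
    cases clear <;> rfl

end Jobs

/-! ### Turing machine simulation of a DARM -/

section Simulation

variable {A : Type}

/-- It holds for all large `m`, since the finitely many instructions must finally share one `m`. The
relabelling `f` is applied while reading, so one source word serves for several inputs. -/
theorem exists_instrJob (M : Machine A) (f : A → A) (I : Instr A M.Γ M.r)
    (hI : ∀ v, I ≠ .halt v) (hI' : ∀ i j p, I ≠ .readBoost i j p) :
    ∀ᶠ m in atTop, ∀ (K : Type) (line : ℕ → K) (n : ℕ), ∃ J : SweepJob (Cell A M.Γ M.r m) K,
      ∀ (c : Config M.Γ M.r) (a : ℕ) (w : List A) (N : ℕ) (t : ℕ → Cell A M.Γ M.r m),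
        c.pc = n → Represents w c.regs N t →
        ∃ t', SweepResult J (N + (m + 1)) t t' (.inl (line (M.exec (w.map f) a c I).pc)) ∧
          Represents w (M.exec (w.map f) a c I).regs (N + (m + 1)) t' := by
  cases I with
  | read i =>
    filter_upwards [exists_updateJob (A := A) (Γ := M.Γ) (r := M.r) (isAutomaticFun_id)
      (fun _ d => d.1.map fun a => M.emb (f a)) (fun _ => rfl)] with m hm K line n
    obtain ⟨J, hJ⟩ := hm K (line (n + 1)) i
    refine ⟨J, fun c a w N t hc ht => ?_⟩
    subst hc
    exact hJ (fun _ => (w.map f).map M.emb) w c.regs N t ht (fun _ p => by simp; rfl)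
  | readBoost i j p => exact absurd rfl (hI' i j p)
  | write i =>
    refine Eventually.of_forall fun m K line n => ⟨growJob [] false (.inl (line (n + 1))),
      fun c a w N t hc ht => ?_⟩
    subst hc
    obtain ⟨t', h1, h2⟩ := growJob_result (u := []) (by simp) false (.inl (line (c.pc + 1))) ht
    exact ⟨t', h1, by simpa [Machine.exec] using h2⟩
  | const i u =>
    filter_upwards [exists_updateJob (A := A) (Γ := M.Γ) (r := M.r)
      (isAutomaticFun_const (u.map M.emb)) (fun _ _ => none) (fun _ => rfl)] with m hm K line n
    obtain ⟨J, hJ⟩ := hm K (line (n + 1)) i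
    refine ⟨J, fun c a w N t hc ht => ?_⟩
    subst hc
    exact hJ (fun _ => []) w c.regs N t ht (fun a => a.elim0)
  | copy i j =>
    filter_upwards [exists_updateJob (A := A) (Γ := M.Γ) (r := M.r) (isAutomaticFun_id)
      (fun _ d => d.2 j) (fun _ => rfl)] with m hm K line n
    obtain ⟨J, hJ⟩ := hm K (line (n + 1)) i
    refine ⟨J, fun c a w N t hc ht => ?_⟩
    subst hc
    exact hJ (fun _ => c.regs j) w c.regs N t ht (fun _ p => rfl)
  | op i k F hF args =>
    filter_upwards [exists_updateJob (A := A) (Γ := M.Γ) (r := M.r) hF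
      (fun a d => d.2 (args a)) (fun _ => rfl)] with m hm K line n
    obtain ⟨J, hJ⟩ := hm K (line (n + 1)) i
    refine ⟨J, fun c a w N t hc ht => ?_⟩
    subst hc
    exact hJ (fun a => c.regs (args a)) w c.regs N t ht (fun _ p => rfl)
  | goto l =>
    refine Eventually.of_forall fun m K line n => ⟨growJob [] false (.inl (line l)),
      fun c a w N t hc ht => ?_⟩
    obtain ⟨t', h1, h2⟩ := growJob_result (u := []) (by simp) false (.inl (line l)) ht
    exact ⟨t', h1, by simpa [Machine.exec] using h2⟩
  | ifGoto k R hR args l =>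
    refine Eventually.of_forall fun m K line n => ?_
    obtain ⟨J, hJ⟩ := exists_testJob (A := A) (Γ := M.Γ) (r := M.r) hR
      (fun a d => d.2 (args a)) (fun _ => rfl) m K (line l) (line (n + 1))
    refine ⟨J, fun c a w N t hc ht => ⟨t, ?_, ht.1, fun p hp => ht.2 p (by omega)⟩⟩
    subst hc
    have := hJ (fun a => c.regs (args a)) w c.regs N t ht (fun _ p => rfl)
    rw [Machine.exec]
    convert this using 2
    split_ifs <;> rfl
  | halt v => exact absurd rfl (hI v)

/-- The program lines, with one more for all lines outside the program, in one of several phases. -/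
abbrev PhaseLine {Φ : Type} (n : ℕ) (b : Φ) (l : ℕ) : Φ × Fin (n + 1) :=
  (b, ⟨min l n, by omega⟩)

variable {Φ : Type} [Finite Φ]

/-- A sequence of runs of a DARM can be carried out by sweeps. In phase `b` the input word is the
image of the source word under `f b`; a run with verdict `v` appends `u b v` to the source word and
leads to the phase, or to the decision, `next b v`. -/
theorem exists_sweepJobs (M : Machine A) (hM : M.IsDARM) (f : Φ → A → A)
    (u : Φ → Verdict → List A) (next : Φ → Verdict → Φ ⊕ Bool) (L : ℕ)
    (hu : ∀ b v, (u b v).length ≤ L) :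
    ∃ (m : ℕ) (job : Φ × Fin (M.prog.length + 1) →
        SweepJob (Cell A M.Γ M.r m) (Φ × Fin (M.prog.length + 1))),
      ∀ [Finite (Cell A M.Γ M.r m)] (k₀) (inp : A ↪ Cell A M.Γ M.r m) (b : Φ) (s : ℕ) (w : List A)
        (N : ℕ) (t : ℕ → Cell A M.Γ M.r m) (v : Verdict), 0 < N →
        Represents w (fun _ => []) N t → (M.run (w.map (f b)) 0 s).result = some v →
        ∃ W ≤ s + 1, ∃ t', SweepReach A m job (Cell.blank A M.Γ M.r m) k₀ inp W
            (PhaseLine _ b 0) t N ((next b v).map (fun b' => PhaseLine _ b' 0) id) t' ∧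
          Represents (w ++ u b v) (fun _ => []) (N + W * (m + 1)) t' := by
  have hm : ∀ᶠ m in atTop, ∀ z : Φ × Fin (M.prog.length + 1),
      ∃ J : SweepJob (Cell A M.Γ M.r m) (Φ × Fin (M.prog.length + 1)),
        ∀ I, M.prog[z.2.val]? = some I → (∀ v, I ≠ .halt v) →
        ∀ (c : Config M.Γ M.r) (w : List A) (N : ℕ) (t : ℕ → Cell A M.Γ M.r m),
          c.pc = z.2.val → Represents w c.regs N t →
          ∃ t', SweepResult J (N + (m + 1)) t t'
              (.inl (PhaseLine _ z.1 (M.exec (w.map (f z.1)) 0 c I).pc)) ∧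
            Represents w (M.exec (w.map (f z.1)) 0 c I).regs (N + (m + 1)) t' := by
    refine eventually_all.2 fun z => ?_
    by_cases hz : ∃ I, M.prog[z.2.val]? = some I ∧ ∀ v, I ≠ .halt v
    · obtain ⟨I, hI, hv⟩ := hz
      have hb : ∀ i j p, I ≠ .readBoost i j p := by
        rintro i j p rfl
        exact hM i j p (List.mem_of_getElem? hI)
      filter_upwards [exists_instrJob M (f z.1) I hv hb] with m hm
      obtain ⟨J, hJ⟩ := hm _ (PhaseLine M.prog.length z.1) z.2.val
      refine ⟨J, fun I' hI' _ c w N t hc ht => ?_⟩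
      obtain rfl : I' = I := by simpa [hI] using hI'.symm
      exact hJ c 0 w N t hc ht
    · push Not at hz
      refine Eventually.of_forall fun m => ⟨growJob [] false (.inr false), fun I hI hv => ?_⟩
      obtain ⟨v, rfl⟩ := hz I hI
      exact absurd rfl (hv v)
  obtain ⟨m, hm, hLm⟩ := (hm.and (eventually_ge_atTop L)).exists
  choose J hJ using hm
  classical
  -- Halting becomes the preparation of the next run: the registers are emptied and the source word
  -- is extended.
  let job : Φ × Fin (M.prog.length + 1) →
      SweepJob (Cell A M.Γ M.r m) (Φ × Fin (M.prog.length + 1)) := fun z =>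
    match M.prog[z.2.val]? with
    | some (.halt v) => growJob (u z.1 v) true
        ((next z.1 v).map (fun b' => PhaseLine _ b' 0) id)
    | _ => J z
  refine ⟨m, job, fun {_} k₀ inp => ?_⟩
  have hline : ∀ {l : ℕ} {I}, M.prog[l]? = some I → min l M.prog.length = l := by
    intro l I h
    obtain ⟨h', -⟩ := List.getElem?_eq_some_iff.1 h
    omega
  have key : ∀ (b : Φ) (w : List A) (v : Verdict) (s : ℕ) (c : Config M.Γ M.r) (N : ℕ)
      (t : ℕ → Cell A M.Γ M.r m), 0 < N → Represents w c.regs N t → c.result = none →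
      ((M.step (w.map (f b)) 0)^[s] c).result = some v →
      ∃ W ≤ s, ∃ t', SweepReach A m job (Cell.blank A M.Γ M.r m) k₀ inp W
          (PhaseLine _ b c.pc) t N ((next b v).map (fun b' => PhaseLine _ b' 0) id) t' ∧
        Represents (w ++ u b v) (fun _ => []) (N + W * (m + 1)) t' := by
    intro b w v s
    induction s with
    | zero => intro c N t _ _ h1 h2; simp [h1] at h2
    | succ s ih =>
      intro c N t hN ht hc hs
      rw [Function.iterate_succ_apply] at hs
      -- Outside the program the configuration repeats itself, so the step is dropped without a
      -- sweep.
      rcases hI : M.prog[c.pc]? with _ | I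
      · have hstep : M.step (w.map (f b)) 0 c = c := by simp [Machine.step, hc, hI]
        rw [hstep] at hs
        obtain ⟨W, hW, h⟩ := ih c N t hN ht hc hs
        exact ⟨W, hW.trans s.le_succ, h⟩
      · have hstep : M.step (w.map (f b)) 0 c = M.exec (w.map (f b)) 0 c I := by
          simp [Machine.step, hc, hI]
        by_cases hv : ∃ v', I = .halt v'
        · obtain ⟨v', rfl⟩ := hv
          have hjob : job (PhaseLine _ b c.pc) = growJob (u b v') true
              ((next b v').map (fun b' => PhaseLine _ b' 0) id) := by
            simp only [job, hline hI, hI]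
          have hvv : v' = v := by
            rw [hstep, Machine.iterate_step_of_result_ne_none M _ _ (by simp [Machine.exec])] at hs
            simpa [Machine.exec] using hs
          subst hvv
          obtain ⟨t', h1, h2⟩ := growJob_result (m := m) (u := u b v')
            ((hu b v').trans (by omega)) true
            ((next b v').map (fun b' => PhaseLine M.prog.length b' 0) id) ht
          refine ⟨1, by omega, t', SweepReach.single hN ht.2 h2.2 ?_, by simpa using h2⟩
          rw [hjob]; exact h1
        · push Not at hv
          have hjob : job (PhaseLine _ b c.pc) = J (PhaseLine _ b c.pc) := by
            simp only [job, hline hI, hI]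
            cases I with
            | halt v' => exact absurd rfl (hv v')
            | _ => rfl
          obtain ⟨t', h1, h2⟩ := hJ (PhaseLine _ b c.pc) I (by simp only [hline hI, hI]) hv c w N t
            (by simp only [hline hI]) ht
          rw [← hjob] at h1
          rw [← hstep] at h1 h2
          have hres : (M.step (w.map (f b)) 0 c).result = none := by
            rw [hstep]
            cases I with
            | halt v' => exact absurd rfl (hv v')
            | readBoost i j p => simp only [Machine.exec]; split_ifs <;> exact hc
            | _ => exact hc
          obtain ⟨W, hW, t'', h3, h4⟩ := ih _ _ t' (by omega) h2 hres hs
          have h5 := SweepReach.single (E := m) (job := job) (k₀ := k₀) (inp := inp) hN ht.2 h2.2 h1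
          refine ⟨1 + W, by omega, t'', h5.trans (by simpa using h3), ?_⟩
          have : N + (1 + W) * (m + 1) = N + (m + 1) + W * (m + 1) := by ring
          rw [this]
          exact h4
  intro b s w N t v hN ht hs
  obtain ⟨W, hW, t', h⟩ := key b w v s M.init N t hN ht rfl hs
  exact ⟨W, by omega, t', h⟩

end Simulation

/-! ### Lengthening formulas without changing their satisfiability -/

section Padding

/-- The clause `x₀ ∨ ¬x₀ ∨ x₀`. -/
def tautClause : Clause := fun a => ⟨0, a ≠ 1⟩

theorem encodeClause_tautClause :
    encodeClause tautClause = [.zero, .plus, .bar, .zero, .minus, .bar, .zero, .plus] := by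
  rw [encodeClause_eq]; rfl

theorem encode_concat {φ : Formula} (hφ : φ ≠ []) (C : Clause) :
    Formula.encode (φ ++ [C]) = φ.encode ++ .amp :: encodeClause C := by
  obtain ⟨D, φ, rfl⟩ := List.exists_cons_of_ne_nil hφ
  rw [List.cons_append, encode_cons, encode_cons, List.flatMap_append]
  simp

/-- The formula with `j` additional clauses `x₀ ∨ ¬x₀ ∨ x₀`. -/
def padFormula (φ : Formula) (j : ℕ) : Formula := φ ++ List.replicate j tautClause

theorem encode_padFormula_succ {φ : Formula} (hφ : φ ≠ []) (j : ℕ) :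
    (padFormula φ (j + 1)).encode = (padFormula φ j).encode ++
      [.amp, .zero, .plus, .bar, .zero, .minus, .bar, .zero, .plus] := by
  rw [padFormula, List.replicate_succ', ← List.append_assoc, encode_concat (by simp [hφ]),
    encodeClause_tautClause]
  rfl

theorem length_encode_padFormula {φ : Formula} (hφ : φ ≠ []) (j : ℕ) :
    (padFormula φ j).encode.length = φ.encode.length + 9 * j := by
  induction j with
  | zero => simp [padFormula]
  | succ j ih => rw [encode_padFormula_succ hφ, List.length_append, ih]; simp; ring

/-- A formula with a clause already has a variable, so the bound covers `x₀`; for the empty formula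
the number would change. -/
theorem numVars_padFormula {φ : Formula} (hφ : φ ≠ []) (j : ℕ) :
    (padFormula φ j).numVars = φ.numVars := by
  refine eq_of_forall_ge_iff fun h => ?_
  rw [numVars_le_iff, numVars_le_iff]
  refine ⟨fun H C hC => H C (List.mem_append_left _ hC), fun H C hC a => ?_⟩
  rcases List.mem_append.1 hC with hC | hC
  · exact H C hC a
  · obtain ⟨D, hD⟩ := List.exists_mem_of_ne_nil φ hφ
    rw [List.eq_of_mem_replicate hC]
    exact (Nat.zero_le _).trans_lt (H D hD 0)

theorem satisfiable_padFormula (φ : Formula) (j : ℕ) :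
    (padFormula φ j).Satisfiable ↔ φ.Satisfiable := by
  refine ⟨fun ⟨v, hv⟩ => ⟨v, fun C hC => hv C (List.mem_append_left _ hC)⟩,
    fun ⟨v, hv⟩ => ⟨v, fun C hC => ?_⟩⟩
  rcases List.mem_append.1 hC with hC | hC
  · exact hv C hC
  · rw [List.eq_of_mem_replicate hC]
    cases h : v 0
    · exact ⟨1, by simpa [tautClause] using h⟩
    · exact ⟨0, by simpa [tautClause] using h⟩

/-- All signs become positive. -/
def posSym : SatSym → SatSym
  | .minus => .plus
  | a => a

/-- The formula in which all literals are made positive. -/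
def posFormula (φ : Formula) : Formula := φ.map fun C a => ⟨(C a).var, true⟩

theorem map_posSym_encodeLiteral (l : Literal) :
    (encodeLiteral l).map posSym = encodeLiteral ⟨l.var, true⟩ := by
  rw [encodeLiteral_eq, encodeLiteral_eq, List.map_append, List.map_map]
  congr 1
  · refine List.map_congr_left fun b _ => ?_
    cases b <;> rfl
  · cases l.pos <;> rfl

theorem map_posSym_encodeClause (C : Clause) :
    (encodeClause C).map posSym = encodeClause fun a => ⟨(C a).var, true⟩ := by
  rw [encodeClause_eq, encodeClause_eq]
  simp only [List.map_append, List.map_cons, map_posSym_encodeLiteral]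
  rfl

theorem map_posSym_encode (φ : Formula) : φ.encode.map posSym = (posFormula φ).encode := by
  cases φ with
  | nil => rfl
  | cons C φ =>
    rw [posFormula, List.map_cons, encode_cons, encode_cons, List.map_append,
      map_posSym_encodeClause, List.map_flatMap, List.flatMap_map]
    simp only [List.map_cons, map_posSym_encodeClause]
    rfl

theorem numVars_posFormula (φ : Formula) : (posFormula φ).numVars = φ.numVars := by
  refine eq_of_forall_ge_iff fun h => ?_
  simp [numVars_le_iff, posFormula]

theorem satisfiable_posFormula (φ : Formula) : (posFormula φ).Satisfiable := by
  refine ⟨fun _ => true, fun C hC => ⟨0, ?_⟩⟩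
  obtain ⟨D, -, rfl⟩ := List.mem_map.1 hC
  rfl

/-- Injectivity of the encoding is not needed: two formulas with the same encoding give the same run
of `satMachine`, whose verdict cannot be both acceptance and rejection. -/
theorem encode_mem_logVar3SAT_iff {c : ℕ} {φ : Formula} : φ.encode ∈ logVar3SAT c ↔
    φ.numVars ≤ c * Nat.log 2 φ.encode.length ∧ φ.Satisfiable := by
  refine ⟨fun ⟨φ', he, h⟩ => ?_, fun h => ⟨φ, rfl, h⟩⟩
  by_contra hn
  have h1 := (satMachine_run (c := c) φ 0).2 hn
  rw [← he] at h h1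
  rw [(satMachine_run (c := c) φ' 0).1 h] at h1
  simp at h1

end Padding

/-! ### From a fast DARM to a fast Turing machine for 3SAT -/

section Solver

/-- What the simulating machine appends to the source word after a run. -/
def solverPad : Bool → Verdict → List SatSym
  | true, .reject => [.amp, .zero, .plus, .bar, .zero, .minus, .bar, .zero, .plus]
  | _, _ => []

/-- How the simulating machine goes on after a run: in phase `true` it tests whether the source word
is long enough, in phase `false` whether the formula is satisfiable. -/
def solverNext : Bool → Verdict → Bool ⊕ Bool
  | true, .accept => .inl false
  | true, _ => .inl true
  | false, .accept => .inr true
  | false, _ => .inr false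

/-- There are at most `J` failed length tests, one successful test and one final run, each with at
most `C * (l + 9 * J + 1) + 1` sweeps. So both the number of sweeps and the tape length are `O((l +
1) * J ^ 2)`. -/
theorem solver_time_le {C m l J W : ℕ} (hJ : 1 ≤ J)
    (hW : W ≤ (J + 2) * (C * (l + 9 * J + 1) + 1)) :
    2 * W * (l + W * (m + 1)) ≤ 2 * (3 * (10 * C + 1)) ^ 2 * (m + 2) * ((l + 1) ^ 2 * J ^ 4) := by
  have h1 : l + 9 * J + 1 ≤ 10 * ((l + 1) * J) := by nlinarith
  have h2 : 1 ≤ (l + 1) * J := Nat.mul_pos (by omega) hJ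
  have h3 : C * (l + 9 * J + 1) + 1 ≤ (10 * C + 1) * ((l + 1) * J) := by nlinarith
  have h4 : W ≤ 3 * (10 * C + 1) * ((l + 1) * J ^ 2) := by
    calc W ≤ (J + 2) * (C * (l + 9 * J + 1) + 1) := hW
      _ ≤ (3 * J) * ((10 * C + 1) * ((l + 1) * J)) := Nat.mul_le_mul (by omega) h3
      _ = _ := by ring
  have h5 : l ≤ 3 * (10 * C + 1) * ((l + 1) * J ^ 2) := by
    have : 1 ≤ J ^ 2 := Nat.one_le_pow _ _ hJ
    calc l ≤ 1 * ((l + 1) * 1) := by omega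
      _ ≤ _ := by gcongr; omega
  generalize 3 * (10 * C + 1) = a at h4 h5 ⊢
  calc 2 * W * (l + W * (m + 1))
      ≤ 2 * (a * ((l + 1) * J ^ 2)) *
        (a * ((l + 1) * J ^ 2) + a * ((l + 1) * J ^ 2) * (m + 1)) := by gcongr
    _ = _ := by ring

/-- A fast DARM for `logVar3SAT c` yields a Turing machine for 3SAT. -/
theorem exists_solvesThreeSAT {c : ℕ} (hc : 1 ≤ c) {M : Machine SatSym} (hM : M.IsDARM)
    {T : ℕ → ℕ} {C : ℕ} (hT : ∀ n, T n ≤ C * (n + 1))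
    (hdec : ∀ x : List SatSym,
      (x ∈ logVar3SAT c → (M.run x 0 (T x.length)).result = some .accept) ∧
      (x ∉ logVar3SAT c → (M.run x 0 (T x.length)).result = some .reject))
    {δ : ℝ} (hδ : 4 ≤ c * δ) : ∃ M' : TuringMachine SatSym, SolvesThreeSAT M' δ := by
  obtain ⟨m, job, hsim⟩ := exists_sweepJobs M hM (fun b => if b then posSym else id) solverPad
    solverNext 9 (by rintro (_ | _) (_ | _ | _) <;> simp [solverPad])
  have := M.finΓ
  have : Finite (Cell SatSym M.Γ M.r m) := inferInstance
  let inp : SatSym ↪ Cell SatSym M.Γ M.r m :=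
    ⟨fun a => ((some a, fun _ => none), 0), fun a b h => by simpa using h⟩
  let k₀ : Bool × Fin (M.prog.length + 1) := PhaseLine _ true 0
  replace hsim := hsim k₀ inp
  -- The factor `16` comes from `J ^ 4`; the summand `1` pays for the single step on the empty
  -- formula.
  refine ⟨sweepTM m job (Cell.blank _ _ _ _) k₀ inp,
    ((2 * (3 * (10 * C + 1)) ^ 2 * (m + 2) * 16 + 1 : ℕ) : ℝ), 2, fun φ => ?_⟩
  -- Sweeps need a nonempty tape. The empty formula is satisfiable, and a blank leftmost cell is
  -- accepted at once.
  rcases eq_or_ne φ [] with rfl | hφ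
  · refine ⟨1, ?_, fun _ => ?_, fun h => absurd ⟨fun _ => true, by simp⟩ h⟩
    · have h1 : Formula.numVars [] = 0 := rfl
      rw [encode_nil, h1]
      push_cast
      simp
      positivity
    · change ((sweepTM m job _ k₀ inp).step ⟨.begin k₀, 0, fun _ => none⟩).state = _
      rw [sweepTM_step (q := .halt true) (s := none) (m := .stay) (by simp) rfl]
  set l := φ.encode.length with hl
  set h := φ.numVars with hh
  -- With `J` extra clauses the logarithm of the length is at least `h / c + 1`, and `c * (h / c +
  -- 1)` exceeds `h`.
  set J := 2 ^ (h / c + 1) with hJ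
  have hl0 : 0 < l := by
    obtain ⟨D, φ', rfl⟩ := List.exists_cons_of_ne_nil hφ
    rw [hl, encode_cons, encodeClause_eq]
    simp
  have hJex : h ≤ c * Nat.log 2 (l + 9 * J) := by
    have h1 : h / c + 1 ≤ Nat.log 2 (l + 9 * J) :=
      Nat.le_log_of_pow_le (by norm_num) (by omega)
    exact (Nat.lt_mul_div_succ h hc).le.trans (Nat.mul_le_mul_left c h1)
  have hex : ∃ j, h ≤ c * Nat.log 2 (l + 9 * j) := ⟨J, hJex⟩
  have hfind : Nat.find hex ≤ J := Nat.find_min' hex hJex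
  set j₀ := Nat.find hex with hj₀
  have hT' : ∀ j ≤ j₀, T (padFormula φ j).encode.length ≤ C * (l + 9 * J + 1) := by
    intro j hj
    refine (hT _).trans (Nat.mul_le_mul_left C ?_)
    rw [length_encode_padFormula hφ]; omega
  set B := C * (l + 9 * J + 1) with hB
  let t₀ : ℕ → Cell SatSym M.Γ M.r m := fun p => ((φ.encode[p]?, fun _ => none), 0)
  have ht₀ : Represents φ.encode (fun _ => []) l t₀ :=
    ⟨fun p => by simp [t₀], fun p hp => by simp [t₀, List.getElem?_eq_none (l := φ.encode) hp]⟩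
  -- Positive formulas are satisfiable, so membership reveals only whether the length suffices; the
  -- Turing machine never has to compute a logarithm or count variables.
  have hpos : ∀ j, ((padFormula φ j).encode.map posSym ∈ logVar3SAT c ↔
      h ≤ c * Nat.log 2 (l + 9 * j)) := by
    intro j
    have h1 := List.length_map posSym (as := (padFormula φ j).encode)
    rw [map_posSym_encode] at h1 ⊢
    rw [encode_mem_logVar3SAT_iff, numVars_posFormula, numVars_padFormula hφ, h1,
      length_encode_padFormula hφ]
    exact and_iff_left (satisfiable_posFormula _)
  -- By minimality of `j₀` every earlier test rejects, and each rejection appends one clause.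
  have hloop : ∀ j ≤ j₀, ∃ W ≤ j * (B + 1), ∃ t',
      SweepReach SatSym m job (Cell.blank _ _ _ _) k₀ inp W k₀ t₀ l (.inl k₀) t' ∧
        Represents (padFormula φ j).encode (fun _ => []) (l + W * (m + 1)) t' := by
    intro j
    induction j with
    | zero =>
      intro _
      exact ⟨0, by simp, t₀, SweepReach.refl ht₀.2, by simpa [padFormula] using ht₀⟩
    | succ j ih =>
      intro hj
      obtain ⟨W, hW, t', h1, h2⟩ := ih (by omega)
      have h3 := (hdec ((padFormula φ j).encode.map posSym)).2
        (by rw [hpos]; exact Nat.find_min hex (by omega))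
      rw [List.length_map] at h3
      obtain ⟨W', hW', t'', h4, h5⟩ := hsim true _ _ _ t' .reject (by omega) h2 h3
      refine ⟨W + W', ?_, t'', h1.trans h4, ?_⟩
      · have := hT' j (by omega)
        rw [add_mul]; omega
      · rw [encode_padFormula_succ hφ, show l + (W + W') * (m + 1) =
          l + W * (m + 1) + W' * (m + 1) by ring]
        exact h5
  obtain ⟨W, hW, t', h1, h2⟩ := hloop j₀ le_rfl
  have h3 := (hdec ((padFormula φ j₀).encode.map posSym)).1
    (by rw [hpos]; exact Nat.find_spec hex)
  rw [List.length_map] at h3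
  obtain ⟨W', hW', t'', h4, h5⟩ := hsim true _ _ _ t' .accept (by omega) h2 h3
  replace h1 := h1.trans h4
  have hmem : (padFormula φ j₀).encode ∈ logVar3SAT c ↔ φ.Satisfiable := by
    rw [encode_mem_logVar3SAT_iff, satisfiable_padFormula, numVars_padFormula hφ,
      length_encode_padFormula hφ]
    exact and_iff_right (Nat.find_spec hex)
  have hrun : ∀ v, (M.run (padFormula φ j₀).encode 0 (T (padFormula φ j₀).encode.length)).result =
      some v → ∃ t : ℕ, t ≤ 2 * (3 * (10 * C + 1)) ^ 2 * (m + 2) * ((l + 1) ^ 2 * J ^ 4) ∧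
        ((sweepTM m job (Cell.blank _ _ _ _) k₀ inp).run φ.encode t).state =
          .ofResult ((solverNext false v).map (fun b' => PhaseLine _ b' 0) id) := by
    intro v hv
    have e : (padFormula φ j₀).encode ++ solverPad true .accept =
      (padFormula φ j₀).encode := List.append_nil _
    rw [e] at h5
    obtain ⟨W'', hW'', t''', h6, -⟩ := hsim false (T (padFormula φ j₀).encode.length) _ _ t'' v
      (by omega) h5 (by simpa using hv)
    have e' : l + W * (m + 1) + W' * (m + 1) = l + (W + W') * (m + 1) := by ring
    rw [e'] at h6
    obtain ⟨b', t, ht, h7⟩ := (h1.trans h6).2 false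
    refine ⟨t, ht.trans (solver_time_le Nat.one_le_two_pow ?_), ?_⟩
    · have := hT' j₀ le_rfl
      have h8 : j₀ * (B + 1) ≤ J * (B + 1) := Nat.mul_le_mul_right _ hfind
      change W + W' + W'' ≤ (J + 2) * (B + 1)
      rw [add_mul]; omega
    · have hinit : (sweepTM m job (Cell.blank _ _ _ _) k₀ inp).init φ.encode =
          ⟨.begin k₀, 0, sweepTape false t₀ l⟩ := by
        rw [TuringMachine.init]
        congr 1
        funext p
        by_cases hp : p < l
        · simp [sweepTape, hp, t₀, List.getD_eq_getElem?_getD,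
            List.getElem?_eq_getElem (l := φ.encode) hp]
          rfl
        · simp [sweepTape, hp, List.getD_eq_getElem?_getD,
            List.getElem?_eq_none (l := φ.encode) (not_lt.1 hp)]
      rw [TuringMachine.run, hinit, h7]
  have htime : ∀ t : ℕ, t ≤ 2 * (3 * (10 * C + 1)) ^ 2 * (m + 2) * ((l + 1) ^ 2 * J ^ 4) →
      (t : ℝ) ≤ ((2 * (3 * (10 * C + 1)) ^ 2 * (m + 2) * 16 + 1 : ℕ) : ℝ) *
        (2 : ℝ) ^ (δ * (h : ℝ)) * ((l : ℝ) + 1) ^ 2 := by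
    intro t ht
    -- This fourth power is the origin of the condition `4 ≤ c * δ`.
    have h1 : J ^ 4 = 16 * 2 ^ (4 * (h / c)) := by
      rw [hJ, ← pow_mul, show (h / c + 1) * 4 = 4 + 4 * (h / c) by ring, pow_add]; norm_num
    have h2 : (2 : ℝ) ^ (4 * (h / c)) ≤ (2 : ℝ) ^ (δ * (h : ℝ)) := by
      rw [← Real.rpow_natCast]
      refine Real.rpow_le_rpow_of_exponent_le (by norm_num) ?_
      push_cast
      have hc' : (0 : ℝ) < c := by exact_mod_cast hc
      have h3 : ((h / c : ℕ) : ℝ) * c ≤ h := by exact_mod_cast Nat.div_mul_le_self h c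
      have h4 : (0 : ℝ) ≤ ((h / c : ℕ) : ℝ) := Nat.cast_nonneg _
      have hδ0 : 0 ≤ δ := by
        by_contra hn
        nlinarith
      calc 4 * ((h / c : ℕ) : ℝ) ≤ (c * δ) * ((h / c : ℕ) : ℝ) := by gcongr
        _ = δ * (((h / c : ℕ) : ℝ) * c) := by ring
        _ ≤ δ * h := by gcongr
    generalize 2 * (3 * (10 * C + 1)) ^ 2 * (m + 2) = a at ht ⊢
    have h5 : (t : ℝ) ≤ a * (((l : ℝ) + 1) ^ 2 * (16 * 2 ^ (4 * (h / c)))) := by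
      rw [h1] at ht; exact_mod_cast ht
    refine h5.trans ?_
    calc (a : ℝ) * (((l : ℝ) + 1) ^ 2 * (16 * 2 ^ (4 * (h / c))))
        ≤ a * (((l : ℝ) + 1) ^ 2 * (16 * (2 : ℝ) ^ (δ * (h : ℝ)))) := by gcongr
      _ = (a * 16) * (2 : ℝ) ^ (δ * (h : ℝ)) * ((l : ℝ) + 1) ^ 2 := by ring
      _ ≤ _ := by push_cast; gcongr; linarith
  have hx := hdec (padFormula φ j₀).encode
  rw [hmem] at hx
  by_cases hs : φ.Satisfiable
  · obtain ⟨t, ht, h6⟩ := hrun _ (hx.1 hs)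
    exact ⟨t, htime t ht, fun _ => h6, fun hn => absurd hs hn⟩
  · obtain ⟨t, ht, h6⟩ := hrun _ (hx.2 hs)
    exact ⟨t, htime t ht, fun hn => absurd hn hs, fun _ => h6⟩

/-- Only a linear bound on the steps is used; the finitely many lengths before the asymptotic bound
takes effect are absorbed by the sum of their step numbers. -/
theorem logVar3SAT_notMem_DALSublinear {δ : ℝ} (h : ∀ M, ¬ SolvesThreeSAT M δ) {c : ℕ}
    (hc : 1 ≤ c) (hδ : 4 ≤ c * δ) : logVar3SAT c ∉ DALSublinear SatSym := by
  rintro ⟨f, hf, M, hM, T, hT, hdec⟩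
  have h1 := (hT.trans_isLittleO hf).bound zero_lt_one
  obtain ⟨n₀, hn₀⟩ := eventually_atTop.1 h1
  have h2 : ∀ n, T n ≤ (∑ i ∈ Finset.range n₀, T i + 1) * (n + 1) := by
    intro n
    by_cases hn : n < n₀
    · have := Finset.single_le_sum (f := T) (fun i _ => Nat.zero_le _) (Finset.mem_range.2 hn)
      nlinarith [Nat.zero_le (T n * n), Nat.zero_le n, this,
        Nat.zero_le ((∑ i ∈ Finset.range n₀, T i) * n)]
    · have h3 := hn₀ n (not_lt.1 hn)
      simp only [Real.norm_natCast, one_mul] at h3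
      have h4 : T n ≤ n := by exact_mod_cast h3
      nlinarith [Nat.zero_le ((∑ i ∈ Finset.range n₀, T i) * (n + 1))]
  obtain ⟨M', hM'⟩ := exists_solvesThreeSAT hc hM h2 (fun x => hdec x 0) hδ
  exact h M' hM'

end Solver

end AutReg

/-! ### The theorem -/

theorem mainTheorem9 :
    (∀ (A : Type) [Finite A], AutReg.DALSublinear A ⊆ AutReg.PDALSublinear A) ∧
    (∀ c : ℕ, AutReg.logVar3SAT c ∈ AutReg.PDALPolylog AutReg.SatSym) ∧
    (AutReg.ETH →
      AutReg.DALSublinear AutReg.SatSym ⊂ AutReg.PDALSublinear AutReg.SatSym ∧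
      ∃ c₀ : ℕ, ∀ c : ℕ, c₀ ≤ c →
        AutReg.logVar3SAT c ∈
          AutReg.PDALSublinear AutReg.SatSym \ AutReg.DALSublinear AutReg.SatSym) := by
  refine ⟨fun A _ => AutReg.DALSublinear_subset_PDALSublinear A,
    AutReg.logVar3SAT_mem_PDALPolylog, fun ⟨δ, hδ, h⟩ => ?_⟩
  -- The ceiling secures `4 ≤ c * δ`, and the summand `1` gives `1 ≤ c` at once.
  have key : ∀ c : ℕ, ⌈4 / δ⌉₊ + 1 ≤ c → AutReg.logVar3SAT c ∈
      AutReg.PDALSublinear AutReg.SatSym \ AutReg.DALSublinear AutReg.SatSym := by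
    intro c hc
    refine ⟨AutReg.PDALPolylog_subset_PDALSublinear _ (AutReg.logVar3SAT_mem_PDALPolylog c),
      AutReg.logVar3SAT_notMem_DALSublinear h (by omega) ?_⟩
    have h1 : 4 / δ ≤ c := (Nat.le_ceil _).trans (by exact_mod_cast (by omega : ⌈4 / δ⌉₊ ≤ c))
    rwa [div_le_iff₀ hδ] at h1
  refine ⟨?_, _, key⟩
  rw [Set.ssubset_iff_of_subset (AutReg.DALSublinear_subset_PDALSublinear _)]
  exact ⟨_, (key _ le_rfl).1, (key _ le_rfl).2⟩
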